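/- **Setup.** Let $k,r\ge 0$ and let $Y_1,Y_2,\dots$ be independent, $Y_i\sim N_{n_i}(X_i\beta,V_i)$, where $X_i$ $(n_i\times k)$ and $Z_{ij}$ $(n_i\times q_j)$, $1\le j\le r$, are known matrices, $V_i=\sum_{j=0}^r\sigma_j^2U_{ij}$ with $U_{i0}=I_{n_i}$ and $U_{ij}=Z_{ij}Z_{ij}^\top$ for $j\ge 1$. The unknown parameter is $\theta=(\beta,\sigma_0^2,\dots,\sigma_r^2)$, with $\beta\in\mathbb R^k$ and all $\sigma_j^2>0$. Fix $\alpha\ge 0$, and put $\eta_i=(2\pi)^{-n_i\alpha/2}|V_i|^{-\alpha/2}$, $w_i=\eta_i\exp\{-\frac{\alpha}{2}(Y_i-X_i\beta)^\top V_i^{-1}(Y_i-X_i\beta)\}$. The minimum density power divergence estimating equations for the first $n$ groups are $$-\frac{1+\alpha}{n}\sum_{i=1}^n w_iX_i^\top V_i^{-1}(Y_i-X_i\beta)=0,$$ $$\frac1n\sum_{i=1}^n\Big\{-\frac{\alpha\,\eta_i\mathrm{Tr}(V_i^{-1}U_{ij})}{2(1+\alpha)^{n_i/2}}+\frac{1+\alpha}{2}w_i\big[\mathrm{Tr}(V_i^{-1}U_{ij})-(Y_i-X_i\beta)^\top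 V_i^{-1}U_{ij}V_i^{-1}(Y_i-X_i\beta)\big]\Big\}=0,\quad 0\le j\le r,$$ which for $\alpha=0$ are the likelihood equations. With $T(c,A,B)=c\alpha^2\mathrm{Tr}(A)\mathrm{Tr}(B)+2\mathrm{Tr}(AB)$ and $A_{ij}=V_i^{-1}U_{ij}$, let $\Psi_n=\frac1n\sum_{i\le n}\frac{\eta_i}{4}\,\mathrm{diag}(J^{(i)}_{11},J^{(i)}_{22})$ and $\Omega_n=\frac1n\sum_{i\le n}\frac{\eta_i^2}{4}\,\mathrm{diag}(\Omega^{(i)}_{11},\Omega^{(i)}_{22})$, where $$J^{(i)}_{11}=\frac{4X_i^\top V_i^{-1}X_i}{(1+\alpha)^{n_i/2+1}},\quad (J^{(i)}_{22})_{jl}=\frac{T(1,A_{ij},A_{il})}{(1+\alpha)^{n_i/2+2}},\quad \Omega^{(i)}_{11}=\frac{4X_i^\top V_i^{-1}X_i}{(1+2\alpha)^{n_i/2+1}},$$ $$(\Omega^{(i)}_{22})_{jl}=\frac{T(4,A_{ij},A_{il})}{(1+2\alpha)^{n_i/2+2}}-\frac{\alpha^2\mathrm{Tr}(A_{ij})\mathrm{Tr}(A_{il})}{(1+\alpha)^{n_i+2}}.$$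 Let $X'$ and $X^*$ be the matrices obtained by stacking, for $i=1,\dots,n$, the blocks $X'_i=\big(\eta_iV_i^{-1}/(1+\alpha)^{n_i/2+1}\big)^{1/2}X_i$ and $X^*_i=\big(\eta_i^2V_i^{-1}/(1+2\alpha)^{n_i/2+1}\big)^{1/2}X_i$. **Conditions**, at the true $\theta$ and for all indices $j,l,p$ ($X_{ij}$ is the $j$-th column of $X_i$; the absolute value of a vector is taken entrywise; $\mathbf 1$ is the vector of ones): * (MM1) The smallest eigenvalue of $\frac1nX'^\top X'$ and the smallest eigenvalue of $\frac1n\sum_{i\le n}\frac{\eta_i}{4}J^{(i)}_{22}$ are bounded away from zero for all large $n$. * (MM2) $|X_{ij}^\top V_i^{-1/2}|$ and $|X_{ij}^\top V_i^{-1}X_{il}|$ are bounded in $i$; $\frac1n\sum_{i\le n}|X_{ij}^\top V_i^{-1}X_{il}\,X_{ip}^\top V_i^{-1/2}\mathbf 1|$ and $\frac1n\sum_{i\le n}|X_{ij}^\top V_i^{-1/2}|\,\mathrm{diag}(V_i^{-1/2}X_{il}X_{ip}^\top V_i^{-1/2})\mathbf 1$ are $O(1)$. * (MM3) The averages over $i\le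 n$ of $\mathrm{Tr}A_{ij}$, $\mathrm{Tr}A_{ij}\mathrm{Tr}A_{il}$, $\mathrm{Tr}(A_{il}A_{ij})$, $\mathrm{Tr}(A_{ij}A_{il}A_{ip})$, $\mathrm{Tr}(A_{ij}A_{il})\mathrm{Tr}A_{ip}$ and $\mathrm{Tr}A_{ij}\mathrm{Tr}A_{il}\mathrm{Tr}A_{ip}$ are $O(1)$, and $|V_i|$ is bounded away from $0$ and $\infty$. * (MM4) The entries of $\frac1n(X^{*\top}X^*)^{-1}X_i^\top V_i^{-1}X_i$, $1\le i\le n$, are $O(1)$. **Theorem.** Under these conditions, as $n\to\infty$ with each $n_i$ fixed: (i) there are measurable functions $\hat\theta_n=(\hat\beta,\hat\sigma_0^2,\dots,\hat\sigma_r^2)$ of $(Y_1,\dots,Y_n)$ which, with probability tending to one, are roots of the estimating equations with all variance components positive, and which converge to $\theta$ in probability. For every such consistent sequence of roots $\hat\theta_n$: (ii) $\sqrt n(\hat\beta-\beta)$ and $\sqrt n(\hat\sigma_j^2-\sigma_j^2)_{0\le j\le r}$ are asymptotically independent, that is, $E[f(\cdot)g(\cdot)]-E[f(\cdot)]E[g(\cdot)]\to0$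 for all bounded continuous functions $f$ of the first and $g$ of the second; (iii) $\Omega_n^{-1/2}\Psi_n\sqrt n(\hat\theta_n-\theta)$ converges in distribution to $N(0,I_{k+r+1})$. In particular, $(X^{*\top}X^*)^{-1/2}(X'^\top X')(\hat\beta-\beta)$ converges in distribution to $N(0,I_k)$. -/

import Mathlib

open MeasureTheory ProbabilityTheory Filter Topology Asymptotics
open scoped Matrix MatrixOrder BoundedContinuousFunction

noncomputable section

namespace MixedModel

/-- The known part of a linear mixed model with `k` fixed effects and `r` random factors: for every
group `i` its size `m i`, the model matrix `X i` of the fixed effects and the model matrices `Z i j`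
of the random factors (`q j` is the number of levels of factor `j`). -/
structure Design (k r : ℕ) where
  m : ℕ → ℕ
  q : Fin r → ℕ
  X : (i : ℕ) → Matrix (Fin (m i)) (Fin k) ℝ
  Z : (i : ℕ) → (j : Fin r) → Matrix (Fin (m i)) (Fin (q j)) ℝ

/-- The vector `θ = (β ; σ₀², σ₁², …, σᵣ²)`. -/
abbrev Param (k r : ℕ) := EuclideanSpace ℝ (Fin k ⊕ Fin (r + 1))

variable {k r : ℕ}

/-- The vector `β` of fixed effects. -/
def fixedPart (θ : Param k r) : EuclideanSpace ℝ (Fin k) := WithLp.toLp 2 fun a => θ (Sum.inl a)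

/-- The vector `(σ₀², …, σᵣ²)` of variance components. -/
def varPart (θ : Param k r) : EuclideanSpace ℝ (Fin (r + 1)) :=
  WithLp.toLp 2 fun j => θ (Sum.inr j)

/-- The parameter space: `β` is arbitrary and all variance components are positive. -/
def paramSpace (k r : ℕ) : Set (Param k r) := {θ | ∀ j, 0 < varPart θ j}

namespace Design

variable (D : Design k r) (α : ℝ) (θ : Param k r)

/-- `U_{i0} = I` and `U_{ij} = Z_{ij} Z_{ij}ᵀ` for `j = 1, …, r`. -/
def U (i : ℕ) (j : Fin (r + 1)) : Matrix (Fin (D.m i)) (Fin (D.m i)) ℝ :=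
  Fin.cases 1 (fun j => D.Z i j * (D.Z i j)ᵀ) j

/-- `V_i = σ₀² I + ∑ⱼ σⱼ² Z_{ij} Z_{ij}ᵀ`. -/
def V (i : ℕ) : Matrix (Fin (D.m i)) (Fin (D.m i)) ℝ := ∑ j, varPart θ j • D.U i j

/-- The mean `X_i β` of the `i`-th response. -/
def mean (i : ℕ) : EuclideanSpace ℝ (Fin (D.m i)) := WithLp.toLp 2 (D.X i *ᵥ fixedPart θ)

/-- `η_{iα} = (2π)^{-n_i α / 2} |V_i|^{-α / 2}`. -/
def eta (i : ℕ) : ℝ :=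
  (2 * Real.pi) ^ (-(D.m i * α / 2)) * (D.V θ i).det ^ (-(α / 2))

/-- The matrix `V_i⁻¹ U_{ij}`. -/
def VU (i : ℕ) (j : Fin (r + 1)) : Matrix (Fin (D.m i)) (Fin (D.m i)) ℝ := (D.V θ i)⁻¹ * D.U i j

/-! ### The estimating equations -/

/-- The observations of the first `n` groups. -/
abbrev Sample (n : ℕ) := (i : Fin n) → EuclideanSpace ℝ (Fin (D.m i))

/-- The residual `y - X_i β`. -/
def resid (i : ℕ) (y : EuclideanSpace ℝ (Fin (D.m i))) : Fin (D.m i) → ℝ :=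
  y - D.mean θ i

/-- `exp(-(α/2) (y - X_i β)ᵀ V_i⁻¹ (y - X_i β)) / ((2π)^{n_i α / 2} |V_i|^{α / 2})`. -/
def weight (i : ℕ) (y : EuclideanSpace ℝ (Fin (D.m i))) : ℝ :=
  D.eta α θ i *
    Real.exp (-(α / 2) * (D.resid θ i y ⬝ᵥ ((D.V θ i)⁻¹ *ᵥ D.resid θ i y)))

/-- The left-hand side `∂H_n/∂β` of the estimating equations for `β`, with the product
`(1 + 1/α) α` written as `1 + α`, so that `α = 0` gives the likelihood equations. -/
def betaEq {n : ℕ} (y : D.Sample n) : Fin k → ℝ :=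
  (1 / n : ℝ) • ∑ i : Fin n,
    (-((1 + α) * D.weight α θ i (y i))) • ((D.X i)ᵀ *ᵥ ((D.V θ i)⁻¹ *ᵥ D.resid θ i (y i)))

/-- The left-hand side `∂H_n/∂σⱼ²` of the estimating equation for `σⱼ²`, with the product
`(α/2) (1 + 1/α)` written as `(1 + α)/2`. -/
def sigmaEq {n : ℕ} (y : D.Sample n) (j : Fin (r + 1)) : ℝ :=
  (1 / n : ℝ) * ∑ i : Fin n,
    (-(α * (D.VU θ i j).trace * D.eta α θ i / (2 * (α + 1) ^ ((D.m i : ℝ) / 2)))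
      + (1 + α) / 2 * D.weight α θ i (y i) *
        ((D.VU θ i j).trace -
          D.resid θ i (y i) ⬝ᵥ ((D.VU θ i j * (D.V θ i)⁻¹) *ᵥ D.resid θ i (y i))))

/-- `θ` is a root, in the parameter space, of the minimum density power divergence estimating
equations for the data `y`. -/
def IsRoot {n : ℕ} (y : D.Sample n) : Prop :=
  θ ∈ paramSpace k r ∧ D.betaEq α θ y = 0 ∧ ∀ j, D.sigmaEq α θ y j = 0

/-! ### The matrices `Ψ_n` and `Ω_n` -/

/-- `T(c, A, B) = c α² Tr(A) Tr(B) + 2 Tr(AB)`. -/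
def T {p : ℕ} (c : ℝ) (A B : Matrix (Fin p) (Fin p) ℝ) : ℝ :=
  c * α ^ 2 * A.trace * B.trace + 2 * (A * B).trace

/-- `J^{(i)}_{11}`. -/
def J11 (i : ℕ) : Matrix (Fin k) (Fin k) ℝ :=
  (4 / (1 + α) ^ ((D.m i : ℝ) / 2 + 1)) • ((D.X i)ᵀ * (D.V θ i)⁻¹ * D.X i)

/-- `J^{(i)}_{22}`. -/
def J22 (i : ℕ) : Matrix (Fin (r + 1)) (Fin (r + 1)) ℝ :=
  Matrix.of fun j l => T α 1 (D.VU θ i j) (D.VU θ i l) / (1 + α) ^ ((D.m i : ℝ) / 2 + 2)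

/-- `Ω^{(i)}_{11}`. -/
def Om11 (i : ℕ) : Matrix (Fin k) (Fin k) ℝ :=
  (4 / (1 + 2 * α) ^ ((D.m i : ℝ) / 2 + 1)) • ((D.X i)ᵀ * (D.V θ i)⁻¹ * D.X i)

/-- `Ω^{(i)}_{22}`. -/
def Om22 (i : ℕ) : Matrix (Fin (r + 1)) (Fin (r + 1)) ℝ :=
  Matrix.of fun j l =>
    T α 4 (D.VU θ i j) (D.VU θ i l) / (1 + 2 * α) ^ ((D.m i : ℝ) / 2 + 2)
      - α ^ 2 * (D.VU θ i l).trace * (D.VU θ i j).trace / (1 + α) ^ ((D.m i : ℝ) + 2)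

/-- `Ψ_n = n⁻¹ ∑_{i ≤ n} (η_{iα} / 4) J^{(i)}`. -/
def Psi (n : ℕ) : Matrix (Fin k ⊕ Fin (r + 1)) (Fin k ⊕ Fin (r + 1)) ℝ :=
  (1 / n : ℝ) • ∑ i ∈ Finset.range n,
    (D.eta α θ i / 4) • Matrix.fromBlocks (D.J11 α θ i) 0 0 (D.J22 α θ i)

/-- `Ω_n = n⁻¹ ∑_{i ≤ n} (η_{iα}² / 4) Ω^{(i)}`. -/
def Omega (n : ℕ) : Matrix (Fin k ⊕ Fin (r + 1)) (Fin k ⊕ Fin (r + 1)) ℝ :=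
  (1 / n : ℝ) • ∑ i ∈ Finset.range n,
    (D.eta α θ i ^ 2 / 4) • Matrix.fromBlocks (D.Om11 α θ i) 0 0 (D.Om22 α θ i)

/-! ### The conditions on the design -/

/-- `X'_i = (η_{iα} V_i⁻¹ / (1+α)^{n_i/2+1})^{1/2} X_i`. -/
def Xprime (i : ℕ) : Matrix (Fin (D.m i)) (Fin k) ℝ :=
  CFC.sqrt ((D.eta α θ i / (1 + α) ^ ((D.m i : ℝ) / 2 + 1)) • (D.V θ i)⁻¹) * D.X i

/-- `X*_i = (η_{iα}² V_i⁻¹ / (1+2α)^{n_i/2+1})^{1/2} X_i`. -/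
def Xstar (i : ℕ) : Matrix (Fin (D.m i)) (Fin k) ℝ :=
  CFC.sqrt ((D.eta α θ i ^ 2 / (1 + 2 * α) ^ ((D.m i : ℝ) / 2 + 1)) • (D.V θ i)⁻¹) * D.X i

/-- The matrix with `N = n_1 + ⋯ + n_n` rows and `k` columns obtained by stacking `n` blocks. -/
def stack (B : (i : ℕ) → Matrix (Fin (D.m i)) (Fin k) ℝ) (n : ℕ) :
    Matrix (Σ i : Fin n, Fin (D.m i)) (Fin k) ℝ :=
  Matrix.of fun p a => B p.1 p.2 a

/-- `X'ᵀ X'` for the first `n` groups. -/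
def gramPrime (n : ℕ) : Matrix (Fin k) (Fin k) ℝ :=
  (D.stack (D.Xprime α θ) n)ᵀ * D.stack (D.Xprime α θ) n

/-- `X*ᵀ X*` for the first `n` groups. -/
def gramStar (n : ℕ) : Matrix (Fin k) (Fin k) ℝ :=
  (D.stack (D.Xstar α θ) n)ᵀ * D.stack (D.Xstar α θ) n

/-- The smallest eigenvalues of the symmetric matrices `A n` are bounded away from zero for all
large `n` (by the Rayleigh quotient). -/
def EigBoundedBelow {p : ℕ} (A : ℕ → Matrix (Fin p) (Fin p) ℝ) : Prop :=
  ∃ c : ℝ, 0 < c ∧ ∀ᶠ n in atTop, ∀ v : Fin p → ℝ, c * (v ⬝ᵥ v) ≤ v ⬝ᵥ (A n *ᵥ v)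

/-- `n⁻¹ ∑_{i ≤ n} f i = O(1)`. -/
def AvgBounded (f : ℕ → ℝ) : Prop :=
  (fun n : ℕ => (1 / n : ℝ) * ∑ i ∈ Finset.range n, f i) =O[atTop] fun _ => (1 : ℝ)

/-- The vector `V_i^{-1/2} X_{ij}`, where `X_{ij}` is the `j`-th column of `X_i`. -/
def whiteCol (i : ℕ) (j : Fin k) : Fin (D.m i) → ℝ :=
  CFC.sqrt (D.V θ i)⁻¹ *ᵥ fun s => D.X i s j

/-- The scalar `X_{ij}ᵀ V_i⁻¹ X_{il}`. -/
def colProd (i : ℕ) (j l : Fin k) : ℝ :=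
  (fun s => D.X i s j) ⬝ᵥ ((D.V θ i)⁻¹ *ᵥ fun s => D.X i s l)

/-- Condition (MM1). -/
def MM1 : Prop := EigBoundedBelow fun n => (1 / n : ℝ) • D.gramPrime α θ n

/-- The counterpart of (MM1) for the variance components: the smallest eigenvalue of the block
`n⁻¹ ∑_{i ≤ n} (η_{iα} / 4) J^{(i)}_{22}` of `Ψ_n` is bounded away from zero. -/
def VarianceInfo : Prop :=
  EigBoundedBelow fun n =>
    (1 / n : ℝ) • ∑ i ∈ Finset.range n, (D.eta α θ i / 4) • D.J22 α θ i

/-- Condition (MM2). The absolute value of a vector is taken entry by entry, as the last of the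
four bounds requires. -/
structure MM2 : Prop where
  col_bdd : ∀ j, ∃ C : ℝ, ∀ i s, |D.whiteCol θ i j s| ≤ C
  prod_bdd : ∀ j l, ∃ C : ℝ, ∀ i, |D.colProd θ i j l| ≤ C
  avg_sum : ∀ j l p, AvgBounded fun i => |D.colProd θ i j l * ∑ s, D.whiteCol θ i p s|
  avg_diag : ∀ j l p, AvgBounded fun i =>
    ∑ s, |D.whiteCol θ i j s| * (D.whiteCol θ i l s * D.whiteCol θ i p s)

/-- Condition (MM3). -/
structure MM3 : Prop where
  tr : ∀ j, AvgBounded fun i => (D.VU θ i j).trace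
  tr_tr : ∀ j l, AvgBounded fun i => (D.VU θ i j).trace * (D.VU θ i l).trace
  tr_mul : ∀ j l, AvgBounded fun i => (D.VU θ i l * D.VU θ i j).trace
  tr_mul_mul : ∀ j l p, AvgBounded fun i => (D.VU θ i j * D.VU θ i l * D.VU θ i p).trace
  tr_mul_tr : ∀ j l p, AvgBounded fun i => (D.VU θ i j * D.VU θ i l).trace * (D.VU θ i p).trace
  tr_tr_tr : ∀ j l p, AvgBounded fun i =>
    (D.VU θ i j).trace * (D.VU θ i l).trace * (D.VU θ i p).trace
  det_bdd : ∃ c C : ℝ, 0 < c ∧ ∀ i, c ≤ (D.V θ i).det ∧ (D.V θ i).det ≤ C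

/-- Condition (MM4): the entries of `n⁻¹ (X*ᵀ X*)⁻¹ X_iᵀ V_i⁻¹ X_i`, `i ≤ n`, are bounded. -/
def MM4 : Prop :=
  ∃ C : ℝ, ∀ᶠ n : ℕ in atTop, ∀ i < n, ∀ a b,
    |((1 / n : ℝ) • ((D.gramStar α θ n)⁻¹ * ((D.X i)ᵀ * (D.V θ i)⁻¹ * D.X i))) a b| ≤ C

/-! ### The model and the asymptotic notions -/

variable {S : Type*} [MeasurableSpace S]

/-- The responses `Y_i` are independent and `Y_i ∼ N(X_i β, V_i)`. -/
structure IsModel (Y : (i : ℕ) → S → EuclideanSpace ℝ (Fin (D.m i))) (μ : Measure S) : Prop where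
  indep : iIndepFun Y μ
  law : ∀ i, HasLaw (Y i) (multivariateGaussian (D.mean θ i) (D.V θ i)) μ

/-- The random vectors `θhat n` are roots of the estimating equations for the first `n` responses,
with probability tending to one, and converge to `θ` in probability. -/
structure IsConsistentRoots (Y : (i : ℕ) → S → EuclideanSpace ℝ (Fin (D.m i))) (μ : Measure S)
    (θhat : ℕ → S → Param k r) : Prop where
  aemeasurable : ∀ n, AEMeasurable (θhat n) μ
  root : Tendsto (fun n => μ {ω | ¬ D.IsRoot α (θhat n ω) (fun i : Fin n => Y i ω)}) atTop (𝓝 0)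
  consistent : TendstoInMeasure μ θhat atTop fun _ => θ

end Design

/-- The random vectors `A n` and `B n` are asymptotically independent: for bounded continuous `f`
and `g` the difference between `E[f(A_n) g(B_n)]` and `E[f(A_n)] E[g(B_n)]` tends to zero. -/
def AsymptoticallyIndep {S E F : Type*} [MeasurableSpace S] [TopologicalSpace E]
    [TopologicalSpace F] (A : ℕ → S → E) (B : ℕ → S → F) (μ : Measure S) : Prop :=
  ∀ (f : E →ᵇ ℝ) (g : F →ᵇ ℝ),
    Tendsto (fun n => ∫ ω, f (A n ω) * g (B n ω) ∂μ - (∫ ω, f (A n ω) ∂μ) * ∫ ω, g (B n ω) ∂μ)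
      atTop (𝓝 0)

/-- The random vectors `A n` converge in distribution to the standard normal law. -/
def AsymptoticallyStdNormal {S ι : Type*} [Fintype ι] [MeasurableSpace S]
    (A : ℕ → S → EuclideanSpace ℝ ι) (μ : Measure S) [IsProbabilityMeasure μ] : Prop :=
  TendstoInDistribution A atTop (id : EuclideanSpace ℝ ι → EuclideanSpace ℝ ι)
    (fun _ => μ) (stdGaussian (EuclideanSpace ℝ ι))

end MixedModel

end

/-!
# Minimum density power divergence estimators in linear mixed models

Put `Wᵢ = Vᵢ(θ)^{-1/2}` at the true `θ`. The residuals `εᵢ = Wᵢ (Yᵢ - Xᵢ β)` are independent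
standard Gaussian vectors, and in terms of them the `i`-th summand of the estimating equations at
`θ + h` depends on the design only through `ηᵢ` and the linear maps `Z h = Wᵢ Xᵢ h_β`
and `B h = ∑ⱼ hⱼ Wᵢ Uᵢⱼ Wᵢ`, for which `Wᵢ Vᵢ(θ + h) Wᵢ = 1 + B h`. The operator norms of these maps
are bounded uniformly in `i`: that of `Z` by the bound for `Xᵀ V⁻¹ X`, and that of `B` because
`σⱼ² Wᵢ Uᵢⱼ Wᵢ ≤ 1`. So there is one ball of parameters on which every group is controlled
(`WhiteGroup`), with bounds that depend on the group only through powers of `1 + nᵢ + ‖εᵢ‖²`. As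
`nᵢ = ∑ⱼ σⱼ² Tr (Vᵢ⁻¹ Uᵢⱼ)`, the trace conditions bound the averages of `nᵢ³`, which is what all
the averages below need.

At `h = 0` the summands are, up to an additive constant, products of a polynomial of degree two in
`ε` and of `exp (-α ‖ε‖² / 2)`. Changing the scale of the Gaussian integral and using its moments
up to order four shows that they are centred, that the mean of their derivative is `(1 + α)` times
the summand of `Ψ_n`, and that their covariance is `(1 + α)²` times that of `Ω_n`
(`WhiteGroup.integral_estFun_zero`, `WhiteGroup.integral_estDeriv`,
`WhiteGroup.integral_estFun_mul`).

Let `T n h` be the left-hand sides of the estimating equations at `θ + h`. A law of large numbers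
for the derivatives at `h = 0`, together with a random Lipschitz bound for them, shows that `T n`
differs from the linear map `(1 + α) Ψ_n` by a map whose Lipschitz constant on small balls is
arbitrarily small, with probability tending to one (`LocallyLinear`). The eigenvalues of `Ψ_n` are
bounded away from zero, so the Newton iteration with this fixed linear map converges to a root,
and, being a limit of measurable iterates, that root is a measurable function of the data
(`LocallyLinear.exists_measurable_roots`). The same near-linearity gives, for every consistent
sequence of roots, `(1 + α) Ψ_n √n (θ̂ - θ) + √n T n 0 → 0` in probability
(`LocallyLinear.tendstoInMeasure_linearization`).

The eigenvalues of `Ω_n` are bounded away from zero as well: groups larger than some `M`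
contribute little to `Ψ_n`, and on the others the quadratic form of `Ω_n` dominates that of `Ψ_n`
up to a constant (`Design.exists_le_Omega`). A central limit theorem under Lyapunov's condition,
proved with characteristic functions, applies to `Ω_n^{-1/2} √n T n 0 / (1 + α)` and gives the
limit law of the roots. Since `Ψ_n` and `Ω_n` are block diagonal, the two parts of `√n (θ̂ - θ)`
are images, under linear maps that stay in a compact set, of two blocks of a vector whose limit
has independent blocks; along subsequences on which these linear maps converge this yields the
asymptotic independence (`asymptoticallyIndep_of_blocks`).
-/


set_option linter.unusedSectionVars false

namespace MixedModel


/-! ### Moments and exponential tilts of the standard Gaussian law -/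

section Gaussian

open scoped RealInnerProductSpace

variable {V : Type*} [NormedAddCommGroup V] [InnerProductSpace ℝ V]

/-- The trace of a continuous endomorphism. -/
noncomputable def trace (A : V →L[ℝ] V) : ℝ := LinearMap.trace ℝ V A

/-- The Gaussian log-likelihood score in the direction that moves the mean by `z` and the
covariance by `B`, at the standard Gaussian law. -/
noncomputable def score (z : V) (B : V →L[ℝ] V) (x : V) : ℝ :=
  ⟪z, x⟫ + (⟪x, B x⟫ - trace B) / 2

theorem abs_score_le (z : V) (B : V →L[ℝ] V) (x : V) :
    |score z B x| ≤ (‖z‖ + ‖B‖ + |trace B|) * (1 + ‖x‖) ^ 2 := by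
  have h1 := abs_real_inner_le_norm z x
  have h2 := abs_real_inner_le_norm x (B x)
  have h3 := B.le_opNorm x
  have h4 : |score z B x| ≤ |⟪z, x⟫| + (|⟪x, B x⟫| + |trace B|) / 2 := by
    rw [score]
    refine (abs_add_le _ _).trans (add_le_add le_rfl ?_)
    rw [abs_div, abs_two]
    gcongr
    exact abs_sub _ _
  have h5 : |⟪x, B x⟫| ≤ ‖B‖ * ‖x‖ ^ 2 := by nlinarith [norm_nonneg x]
  nlinarith [norm_nonneg x, norm_nonneg z, norm_nonneg B, abs_nonneg (trace B),
    mul_nonneg (norm_nonneg z) (norm_nonneg x), mul_nonneg (norm_nonneg B) (norm_nonneg x),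
    mul_nonneg (abs_nonneg (trace B)) (norm_nonneg x),
    mul_nonneg (norm_nonneg z) (sq_nonneg ‖x‖), mul_nonneg (norm_nonneg B) (sq_nonneg ‖x‖),
    mul_nonneg (abs_nonneg (trace B)) (sq_nonneg ‖x‖)]

variable [FiniteDimensional ℝ V]

theorem trace_eq_sum (A : V →L[ℝ] V) :
    trace A = ∑ i, ⟪stdOrthonormalBasis ℝ V i, A (stdOrthonormalBasis ℝ V i)⟫ := by
  rw [trace, LinearMap.trace_eq_sum_inner _ (stdOrthonormalBasis ℝ V)]
  rfl

theorem inner_apply_eq_sum (A : V →L[ℝ] V) (x : V) :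
    ⟪x, A x⟫ = ∑ i, ⟪stdOrthonormalBasis ℝ V i, x⟫ *
      ⟪ContinuousLinearMap.adjoint A (stdOrthonormalBasis ℝ V i), x⟫ := by
  rw [← (stdOrthonormalBasis ℝ V).sum_inner_mul_inner x (A x)]
  refine Finset.sum_congr rfl fun i _ => ?_
  rw [ContinuousLinearMap.adjoint_inner_left, real_inner_comm]

variable [MeasurableSpace V] [BorelSpace V]

/-- The fourth moment, read off from the fourth derivative of the moment generating function. -/
theorem integral_pow_four_gaussianReal (v : NNReal) :
    ∫ x, x ^ 4 ∂(gaussianReal 0 v) = 3 * (v : ℝ) ^ 2 := by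
  have h0 : (0 : ℝ) ∈ interior (integrableExpSet id (gaussianReal 0 v)) := by
    rw [integrableExpSet_id_gaussianReal]; simp
  have h := iteratedDeriv_mgf_zero h0 4
  have key : ∀ a b c d e : ℝ, ∀ t : ℝ, HasDerivAt
      (fun t : ℝ => (a + b * t + c * t ^ 2 + d * t ^ 3 + e * t ^ 4) * Real.exp (v * t ^ 2 / 2))
      ((b + 2 * c * t + 3 * d * t ^ 2 + 4 * e * t ^ 3 +
        (a + b * t + c * t ^ 2 + d * t ^ 3 + e * t ^ 4) * (v * t)) *
          Real.exp (v * t ^ 2 / 2)) t := by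
    intro a b c d e t
    have h1 : HasDerivAt (fun t : ℝ => (v : ℝ) * t ^ 2 / 2) (v * t) t := by
      have := (((hasDerivAt_id t).pow 2).const_mul (v : ℝ)).div_const 2
      convert! this using 1
      simp; ring
    have h2 : HasDerivAt (fun t : ℝ => a + b * t + c * t ^ 2 + d * t ^ 3 + e * t ^ 4)
        (b + 2 * c * t + 3 * d * t ^ 2 + 4 * e * t ^ 3) t := by
      have := (((((hasDerivAt_id t).const_mul b).const_add a).add
        (((hasDerivAt_id t).pow 2).const_mul c)).add
        (((hasDerivAt_id t).pow 3).const_mul d)).add (((hasDerivAt_id t).pow 4).const_mul e)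
      convert! this using 1
      simp; ring
    convert! h2.mul h1.exp using 1
    ring
  have hd : ∀ a b c d e : ℝ, deriv
      (fun t : ℝ => (a + b * t + c * t ^ 2 + d * t ^ 3 + e * t ^ 4) * Real.exp (v * t ^ 2 / 2))
      = fun t : ℝ => ((b + 2 * c * t + 3 * d * t ^ 2 + 4 * e * t ^ 3 +
        (a + b * t + c * t ^ 2 + d * t ^ 3 + e * t ^ 4) * (v * t)) *
          Real.exp (v * t ^ 2 / 2)) := fun a b c d e => funext fun t => (key a b c d e t).deriv
  have e0 : mgf id (gaussianReal 0 v) = fun t : ℝ =>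
      (1 + 0 * t + 0 * t ^ 2 + 0 * t ^ 3 + 0 * t ^ 4) * Real.exp (v * t ^ 2 / 2) := by
    rw [mgf_id_gaussianReal]; ext t; simp
  have e1 : iteratedDeriv 1 (mgf id (gaussianReal 0 v)) = fun t : ℝ =>
      (0 + v * t + 0 * t ^ 2 + 0 * t ^ 3 + 0 * t ^ 4) * Real.exp (v * t ^ 2 / 2) := by
    rw [iteratedDeriv_one, e0, hd]; ext t; ring
  have e2 : iteratedDeriv 2 (mgf id (gaussianReal 0 v)) = fun t : ℝ =>
      (v + 0 * t + v ^ 2 * t ^ 2 + 0 * t ^ 3 + 0 * t ^ 4) * Real.exp (v * t ^ 2 / 2) := by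
    rw [iteratedDeriv_succ, e1, hd]; ext t; ring
  have e3 : iteratedDeriv 3 (mgf id (gaussianReal 0 v)) = fun t : ℝ =>
      (0 + 3 * v ^ 2 * t + 0 * t ^ 2 + v ^ 3 * t ^ 3 + 0 * t ^ 4) *
        Real.exp (v * t ^ 2 / 2) := by
    rw [iteratedDeriv_succ, e2, hd]; ext t; ring
  rw [iteratedDeriv_succ, e3, hd] at h
  simpa using h.symm

theorem map_inner_stdGaussian (v : V) :
    (stdGaussian V).map (fun x => ⟪v, x⟫) = gaussianReal 0 (‖v‖ ^ 2).toNNReal := by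
  have := IsGaussian.map_eq_gaussianReal (μ := stdGaussian V) (innerSL ℝ v)
  rw [integral_strongDual_stdGaussian, variance_dual_stdGaussian] at this
  simpa using this

theorem integral_inner_pow_four (v : V) :
    ∫ x, ⟪v, x⟫ ^ 4 ∂(stdGaussian V) = 3 * ‖v‖ ^ 4 := by
  have h := integral_pow_four_gaussianReal (‖v‖ ^ 2).toNNReal
  rw [← map_inner_stdGaussian, integral_map (by fun_prop) (by fun_prop)] at h
  rw [h, Real.coe_toNNReal _ (by positivity)]
  ring

theorem integrable_norm_pow_stdGaussian (p : ℕ) :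
    Integrable (fun x : V => ‖x‖ ^ p) (stdGaussian V) := by
  rcases Nat.eq_zero_or_pos p with rfl | hp
  · simp
  · have := (IsGaussian.memLp_id (stdGaussian V) p (by simp)).integrable_norm_pow (by omega)
    simpa using this

theorem integrable_of_poly_bound {f : V → ℝ} (hf : AEStronglyMeasurable f (stdGaussian V))
    (C : ℝ) (p : ℕ) (h : ∀ x, |f x| ≤ C * (1 + ‖x‖) ^ p) : Integrable f (stdGaussian V) := by
  have hint : Integrable (fun x : V => C * (1 + ‖x‖) ^ p) (stdGaussian V) := by
    refine Integrable.const_mul ?_ C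
    simp_rw [add_pow]
    refine integrable_finsetSum _ fun i _ => ?_
    simp only [one_pow, one_mul]
    exact (integrable_norm_pow_stdGaussian _).mul_const _
  exact hint.mono' hf (Eventually.of_forall fun x => by simpa using h x)

theorem integrable_inner_mul (a b : V) :
    Integrable (fun x : V => ⟪a, x⟫ * ⟪b, x⟫) (stdGaussian V) := by
  refine integrable_of_poly_bound (by fun_prop) (‖a‖ * ‖b‖) 2 fun x => ?_
  rw [abs_mul]
  have h1 := abs_real_inner_le_norm a x
  have h2 := abs_real_inner_le_norm b x
  calc |⟪a, x⟫| * |⟪b, x⟫| ≤ (‖a‖ * ‖x‖) * (‖b‖ * ‖x‖) := by gcongr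
    _ = ‖a‖ * ‖b‖ * ‖x‖ ^ 2 := by ring
    _ ≤ _ := by gcongr; linarith [norm_nonneg x]

theorem integrable_inner_mul_four (a b c d : V) :
    Integrable (fun x : V => ⟪a, x⟫ * ⟪b, x⟫ * ⟪c, x⟫ * ⟪d, x⟫) (stdGaussian V) := by
  refine integrable_of_poly_bound (by fun_prop) (‖a‖ * ‖b‖ * ‖c‖ * ‖d‖) 4 fun x => ?_
  rw [abs_mul, abs_mul, abs_mul]
  have h1 := abs_real_inner_le_norm a x
  have h2 := abs_real_inner_le_norm b x
  have h3 := abs_real_inner_le_norm c x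
  have h4 := abs_real_inner_le_norm d x
  calc |⟪a, x⟫| * |⟪b, x⟫| * |⟪c, x⟫| * |⟪d, x⟫|
      ≤ (‖a‖ * ‖x‖) * (‖b‖ * ‖x‖) * (‖c‖ * ‖x‖) * (‖d‖ * ‖x‖) := by gcongr
    _ = ‖a‖ * ‖b‖ * ‖c‖ * ‖d‖ * ‖x‖ ^ 4 := by ring
    _ ≤ _ := by gcongr; linarith [norm_nonneg x]

theorem integral_inner_mul_inner (a b : V) :
    ∫ x, ⟪a, x⟫ * ⟪b, x⟫ ∂(stdGaussian V) = ⟪a, b⟫ := by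
  have h := congrArg (fun L => L a b) (covarianceBilin_stdGaussian (E := V))
  rw [covarianceBilin_apply IsGaussian.memLp_two_id] at h
  simp only [id, integral_id_stdGaussian, sub_zero] at h
  exact h

/-- Isserlis' formula for four Gaussian linear forms, by polarization of the fourth moment. -/
theorem integral_inner_mul_four (a b c d : V) :
    ∫ x, ⟪a, x⟫ * ⟪b, x⟫ * ⟪c, x⟫ * ⟪d, x⟫ ∂(stdGaussian V) =
      ⟪a, b⟫ * ⟪c, d⟫ + ⟪a, c⟫ * ⟪b, d⟫ + ⟪a, d⟫ * ⟪b, c⟫ := by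
  have hI : ∀ v : V, Integrable (fun x => ⟪v, x⟫ ^ 4) (stdGaussian V) := fun v => by
    have := integrable_inner_mul_four v v v v
    refine this.congr (Eventually.of_forall fun x => ?_)
    ring
  have e : ∀ x : V, ⟪a, x⟫ * ⟪b, x⟫ * ⟪c, x⟫ * ⟪d, x⟫ = (1 / 192) *
      (⟪a + b + c + d, x⟫ ^ 4 - ⟪a + b + c - d, x⟫ ^ 4 - ⟪a + b - c + d, x⟫ ^ 4
       - ⟪a - b + c + d, x⟫ ^ 4 + ⟪a + b - c - d, x⟫ ^ 4 + ⟪a - b + c - d, x⟫ ^ 4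
       + ⟪a - b - c + d, x⟫ ^ 4 - ⟪a - b - c - d, x⟫ ^ 4) := fun x => by
    simp only [inner_add_left, inner_sub_left]; ring
  simp_rw [e]
  rw [integral_const_mul, integral_sub, integral_add, integral_add, integral_add, integral_sub,
    integral_sub, integral_sub]
  · simp only [integral_inner_pow_four]
    have e4 : ∀ v : V, ‖v‖ ^ 4 = ⟪v, v⟫ ^ 2 := fun v => by
      rw [real_inner_self_eq_norm_sq]; ring
    simp only [e4, inner_add_left, inner_sub_left, inner_add_right, inner_sub_right,
      real_inner_comm a b, real_inner_comm a c, real_inner_comm a d, real_inner_comm b c,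
      real_inner_comm b d, real_inner_comm c d]
    ring
  all_goals first | exact hI _ | skip
  all_goals fun_prop (disch := assumption)

/-- The density of the standard Gaussian law with respect to the Lebesgue measure. -/
theorem stdGaussian_eq_withDensity :
    stdGaussian V = (volume : Measure V).withDensity fun x => ENNReal.ofReal
      ((2 * Real.pi) ^ (-(Module.finrank ℝ V / 2 : ℝ)) * Real.exp (-(1 / 2) * ‖x‖ ^ 2)) := by
  have hmeas : Measurable fun x : V =>
      (2 * Real.pi) ^ (-(Module.finrank ℝ V / 2 : ℝ)) * Real.exp (-(1 / 2) * ‖x‖ ^ 2) := by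
    fun_prop
  have hint : Integrable fun x : V =>
      (2 * Real.pi) ^ (-(Module.finrank ℝ V / 2 : ℝ)) * Real.exp (-(1 / 2) * ‖x‖ ^ 2) := by
    refine Integrable.const_mul ?_ _
    have := (GaussianFourier.integrable_cexp_neg_mul_sq_norm_add (V := V) (b := (1 / 2 : ℂ))
      (by norm_num) 0 0).norm
    refine this.congr (Eventually.of_forall fun x => ?_)
    simp [Complex.norm_exp, ← Complex.ofReal_pow]
  have : IsFiniteMeasure ((volume : Measure V).withDensity fun x => ENNReal.ofReal
      ((2 * Real.pi) ^ (-(Module.finrank ℝ V / 2 : ℝ)) * Real.exp (-(1 / 2) * ‖x‖ ^ 2))) :=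
    isFiniteMeasure_withDensity_ofReal hint.2
  refine Measure.ext_of_charFun (funext fun t => ?_)
  rw [charFun_stdGaussian, charFun_apply, integral_withDensity_eq_integral_toReal_smul
    (by fun_prop) (Eventually.of_forall fun x => ENNReal.ofReal_lt_top)]
  have h := GaussianFourier.integral_cexp_neg_mul_sq_norm_add (V := V) (b := (1 / 2 : ℂ))
    (by norm_num) Complex.I t
  have e : ∀ x : V, (ENNReal.ofReal ((2 * Real.pi) ^ (-(Module.finrank ℝ V / 2 : ℝ)) *
      Real.exp (-(1 / 2) * ‖x‖ ^ 2))).toReal • Complex.exp (⟪x, t⟫ * Complex.I) =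
      (((2 * Real.pi) ^ (-(Module.finrank ℝ V / 2 : ℝ)) : ℝ) : ℂ) *
        Complex.exp (-(1 / 2) * ‖x‖ ^ 2 + Complex.I * ⟪t, x⟫) := fun x => by
    rw [ENNReal.toReal_ofReal (by positivity), Complex.real_smul, Complex.ofReal_mul, mul_assoc,
      Complex.exp_add]
    push_cast
    rw [real_inner_comm t x, mul_comm Complex.I]
  simp_rw [e]
  rw [integral_const_mul, h, ← mul_assoc]
  have e2 : ((Real.pi : ℂ) / (1 / 2)) ^ (Module.finrank ℝ V / 2 : ℂ) =
      (((2 * Real.pi) ^ (Module.finrank ℝ V / 2 : ℝ) : ℝ) : ℂ) := by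
    rw [Complex.ofReal_cpow (by positivity)]
    push_cast
    congr 1
    ring
  rw [e2, ← Complex.ofReal_mul, ← Real.rpow_add (by positivity)]
  simp only [neg_add_cancel, Real.rpow_zero, Complex.ofReal_one, one_mul]
  congr 1
  rw [Complex.I_sq]
  ring

/-- An exponential tilt of the standard Gaussian law by `exp (-τ ‖x‖² / 2)` is, up to the factor
`(1 + τ) ^ (-N / 2)`, the law scaled by `(1 + τ) ^ (-1 / 2)`. -/
theorem integral_exp_mul_stdGaussian {τ : ℝ} (hτ : 0 ≤ τ) (F : V → ℝ) :
    ∫ x, Real.exp (-(τ / 2) * ‖x‖ ^ 2) * F x ∂(stdGaussian V) =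
      (1 + τ) ^ (-(Module.finrank ℝ V / 2 : ℝ)) *
        ∫ x, F ((√(1 + τ))⁻¹ • x) ∂(stdGaussian V) := by
  have hpos : (0 : ℝ) < 1 + τ := by linarith
  rw [stdGaussian_eq_withDensity, integral_withDensity_eq_integral_toReal_smul
    (by fun_prop) (Eventually.of_forall fun x => ENNReal.ofReal_lt_top),
    integral_withDensity_eq_integral_toReal_smul
    (by fun_prop) (Eventually.of_forall fun x => ENNReal.ofReal_lt_top)]
  set c : ℝ := (2 * Real.pi) ^ (-(Module.finrank ℝ V / 2 : ℝ)) with hc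
  have hc0 : 0 ≤ c := by positivity
  have e1 : ∀ x : V, (ENNReal.ofReal (c * Real.exp (-(1 / 2) * ‖x‖ ^ 2))).toReal •
      (Real.exp (-(τ / 2) * ‖x‖ ^ 2) * F x) =
      c * (Real.exp (-(1 / 2) * ‖√(1 + τ) • x‖ ^ 2) *
        F ((√(1 + τ))⁻¹ • √(1 + τ) • x)) := fun x => by
    rw [ENNReal.toReal_ofReal (by positivity), smul_smul, inv_mul_cancel₀ (by positivity),
      one_smul, norm_smul, mul_pow, Real.norm_eq_abs, sq_abs, Real.sq_sqrt hpos.le, smul_eq_mul,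
      mul_assoc, ← mul_assoc (Real.exp _), ← Real.exp_add]
    congr 4
    ring
  have e2 : ∀ x : V, (ENNReal.ofReal (c * Real.exp (-(1 / 2) * ‖x‖ ^ 2))).toReal •
      F ((√(1 + τ))⁻¹ • x) =
      c * (Real.exp (-(1 / 2) * ‖x‖ ^ 2) * F ((√(1 + τ))⁻¹ • x)) := fun x => by
    rw [ENNReal.toReal_ofReal (by positivity), smul_eq_mul, mul_assoc]
  simp_rw [e1, e2]
  rw [integral_const_mul, integral_const_mul, Measure.integral_comp_smul volume
    (fun x : V => Real.exp (-(1 / 2) * ‖x‖ ^ 2) * F ((√(1 + τ))⁻¹ • x))]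
  have e3 : |(√(1 + τ) ^ Module.finrank ℝ V)⁻¹| =
      (1 + τ) ^ (-(Module.finrank ℝ V / 2 : ℝ)) := by
    rw [abs_of_nonneg (by positivity), Real.sqrt_eq_rpow, ← Real.rpow_natCast, ← Real.rpow_mul
      hpos.le, ← Real.rpow_neg hpos.le]
    congr 1
    ring
  rw [e3, smul_eq_mul]
  ring

theorem integral_stdGaussian_eq_zero_of_odd {f : V → ℝ} (hf : ∀ x, f (-x) = -f x) :
    ∫ x, f x ∂(stdGaussian V) = 0 := by
  have h := stdGaussian_map (E := V) (LinearIsometryEquiv.neg ℝ)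
  have h2 : ∫ x, f (-x) ∂(stdGaussian V) = ∫ x, f x ∂(stdGaussian V) := by
    conv_rhs => rw [← h]
    exact ((LinearIsometryEquiv.neg ℝ (E := V)).toHomeomorph.measurableEmbedding.integral_map
      f).symm
  simp_rw [hf, integral_neg] at h2
  linarith

theorem integrable_quadratic (A : V →L[ℝ] V) :
    Integrable (fun x => ⟪x, A x⟫) (stdGaussian V) := by
  simp_rw [inner_apply_eq_sum]
  exact integrable_finsetSum _ fun i _ => integrable_inner_mul _ _

theorem integrable_quadratic_mul (A B : V →L[ℝ] V) :
    Integrable (fun x => ⟪x, A x⟫ * ⟪x, B x⟫) (stdGaussian V) := by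
  simp_rw [inner_apply_eq_sum, Finset.sum_mul_sum]
  refine integrable_finsetSum _ fun i _ => integrable_finsetSum _ fun j _ => ?_
  simp_rw [← mul_assoc]
  exact integrable_inner_mul_four _ _ _ _

theorem integral_quadratic (A : V →L[ℝ] V) :
    ∫ x, ⟪x, A x⟫ ∂(stdGaussian V) = trace A := by
  simp_rw [inner_apply_eq_sum]
  rw [integral_finsetSum _ fun i _ => integrable_inner_mul _ _, trace_eq_sum]
  refine Finset.sum_congr rfl fun i _ => ?_
  rw [integral_inner_mul_inner, ContinuousLinearMap.adjoint_inner_right, real_inner_comm]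

theorem integral_quadratic_mul {A B : V →L[ℝ] V} (hA : (A : V →ₗ[ℝ] V).IsSymmetric)
    (hB : (B : V →ₗ[ℝ] V).IsSymmetric) :
    ∫ x, ⟪x, A x⟫ * ⟪x, B x⟫ ∂(stdGaussian V) = trace A * trace B + 2 * trace (A * B) := by
  have hA' : ContinuousLinearMap.adjoint A = A := hA.isSelfAdjoint
  have hB' : ContinuousLinearMap.adjoint B = B := hB.isSelfAdjoint
  have hA2 : ∀ x y, ⟪A x, y⟫ = ⟪x, A y⟫ := hA
  have hB2 : ∀ x y, ⟪B x, y⟫ = ⟪x, B y⟫ := hB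
  set b := stdOrthonormalBasis ℝ V with hb
  simp_rw [inner_apply_eq_sum, hA', hB', Finset.sum_mul_sum]
  have hi : ∀ i j, Integrable (fun x => ⟪b i, x⟫ * ⟪A (b i), x⟫ * (⟪b j, x⟫ * ⟪B (b j), x⟫))
      (stdGaussian V) := fun i j => by
    simp_rw [← mul_assoc]
    exact integrable_inner_mul_four _ _ _ _
  rw [integral_finsetSum _ fun i _ => integrable_finsetSum _ fun j _ => hi i j]
  have e : ∀ i j, ∫ x, ⟪b i, x⟫ * ⟪A (b i), x⟫ * (⟪b j, x⟫ * ⟪B (b j), x⟫) ∂(stdGaussian V) =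
      ⟪b i, A (b i)⟫ * ⟪b j, B (b j)⟫ + ⟪b i, b j⟫ * ⟪A (b i), B (b j)⟫ +
        ⟪B (b i), b j⟫ * ⟪b j, A (b i)⟫ := fun i j => by
    rw [hB2, real_inner_comm (A (b i)) (b j), ← integral_inner_mul_four]
    refine integral_congr_ae (Eventually.of_forall fun x => ?_)
    exact (mul_assoc _ _ _).symm
  have e2 : trace (A * B) = ∑ i, ⟪A (b i), B (b i)⟫ := by
    rw [trace_eq_sum]
    exact Finset.sum_congr rfl fun i _ => (hA2 _ _).symm
  calc _ = ∑ i, ∑ j, (⟪b i, A (b i)⟫ * ⟪b j, B (b j)⟫ + ⟪b i, b j⟫ * ⟪A (b i), B (b j)⟫ +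
        ⟪B (b i), b j⟫ * ⟪b j, A (b i)⟫) := by
        refine Finset.sum_congr rfl fun i _ => ?_
        rw [integral_finsetSum _ fun j _ => hi i j]
        exact Finset.sum_congr rfl fun j _ => e i j
    _ = _ := by
        simp_rw [Finset.sum_add_distrib, b.sum_inner_mul_inner]
        rw [trace_eq_sum, trace_eq_sum, Finset.sum_mul_sum, e2]
        simp_rw [orthonormal_iff_ite.mp b.orthonormal, ite_mul, one_mul, zero_mul,
          Finset.sum_ite_eq, Finset.mem_univ, if_true, fun i => real_inner_comm (A (b i)) (B (b i))]
        ring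

theorem integral_exp_mul_quadratic {τ : ℝ} (hτ : 0 ≤ τ) (c : ℝ) (l : V) (A : V →L[ℝ] V) :
    ∫ x, Real.exp (-(τ / 2) * ‖x‖ ^ 2) * (c + ⟪l, x⟫ + ⟪x, A x⟫) ∂(stdGaussian V) =
      (1 + τ) ^ (-(Module.finrank ℝ V / 2 : ℝ)) * (c + (1 + τ)⁻¹ * trace A) := by
  rw [integral_exp_mul_stdGaussian hτ (fun x => c + ⟪l, x⟫ + ⟪x, A x⟫)]
  congr 1
  have hs : (√(1 + τ))⁻¹ * (√(1 + τ))⁻¹ = (1 + τ)⁻¹ := by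
    rw [← mul_inv, Real.mul_self_sqrt (by linarith)]
  simp_rw [map_smul, inner_smul_left, inner_smul_right, ← mul_assoc, conj_trivial, hs]
  have hl : Integrable (fun x => (√(1 + τ))⁻¹ * ⟪l, x⟫) (stdGaussian V) := by
    refine integrable_of_poly_bound (by fun_prop) (|(√(1 + τ))⁻¹| * ‖l‖) 1 fun x => ?_
    rw [abs_mul, mul_assoc]
    gcongr
    have := abs_real_inner_le_norm l x
    nlinarith [norm_nonneg l]
  have hl' : Integrable (fun x => c + (√(1 + τ))⁻¹ * ⟪l, x⟫) (stdGaussian V) :=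
    (integrable_const _).add hl
  rw [integral_add hl' ((integrable_quadratic A).const_mul _),
    integral_add (integrable_const _) hl, integral_const_mul, integral_const_mul,
    integral_quadratic,
    integral_stdGaussian_eq_zero_of_odd (f := fun x => ⟪l, x⟫) fun x => inner_neg_right _ _]
  simp

/-- The tilted mean of the score. It vanishes for `τ = 0` and is otherwise the bias that the
second term of the estimating functions corrects. -/
theorem integral_exp_mul_score {τ : ℝ} (hτ : 0 ≤ τ) (z : V) (B : V →L[ℝ] V) :
    ∫ x, Real.exp (-(τ / 2) * ‖x‖ ^ 2) * score z B x ∂(stdGaussian V) =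
      (1 + τ) ^ (-(Module.finrank ℝ V / 2 : ℝ)) * (((1 + τ)⁻¹ - 1) * trace B / 2) := by
  have h := integral_exp_mul_quadratic hτ (-(trace B) / 2) z ((1 / 2 : ℝ) • B)
  have e : ∀ x, score z B x = -(trace B) / 2 + ⟪z, x⟫ + ⟪x, ((1 / 2 : ℝ) • B) x⟫ := fun x => by
    simp only [score, smul_apply, inner_smul_right]; ring
  simp_rw [e]
  have h2 : trace ((1 / 2 : ℝ) • B) = 1 / 2 * trace B := by
    rw [trace, ContinuousLinearMap.toLinearMap_smul, map_smul, smul_eq_mul, trace]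
  rw [h, h2]
  ring

/-- The tilted second moments of the scores. After the change of scale the product splits into an
odd part, whose integral is zero, and even parts of degree two and four. -/
theorem integral_exp_mul_score_mul_score {τ : ℝ} (hτ : 0 ≤ τ) (z z' : V) {B B' : V →L[ℝ] V}
    (hB : (B : V →ₗ[ℝ] V).IsSymmetric) (hB' : (B' : V →ₗ[ℝ] V).IsSymmetric) :
    ∫ x, Real.exp (-(τ / 2) * ‖x‖ ^ 2) * (score z B x * score z' B' x) ∂(stdGaussian V) =
      (1 + τ) ^ (-(Module.finrank ℝ V / 2 : ℝ)) * ((1 + τ)⁻¹ * ⟪z, z'⟫ +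
        ((1 - (1 + τ)⁻¹) ^ 2 * (trace B * trace B') + 2 * (1 + τ)⁻¹ ^ 2 * trace (B * B')) / 4) := by
  rw [integral_exp_mul_stdGaussian hτ (fun x => score z B x * score z' B' x)]
  congr 1
  have hs : (√(1 + τ))⁻¹ ^ 2 = (1 + τ)⁻¹ := by
    rw [inv_pow, Real.sq_sqrt (by linarith)]
  set s := (√(1 + τ))⁻¹ with hsdef
  set κ := (1 + τ)⁻¹ with hκ
  -- The odd part of the product of the rescaled scores.
  set f : V → ℝ := fun x => s / 2 * (⟪z, x⟫ * (κ * ⟪x, B' x⟫ - trace B') +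
    ⟪z', x⟫ * (κ * ⟪x, B x⟫ - trace B)) with hf
  have e : ∀ x, score z B (s • x) * score z' B' (s • x) =
      f x + (κ * (⟪z, x⟫ * ⟪z', x⟫) + (κ ^ 2 / 4) * (⟪x, B x⟫ * ⟪x, B' x⟫)
       - (κ * trace B' / 4) * ⟪x, B x⟫ - (κ * trace B / 4) * ⟪x, B' x⟫
        + trace B * trace B' / 4) := fun x => by
    simp only [score, hf, map_smul, inner_smul_left, inner_smul_right, conj_trivial, ← hs]
    ring
  simp_rw [e]
  have hfi : Integrable f (stdGaussian V) := by
    refine integrable_of_poly_bound (by fun_prop)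
      (|s / 2| * (‖z‖ * (|κ| * ‖B'‖ + |trace B'|) + ‖z'‖ * (|κ| * ‖B‖ + |trace B|))) 3 fun x => ?_
    simp only [hf]
    rw [abs_mul, mul_assoc]
    gcongr
    have hq : ∀ (C : V →L[ℝ] V), |κ * ⟪x, C x⟫ - trace C| ≤
        (|κ| * ‖C‖ + |trace C|) * (1 + ‖x‖) ^ 2 := fun C => by
      have h1 : |⟪x, C x⟫| ≤ ‖C‖ * ‖x‖ ^ 2 := by
        have := abs_real_inner_le_norm x (C x)
        have := C.le_opNorm x
        nlinarith [norm_nonneg x]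
      calc |κ * ⟪x, C x⟫ - trace C| ≤ |κ| * |⟪x, C x⟫| + |trace C| := by
            rw [← abs_mul]; exact abs_sub _ _
        _ ≤ |κ| * (‖C‖ * (1 + ‖x‖) ^ 2) + |trace C| * (1 + ‖x‖) ^ 2 := by
            gcongr
            · refine h1.trans ?_
              gcongr
              linarith
            · refine le_mul_of_one_le_right (abs_nonneg _) (one_le_pow₀ ?_)
              linarith [norm_nonneg x]
        _ = _ := by ring
    have hz : ∀ w : V, |⟪w, x⟫| ≤ ‖w‖ * (1 + ‖x‖) := fun w =>
      (abs_real_inner_le_norm w x).trans (by gcongr; linarith)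
    calc _ ≤ |⟪z, x⟫| * |κ * ⟪x, B' x⟫ - trace B'| + |⟪z', x⟫| * |κ * ⟪x, B x⟫ - trace B| := by
          rw [← abs_mul, ← abs_mul]; exact abs_add_le _ _
      _ ≤ (‖z‖ * (1 + ‖x‖)) * ((|κ| * ‖B'‖ + |trace B'|) * (1 + ‖x‖) ^ 2) +
          (‖z'‖ * (1 + ‖x‖)) * ((|κ| * ‖B‖ + |trace B|) * (1 + ‖x‖) ^ 2) := by
          gcongr
          exacts [hz z, hq B', hz z', hq B]
      _ = _ := by ring
  have h1 := (integrable_inner_mul z z').const_mul κ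
  have h2 := (integrable_quadratic_mul B B').const_mul (κ ^ 2 / 4)
  have h3 := (integrable_quadratic B).const_mul (κ * trace B' / 4)
  have h4 := (integrable_quadratic B').const_mul (κ * trace B / 4)
  have h12 : Integrable (fun x => κ * (⟪z, x⟫ * ⟪z', x⟫) +
      κ ^ 2 / 4 * (⟪x, B x⟫ * ⟪x, B' x⟫)) (stdGaussian V) := h1.add h2
  have h13 : Integrable (fun x => κ * (⟪z, x⟫ * ⟪z', x⟫) +
      κ ^ 2 / 4 * (⟪x, B x⟫ * ⟪x, B' x⟫) - κ * trace B' / 4 * ⟪x, B x⟫) (stdGaussian V) :=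
    h12.sub h3
  have h14 : Integrable (fun x => κ * (⟪z, x⟫ * ⟪z', x⟫) +
      κ ^ 2 / 4 * (⟪x, B x⟫ * ⟪x, B' x⟫) - κ * trace B' / 4 * ⟪x, B x⟫ -
        κ * trace B / 4 * ⟪x, B' x⟫) (stdGaussian V) := h13.sub h4
  have h15 : Integrable (fun x => κ * (⟪z, x⟫ * ⟪z', x⟫) +
      κ ^ 2 / 4 * (⟪x, B x⟫ * ⟪x, B' x⟫) - κ * trace B' / 4 * ⟪x, B x⟫ -
        κ * trace B / 4 * ⟪x, B' x⟫ + trace B * trace B' / 4) (stdGaussian V) :=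
    h14.add (integrable_const _)
  rw [integral_add hfi h15, integral_stdGaussian_eq_zero_of_odd (f := f),
    integral_add h14 (integrable_const _), integral_sub h13 h4, integral_sub h12 h3,
    integral_add h1 h2,
    integral_const_mul, integral_const_mul, integral_const_mul, integral_const_mul,
    integral_inner_mul_inner, integral_quadratic_mul hB hB', integral_quadratic,
    integral_quadratic]
  · simp only [integral_const, probReal_univ, smul_eq_mul]
    ring
  · intro x
    simp only [hf, map_neg, inner_neg_right, inner_neg_left]
    ring

theorem integrable_exp_mul {τ : ℝ} (hτ : 0 ≤ τ) {f : V → ℝ}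
    (hf : AEStronglyMeasurable f (stdGaussian V))
    (C : ℝ) (p : ℕ) (h : ∀ x, |f x| ≤ C * (1 + ‖x‖) ^ p) :
    Integrable (fun x => Real.exp (-(τ / 2) * ‖x‖ ^ 2) * f x) (stdGaussian V) := by
  refine integrable_of_poly_bound (by fun_prop) C p fun x => ?_
  rw [abs_mul, abs_of_pos (Real.exp_pos _)]
  refine (mul_le_of_le_one_left (abs_nonneg _) ?_).trans (h x)
  rw [Real.exp_le_one_iff]
  nlinarith [sq_nonneg ‖x‖, mul_nonneg hτ (sq_nonneg ‖x‖)]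

theorem integrable_exp_mul_score {τ : ℝ} (hτ : 0 ≤ τ) (z : V) (B : V →L[ℝ] V) :
    Integrable (fun x => Real.exp (-(τ / 2) * ‖x‖ ^ 2) * score z B x) (stdGaussian V) :=
  integrable_exp_mul hτ (by unfold score; fun_prop) _ 2 (abs_score_le z B)

theorem integrable_exp_mul_score_mul_score {τ : ℝ} (hτ : 0 ≤ τ) (z z' : V) (B B' : V →L[ℝ] V) :
    Integrable (fun x => Real.exp (-(τ / 2) * ‖x‖ ^ 2) * (score z B x * score z' B' x))
      (stdGaussian V) := by
  refine integrable_exp_mul hτ (by unfold score; fun_prop)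
    ((‖z‖ + ‖B‖ + |trace B|) * (‖z'‖ + ‖B'‖ + |trace B'|)) 4 fun x => ?_
  rw [abs_mul]
  calc _ ≤ ((‖z‖ + ‖B‖ + |trace B|) * (1 + ‖x‖) ^ 2) *
        ((‖z'‖ + ‖B'‖ + |trace B'|) * (1 + ‖x‖) ^ 2) := by
        gcongr <;> exact abs_score_le _ _ _
    _ = _ := by ring

theorem integrable_exp_mul_quadratic {τ : ℝ} (hτ : 0 ≤ τ) (c : ℝ) (l : V) (A : V →L[ℝ] V) :
    Integrable (fun x => Real.exp (-(τ / 2) * ‖x‖ ^ 2) * (c + ⟪l, x⟫ + ⟪x, A x⟫))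
      (stdGaussian V) := by
  refine integrable_exp_mul hτ (by fun_prop) (2 * (|c| + ‖l‖ + ‖A‖)) 2 fun x => ?_
  have h1 := abs_real_inner_le_norm l x
  have h2 := abs_real_inner_le_norm x (A x)
  have h3 := A.le_opNorm x
  have h5 : |⟪x, A x⟫| ≤ ‖A‖ * ‖x‖ ^ 2 := by nlinarith [norm_nonneg x]
  have h4 : |c + ⟪l, x⟫ + ⟪x, A x⟫| ≤ |c| + |⟪l, x⟫| + |⟪x, A x⟫| := abs_add_three _ _ _
  nlinarith [norm_nonneg x, norm_nonneg l, norm_nonneg A, abs_nonneg c,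
    mul_nonneg (norm_nonneg l) (norm_nonneg x), mul_nonneg (norm_nonneg A) (norm_nonneg x),
    mul_nonneg (abs_nonneg c) (norm_nonneg x),
    mul_nonneg (norm_nonneg l) (sq_nonneg ‖x‖), mul_nonneg (norm_nonneg A) (sq_nonneg ‖x‖),
    mul_nonneg (abs_nonneg c) (sq_nonneg ‖x‖)]

/-- The moments of `1 + N + ‖x‖²`, in dimension `N`, grow like the powers of `1 + N`. -/
theorem exists_integral_pow_le (p : ℕ) : ∃ C : ℝ, 0 ≤ C ∧
    ∀ (V : Type) [NormedAddCommGroup V] [InnerProductSpace ℝ V] [FiniteDimensional ℝ V]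
      [MeasurableSpace V] [BorelSpace V],
      ∫ x, (1 + Module.finrank ℝ V + ‖x‖ ^ 2) ^ (p + 1) ∂(stdGaussian V) ≤
        C * (1 + Module.finrank ℝ V) ^ (p + 1) := by
  set m : ℝ := ∫ x, x ^ (2 * (p + 1)) ∂(gaussianReal 0 1) with hm
  have hm0 : 0 ≤ m := integral_nonneg fun x => by
    change 0 ≤ x ^ (2 * (p + 1)); rw [pow_mul]; positivity
  refine ⟨2 ^ p * (1 + m), by positivity, ?_⟩
  intro V _ _ _ _ _
  set N := Module.finrank ℝ V with hN
  set b := stdOrthonormalBasis ℝ V with hb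
  have hmom : ∀ i, ∫ x, ⟪b i, x⟫ ^ (2 * (p + 1)) ∂(stdGaussian V) = m := fun i => by
    have h := map_inner_stdGaussian (b i)
    rw [b.orthonormal.norm_eq_one i] at h
    simp only [one_pow, Real.toNNReal_one] at h
    rw [hm, ← h, integral_map (by fun_prop) (by fun_prop)]
  have hint : ∀ i, Integrable (fun x => ⟪b i, x⟫ ^ (2 * (p + 1))) (stdGaussian V) := fun i => by
    refine integrable_of_poly_bound (by fun_prop) 1 (2 * (p + 1)) fun x => ?_
    rw [abs_pow, one_mul]
    gcongr
    have := abs_real_inner_le_norm (b i) x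
    rw [b.orthonormal.norm_eq_one i] at this
    linarith
  have hle : ∀ x : V, (1 + (N : ℝ) + ‖x‖ ^ 2) ^ (p + 1) ≤ 2 ^ p * ((1 + N) ^ (p + 1) +
      N ^ p * ∑ i, ⟪b i, x⟫ ^ (2 * (p + 1))) := fun x => by
    have h1 : (1 + (N : ℝ) + ‖x‖ ^ 2) ^ (p + 1) ≤
        2 ^ p * ((1 + N) ^ (p + 1) + (‖x‖ ^ 2) ^ (p + 1)) := by
      simpa using add_pow_le (by positivity : (0 : ℝ) ≤ 1 + N) (sq_nonneg ‖x‖) (p + 1)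
    refine h1.trans ?_
    gcongr
    rw [← b.sum_sq_inner_right x]
    rcases Nat.eq_zero_or_pos N with h0 | h0
    · have : IsEmpty (Fin N) := by rw [h0]; infer_instance
      simp
    · have h2 := pow_sum_div_card_le_sum_pow (s := Finset.univ) (f := fun i => ⟪b i, x⟫ ^ 2)
        (fun i _ => sq_nonneg _) p
      have h0' : (0 : ℝ) < N := by exact_mod_cast h0
      rw [div_le_iff₀ (by rw [Finset.card_univ, Fintype.card_fin]; positivity)] at h2
      simp only [Finset.card_univ, Fintype.card_fin, ← pow_mul] at h2
      rw [mul_comm]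
      exact h2
  calc _ ≤ ∫ x, 2 ^ p * ((1 + (N : ℝ)) ^ (p + 1) +
      N ^ p * ∑ i, ⟪b i, x⟫ ^ (2 * (p + 1))) ∂(stdGaussian V) := by
        refine integral_mono_of_nonneg (Eventually.of_forall fun x => by positivity) ?_
          (Eventually.of_forall hle)
        exact ((integrable_const _).add
          ((integrable_finsetSum _ fun i _ => hint i).const_mul _)).const_mul _
    _ = 2 ^ p * ((1 + (N : ℝ)) ^ (p + 1) + N ^ p * (N * m)) := by
        rw [integral_const_mul, integral_add (integrable_const _)
          ((integrable_finsetSum _ fun i _ => hint i).const_mul _), integral_const_mul,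
          integral_finsetSum _ fun i _ => hint i]
        simp [hmom, hN]
    _ ≤ 2 ^ p * ((1 + (N : ℝ)) ^ (p + 1) + (1 + N) ^ p * ((1 + N) * m)) := by
        gcongr <;> linarith
    _ = _ := by ring

end Gaussian


/-! ### Maps with polynomially bounded first and second derivatives -/

section Tame

variable {E G H : Type*} [NormedAddCommGroup E] [NormedSpace ℝ E] [NormedAddCommGroup G]
  [NormedSpace ℝ G] [NormedAddCommGroup H] [NormedSpace ℝ H]

/-- `F` is differentiable on `s`, of size `M q ^ d`, its derivative is of size `M q ^ (d + 2)`, and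
the derivative is Lipschitz with constant `M q ^ (d + 4)`. Every derivative costs a factor `q ^ 2`,
so that the class is stable under products. -/
def Tame (s : Set E) (q M : ℝ) (d : ℕ) (F : E → G) : Prop :=
  ∃ F' : E → E →L[ℝ] G, ∀ x ∈ s, HasFDerivAt F (F' x) x ∧ ‖F x‖ ≤ M * q ^ d ∧
    ‖F' x‖ ≤ M * q ^ (d + 2) ∧ ∀ y ∈ s, ‖F' x - F' y‖ ≤ M * q ^ (d + 4) * ‖x - y‖

variable {s : Set E} {q M M' : ℝ} {d d' : ℕ} {F : E → G}

theorem Tame.lipschitz (hs : Convex ℝ s) (h : Tame s q M d F) {x y : E} (hx : x ∈ s)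
    (hy : y ∈ s) : ‖F x - F y‖ ≤ M * q ^ (d + 2) * ‖x - y‖ := by
  obtain ⟨F', h⟩ := h
  exact hs.norm_image_sub_le_of_norm_hasFDerivWithin_le
    (fun z hz => (h z hz).1.hasFDerivWithinAt) (fun z hz => (h z hz).2.2.1) hy hx

theorem Tame.mono (hq : 1 ≤ q) (h : Tame s q M d F) (hM : M ≤ M') : Tame s q M' d F := by
  obtain ⟨F', h⟩ := h
  refine ⟨F', fun x hx => ?_⟩
  obtain ⟨h1, h2, h3, h4⟩ := h x hx
  refine ⟨h1, h2.trans (by gcongr), h3.trans (by gcongr), fun y hy => (h4 y hy).trans (by gcongr)⟩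

theorem Tame.add {F₂ : E → G} (h : Tame s q M d F) (h' : Tame s q M' d F₂) :
    Tame s q (M + M') d (fun x => F x + F₂ x) := by
  obtain ⟨F', h⟩ := h
  obtain ⟨F₂', h'⟩ := h'
  refine ⟨fun x => F' x + F₂' x, fun x hx => ?_⟩
  obtain ⟨h1, h2, h3, h4⟩ := h x hx
  obtain ⟨k1, k2, k3, k4⟩ := h' x hx
  refine ⟨h1.add k1, ?_, ?_, fun y hy => ?_⟩
  · rw [add_mul]; exact (norm_add_le _ _).trans (add_le_add h2 k2)
  · rw [add_mul]; exact (norm_add_le _ _).trans (add_le_add h3 k3)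
  · rw [add_mul, add_mul, add_sub_add_comm]
    exact (norm_add_le _ _).trans (add_le_add (h4 y hy) (k4 y hy))

theorem tame_const (hq : 1 ≤ q) {c : G} (hc : ‖c‖ ≤ M * q ^ d) : Tame s q M d fun _ => c := by
  have hM : 0 ≤ M := by
    by_contra h
    push Not at h
    have : M * q ^ d < 0 := mul_neg_of_neg_of_pos h (by positivity)
    linarith [norm_nonneg c]
  refine ⟨fun _ => 0, fun x _ => ⟨hasFDerivAt_const c x, hc, ?_, fun y _ => ?_⟩⟩
  · simp only [norm_zero]; positivity
  · simp only [sub_self, norm_zero]; positivity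

/-- A linear image of a tame map is tame; the norm of the linear map may use up powers of `q`. -/
theorem Tame.clm_comp (hq : 1 ≤ q) (h : Tame s q M d F) (L : G →L[ℝ] H) {c : ℝ} {j : ℕ}
    (hc : 0 ≤ c) (hL : ∀ g, ‖L g‖ ≤ c * q ^ j * ‖g‖) :
    Tame s q (c * M) (d + j) (fun x => L (F x)) := by
  obtain ⟨F', h⟩ := h
  have hL' : ∀ T : E →L[ℝ] G, ‖L ∘L T‖ ≤ c * q ^ j * ‖T‖ := fun T =>
    (L.opNorm_comp_le T).trans (mul_le_mul_of_nonneg_right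
      (L.opNorm_le_bound (by positivity) hL) (norm_nonneg _))
  refine ⟨fun x => L ∘L F' x, fun x hx => ?_⟩
  obtain ⟨h1, h2, h3, h4⟩ := h x hx
  refine ⟨L.hasFDerivAt.comp x h1, (hL _).trans ?_, (hL' _).trans ?_, fun y hy => ?_⟩
  · calc _ ≤ c * q ^ j * (M * q ^ d) := by gcongr
      _ = _ := by ring
  · calc _ ≤ c * q ^ j * (M * q ^ (d + 2)) := by gcongr
      _ = _ := by ring
  · rw [← ContinuousLinearMap.comp_sub]
    calc _ ≤ c * q ^ j * ‖F' x - F' y‖ := hL' _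
      _ ≤ c * q ^ j * (M * q ^ (d + 4) * ‖x - y‖) := by gcongr; exact h4 y hy
      _ = _ := by ring

/-- The product rule for tame maps. -/
theorem Tame.bilin {G₁ G₂ : Type*} [NormedAddCommGroup G₁] [NormedSpace ℝ G₁]
    [NormedAddCommGroup G₂] [NormedSpace ℝ G₂] (hs : Convex ℝ s) (hq : 1 ≤ q) (hM : 0 ≤ M)
    (hM' : 0 ≤ M') (L : G₁ →L[ℝ] G₂ →L[ℝ] H) (hL : ‖L‖ ≤ 1) {F₁ : E → G₁} {F₂ : E → G₂}
    (h : Tame s q M d F₁) (h' : Tame s q M' d' F₂) :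
    Tame s q (4 * M * M') (d + d') (fun x => L (F₁ x) (F₂ x)) := by
  have hl := fun {x y} => h.lipschitz (x := x) (y := y) hs
  have hl' := fun {x y} => h'.lipschitz (x := x) (y := y) hs
  obtain ⟨A, h⟩ := h
  obtain ⟨B, h'⟩ := h'
  have hb : ∀ a b, ‖L a b‖ ≤ ‖a‖ * ‖b‖ := fun a b => (L.le_opNorm₂ a b).trans (by
    have := mul_nonneg (norm_nonneg a) (norm_nonneg b); nlinarith)
  have hbR : ∀ a (T : E →L[ℝ] G₂), ‖L.precompR E a T‖ ≤ ‖a‖ * ‖T‖ := fun a T =>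
    ContinuousLinearMap.opNorm_le_bound _ (by positivity) fun v => by
      rw [ContinuousLinearMap.precompR_apply, mul_assoc]
      exact (hb _ _).trans (by gcongr; exact T.le_opNorm v)
  have hbL : ∀ (T : E →L[ℝ] G₁) b, ‖L.precompL E T b‖ ≤ ‖T‖ * ‖b‖ := fun T b =>
    ContinuousLinearMap.opNorm_le_bound _ (by positivity) fun v => by
      rw [ContinuousLinearMap.precompL_apply]
      exact (hb _ _).trans (by
        have := T.le_opNorm v
        nlinarith [norm_nonneg b])
  refine ⟨fun x => L.precompR E (F₁ x) (B x) + L.precompL E (A x) (F₂ x), fun x hx => ?_⟩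
  obtain ⟨h1, h2, h3, h4⟩ := h x hx
  obtain ⟨k1, k2, k3, k4⟩ := h' x hx
  have q0 : (0 : ℝ) ≤ q := by linarith
  refine ⟨L.hasFDerivAt_of_bilinear h1 k1, ?_, ?_, fun y hy => ?_⟩
  · calc _ ≤ ‖F₁ x‖ * ‖F₂ x‖ := hb _ _
      _ ≤ (M * q ^ d) * (M' * q ^ d') := by gcongr
      _ = 1 * (M * M' * q ^ (d + d')) := by ring
      _ ≤ 4 * (M * M' * q ^ (d + d')) := by gcongr; norm_num
      _ = _ := by ring
  · calc _ ≤ ‖F₁ x‖ * ‖B x‖ + ‖A x‖ * ‖F₂ x‖ :=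
          (norm_add_le _ _).trans (add_le_add (hbR _ _) (hbL _ _))
      _ ≤ (M * q ^ d) * (M' * q ^ (d' + 2)) + (M * q ^ (d + 2)) * (M' * q ^ d') := by gcongr
      _ = 2 * (M * M' * q ^ (d + d' + 2)) := by ring
      _ ≤ 4 * (M * M' * q ^ (d + d' + 2)) := by gcongr; norm_num
      _ = _ := by ring
  · obtain ⟨h1y, h2y, h3y, -⟩ := h y hy
    obtain ⟨k1y, k2y, k3y, -⟩ := h' y hy
    have e : L.precompR E (F₁ x) (B x) + L.precompL E (A x) (F₂ x) -
        (L.precompR E (F₁ y) (B y) + L.precompL E (A y) (F₂ y)) =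
        (L.precompR E (F₁ x) (B x - B y) + L.precompR E (F₁ x - F₁ y) (B y)) +
        (L.precompL E (A x) (F₂ x - F₂ y) + L.precompL E (A x - A y) (F₂ y)) := by
      simp only [map_sub, sub_apply]
      abel
    rw [e]
    calc _ ≤ (‖F₁ x‖ * ‖B x - B y‖ + ‖F₁ x - F₁ y‖ * ‖B y‖) +
          (‖A x‖ * ‖F₂ x - F₂ y‖ + ‖A x - A y‖ * ‖F₂ y‖) :=
          (norm_add_le _ _).trans (add_le_add
            ((norm_add_le _ _).trans (add_le_add (hbR _ _) (hbR _ _)))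
            ((norm_add_le _ _).trans (add_le_add (hbL _ _) (hbL _ _))))
      _ ≤ ((M * q ^ d) * (M' * q ^ (d' + 4) * ‖x - y‖) +
            (M * q ^ (d + 2) * ‖x - y‖) * (M' * q ^ (d' + 2))) +
          ((M * q ^ (d + 2)) * (M' * q ^ (d' + 2) * ‖x - y‖) +
            (M * q ^ (d + 4) * ‖x - y‖) * (M' * q ^ d')) := by
          gcongr
          exacts [k4 y hy, hl hx hy, hl' hx hy, h4 y hy]
      _ = _ := by ring

theorem Tame.mul {f g : E → ℝ} (hs : Convex ℝ s) (hq : 1 ≤ q) (hM : 0 ≤ M) (hM' : 0 ≤ M')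
    (h : Tame s q M d f) (h' : Tame s q M' d' g) :
    Tame s q (4 * M * M') (d + d') (fun x => f x * g x) :=
  h.bilin hs hq hM hM' (ContinuousLinearMap.mul ℝ ℝ)
    (ContinuousLinearMap.opNorm_mul_le ℝ ℝ) h'

theorem Tame.const_mul {f : E → ℝ} (hq : 1 ≤ q) (h : Tame s q M d f) (c : ℝ) :
    Tame s q (|c| * M) d (fun x => c * f x) := by
  simpa using h.clm_comp hq (j := 0) (ContinuousLinearMap.mul ℝ ℝ c) (abs_nonneg c)
    (fun g => by simp)

/-- A bounded function whose logarithmic derivative is tame is itself tame. This is how exponentials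
of unbounded functions of the data are controlled: only the bound for `f` itself uses the sign of
the exponent. -/
theorem tame_of_log_deriv (hs : Convex ℝ s) (hq : 1 ≤ q) (hM : 0 ≤ M) (hM' : 0 ≤ M')
    {f : E → ℝ} {f' : E → E →L[ℝ] ℝ} {u : E → E → ℝ} (hf : ∀ x ∈ s, HasFDerivAt f (f' x) x)
    (hfu : ∀ x ∈ s, ∀ v, f' x v = f x * u v x) (hb : ∀ x ∈ s, |f x| ≤ M)
    (hu : ∀ v, Tame s q (M' * ‖v‖) 2 (u v)) :
    Tame s q (M * (1 + M') ^ 2) 0 f := by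
  have hub : ∀ x ∈ s, ∀ v, |u v x| ≤ M' * ‖v‖ * q ^ 2 := fun x hx v => by
    obtain ⟨_, h⟩ := hu v
    exact (h x hx).2.1
  have hn : ∀ x ∈ s, ‖f' x‖ ≤ M * M' * q ^ 2 := fun x hx =>
    ContinuousLinearMap.opNorm_le_bound _ (by positivity) fun v => by
      rw [hfu x hx, Real.norm_eq_abs, abs_mul]
      calc _ ≤ M * (M' * ‖v‖ * q ^ 2) := by gcongr; exacts [hb x hx, hub x hx v]
        _ = _ := by ring
  refine ⟨f', fun x hx => ⟨hf x hx, ?_, (hn x hx).trans ?_, fun y hy => ?_⟩⟩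
  · rw [pow_zero, mul_one]
    exact (hb x hx).trans (le_mul_of_one_le_right hM (one_le_pow₀ (by linarith)))
  · rw [zero_add]
    gcongr
    nlinarith
  · have hl : |f x - f y| ≤ M * M' * q ^ 2 * ‖x - y‖ :=
      hs.norm_image_sub_le_of_norm_hasFDerivWithin_le
        (fun z hz => (hf z hz).hasFDerivWithinAt) hn hy hx
    refine ContinuousLinearMap.opNorm_le_bound _ (by positivity) fun v => ?_
    have hlu := (hu v).lipschitz hs hx hy
    rw [Real.norm_eq_abs] at hlu
    have e : (f' x - f' y) v = f x * (u v x - u v y) + (f x - f y) * u v y := by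
      rw [sub_apply, hfu x hx, hfu y hy]; ring
    rw [e]
    calc _ ≤ |f x| * |u v x - u v y| + |f x - f y| * |u v y| := by
          rw [← abs_mul, ← abs_mul]; exact abs_add_le _ _
      _ ≤ M * (M' * ‖v‖ * q ^ (2 + 2) * ‖x - y‖) +
          (M * M' * q ^ 2 * ‖x - y‖) * (M' * ‖v‖ * q ^ 2) := by
          gcongr
          exacts [hb x hx, hub y hy v]
      _ = M * (M' + M' ^ 2) * (q ^ (0 + 4) * ‖x - y‖ * ‖v‖) := by ring
      _ ≤ M * (1 + M') ^ 2 * (q ^ (0 + 4) * ‖x - y‖ * ‖v‖) := by gcongr; nlinarith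
      _ = _ := by ring

end Tame


/-! ### The estimating function of one whitened group -/

section White

open scoped RealInnerProductSpace

variable {E V : Type*} [NormedAddCommGroup E] [NormedSpace ℝ E] [NormedAddCommGroup V]
  [InnerProductSpace ℝ V]

/-- The inverse of the perturbed covariance `1 + B h`. -/
noncomputable def precision (B : E →L[ℝ] V →L[ℝ] V) (h : E) : V →L[ℝ] V :=
  Ring.inverse (1 + B h)

theorem precision_zero (B : E →L[ℝ] V →L[ℝ] V) : precision B (0 : E) = 1 := by
  simp [precision]

variable (B : E →L[ℝ] V →L[ℝ] V) (Z : E →L[ℝ] V) (ε : V) (α : ℝ) (η : E → ℝ)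

/-- The directional derivative of the Gaussian log-likelihood with mean `Z h` and covariance
`1 + B h` in the direction `e`. -/
noncomputable def scoreAt (e h : E) : ℝ :=
  ⟪Z e, precision B h (ε - Z h)⟫ + (⟪ε - Z h, precision B h (B e (precision B h (ε - Z h)))⟫
    - trace (precision B h * B e)) / 2

/-- The weight that the density power divergence gives to the group; `η` collects the
determinantal factor. -/
noncomputable def weightAt (h : E) : ℝ :=
  η h * Real.exp (-(α / 2) * ⟪ε - Z h, precision B h (ε - Z h)⟫)

/-- The component in the direction `e` of the estimating function of one group at the parameter
`h`: the weighted score, centred at its mean under the law with parameter `h`, times `-(1 + α)`. -/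
noncomputable def estFun (e h : E) : ℝ :=
  -(1 + α) * (weightAt B Z ε α η h * scoreAt B Z ε e h) +
    -(α / 2 * (1 + α) ^ (-(Module.finrank ℝ V / 2 : ℝ))) *
      (η h * trace (precision B h * B e))

theorem weightAt_zero : weightAt B Z ε α η 0 = η 0 * Real.exp (-(α / 2) * ‖ε‖ ^ 2) := by
  simp [weightAt, precision_zero]

theorem scoreAt_zero (e : E) : scoreAt B Z ε e 0 = score (Z e) (B e) ε := by
  simp [scoreAt, precision_zero, score]

variable [FiniteDimensional ℝ V]

/-- The dimension enters the estimates only through this bound for the trace. -/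
theorem abs_trace_le (A : V →L[ℝ] V) : |trace A| ≤ Module.finrank ℝ V * ‖A‖ := by
  rw [trace_eq_sum]
  refine (Finset.abs_sum_le_sum_abs _ _).trans ?_
  calc _ ≤ ∑ _i : Fin (Module.finrank ℝ V), ‖A‖ := by
        refine Finset.sum_le_sum fun i _ => ?_
        have h1 := abs_real_inner_le_norm (stdOrthonormalBasis ℝ V i)
          (A (stdOrthonormalBasis ℝ V i))
        have h2 := A.le_opNorm (stdOrthonormalBasis ℝ V i)
        rw [(stdOrthonormalBasis ℝ V).orthonormal.norm_eq_one] at h1 h2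
        linarith
    _ = _ := by simp

/-- The trace as a continuous linear functional. -/
noncomputable def traceCLM : (V →L[ℝ] V) →L[ℝ] ℝ :=
  LinearMap.mkContinuous
    { toFun := trace
      map_add' := fun A B => by simp [trace]
      map_smul' := fun c A => by simp [trace] }
    (Module.finrank ℝ V) abs_trace_le

theorem traceCLM_apply (A : V →L[ℝ] V) : traceCLM A = trace A := rfl

/-- The hypotheses on a whitened group: mean and covariance are linear perturbations, bounded by
`K`, of those of the standard Gaussian law, on the ball of radius `δ`, where the covariance stays
away from being singular. The factor `η` behaves like `det ^ (-α / 2)`. -/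
structure WhiteGroup (K δ Mη : ℝ) : Prop where
  K_one : 1 ≤ K
  δ_pos : 0 < δ
  Kδ : K * δ ≤ 1 / 4
  normB : ∀ e, ‖B e‖ ≤ K * ‖e‖
  normZ : ∀ e, ‖Z e‖ ≤ K * ‖e‖
  symm : ∀ e, (B e : V →ₗ[ℝ] V).IsSymmetric
  α_nonneg : 0 ≤ α
  η_nonneg : ∀ h ∈ Metric.closedBall (0 : E) δ, 0 ≤ η h
  η_le : ∀ h ∈ Metric.closedBall (0 : E) δ, η h ≤ Mη
  η_deriv : ∀ h ∈ Metric.closedBall (0 : E) δ, HasFDerivAt η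
    ((-(α / 2) * η h) • (traceCLM ∘L (ContinuousLinearMap.mul ℝ (V →L[ℝ] V) (precision B h)) ∘L B))
    h

variable {B Z α η} {K δ Mη : ℝ}

/-- The constant of `WhiteGroup.tame_scoreAt`. Its numerals are what the product rule
`Tame.bilin` gives; only their independence of the dimension matters. -/
noncomputable def scoreConst (K : ℝ) : ℝ :=
  512 * K ^ 4 + 131072 * K ^ 7 + 32 * K ^ 3

/-- The constant of `WhiteGroup.tame_estFun`. -/
noncomputable def estConst (K α Mη : ℝ) : ℝ :=
  4 * (1 + α) * (Mη * (1 + α * scoreConst K) ^ 2) * scoreConst K +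
    2 * α * (Mη * (1 + 32 * α * K ^ 3) ^ 2) * (64 * K ^ 3)

namespace WhiteGroup

variable (W : WhiteGroup B Z α η K δ Mη) {h : E}

include W

theorem norm_B_le (hh : h ∈ Metric.closedBall (0 : E) δ) : ‖B h‖ ≤ 1 / 4 := by
  rw [mem_closedBall_zero_iff] at hh
  have := W.K_one
  calc ‖B h‖ ≤ K * ‖h‖ := W.normB h
    _ ≤ K * δ := by gcongr
    _ ≤ _ := W.Kδ

theorem isUnit (hh : h ∈ Metric.closedBall (0 : E) δ) : IsUnit (1 + B h) := by
  have := W.norm_B_le hh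
  have h2 : IsUnit (1 - -(B h)) := isUnit_one_sub_of_norm_lt_one (by rw [norm_neg]; linarith)
  rwa [sub_neg_eq_add] at h2

theorem mul_precision (hh : h ∈ Metric.closedBall (0 : E) δ) :
    (1 + B h) * precision B h = 1 := Ring.mul_inverse_cancel _ (W.isUnit hh)

theorem norm_precision_le (hh : h ∈ Metric.closedBall (0 : E) δ) : ‖precision B h‖ ≤ 2 := by
  have h1 := W.norm_B_le hh
  have h2 : precision B h = 1 - B h * precision B h := by
    rw [eq_sub_iff_add_eq, ← W.mul_precision hh, add_mul, one_mul]
  have h3 : ‖precision B h‖ ≤ 1 + 1 / 4 * ‖precision B h‖ := by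
    calc ‖precision B h‖ = ‖1 - B h * precision B h‖ := by rw [← h2]
      _ ≤ ‖(1 : V →L[ℝ] V)‖ + ‖B h * precision B h‖ := norm_sub_le _ _
      _ ≤ 1 + ‖B h‖ * ‖precision B h‖ :=
        add_le_add ContinuousLinearMap.norm_id_le (norm_mul_le _ _)
      _ ≤ _ := by gcongr
  linarith [norm_nonneg (precision B h)]

theorem hasFDerivAt_precision (hh : h ∈ Metric.closedBall (0 : E) δ) :
    HasFDerivAt (precision B)
      ((-ContinuousLinearMap.mulLeftRight ℝ (V →L[ℝ] V) (precision B h) (precision B h)) ∘L B)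
      h := by
  obtain ⟨u, hu⟩ := W.isUnit hh
  have h1 := hasFDerivAt_ringInverse (𝕜 := ℝ) u
  have h2 : (↑u⁻¹ : V →L[ℝ] V) = precision B h := by
    rw [precision, ← hu, Ring.inverse_unit]
  rw [h2, hu] at h1
  exact h1.comp h ((B.hasFDerivAt (x := h)).const_add 1)

theorem tame_precision {q : ℝ} (hq : 1 ≤ q) :
    Tame (Metric.closedBall (0 : E) δ) q (16 * K ^ 2) 0 (precision B) := by
  have hK := W.K_one
  have hn : ∀ x ∈ Metric.closedBall (0 : E) δ, ‖(-ContinuousLinearMap.mulLeftRight ℝ (V →L[ℝ] V)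
      (precision B x) (precision B x)) ∘L B‖ ≤ 4 * K := fun x hx => by
    refine ContinuousLinearMap.opNorm_le_bound _ (by positivity) fun v => ?_
    simp only [ContinuousLinearMap.comp_apply, neg_apply,
      ContinuousLinearMap.mulLeftRight_apply, norm_neg]
    have hp := W.norm_precision_le hx
    calc _ ≤ ‖precision B x‖ * ‖B v‖ * ‖precision B x‖ :=
          (norm_mul_le _ _).trans (by gcongr; exact norm_mul_le _ _)
      _ ≤ 2 * (K * ‖v‖) * 2 := by gcongr; exact W.normB v
      _ = _ := by ring
  have hlip : ∀ x ∈ Metric.closedBall (0 : E) δ, ∀ y ∈ Metric.closedBall (0 : E) δ,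
      ‖precision B x - precision B y‖ ≤ 4 * K * ‖x - y‖ := fun x hx y hy =>
    (convex_closedBall (0 : E) δ).norm_image_sub_le_of_norm_hasFDerivWithin_le
      (fun z hz => (W.hasFDerivAt_precision hz).hasFDerivWithinAt) hn hy hx
  refine ⟨_, fun x hx => ⟨W.hasFDerivAt_precision hx, ?_, (hn x hx).trans ?_, fun y hy => ?_⟩⟩
  · have := W.norm_precision_le hx
    rw [pow_zero, mul_one]
    nlinarith
  · have : (1 : ℝ) ≤ q ^ (0 + 2) := one_le_pow₀ hq
    nlinarith
  · have hq4 : (1 : ℝ) ≤ q ^ (0 + 4) := one_le_pow₀ hq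
    refine ContinuousLinearMap.opNorm_le_bound _ (by positivity) fun v => ?_
    simp only [ContinuousLinearMap.comp_apply, neg_apply, sub_apply,
      ContinuousLinearMap.mulLeftRight_apply]
    have e : -(precision B x * B v * precision B x) - -(precision B y * B v * precision B y) =
        -(precision B x * B v * (precision B x - precision B y) +
          (precision B x - precision B y) * B v * precision B y) := by noncomm_ring
    rw [e, norm_neg]
    have hx' := W.norm_precision_le hx
    have hy' := W.norm_precision_le hy
    have hB := W.normB v
    have hl := hlip x hx y hy
    calc _ ≤ ‖precision B x‖ * ‖B v‖ * ‖precision B x - precision B y‖ +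
          ‖precision B x - precision B y‖ * ‖B v‖ * ‖precision B y‖ :=
          (norm_add_le _ _).trans (add_le_add
            ((norm_mul_le _ _).trans (by gcongr; exact norm_mul_le _ _))
            ((norm_mul_le _ _).trans (by gcongr; exact norm_mul_le _ _)))
      _ ≤ 2 * (K * ‖v‖) * (4 * K * ‖x - y‖) + (4 * K * ‖x - y‖) * (K * ‖v‖) * 2 := by gcongr
      _ = 16 * K ^ 2 * 1 * ‖x - y‖ * ‖v‖ := by ring
      _ ≤ _ := by gcongr

theorem precision_symm (hh : h ∈ Metric.closedBall (0 : E) δ) (x y : V) :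
    ⟪precision B h x, y⟫ = ⟪x, precision B h y⟫ := by
  have hx : (1 + B h) (precision B h x) = x := by
    simpa using congrArg (fun T : V →L[ℝ] V => T x) (W.mul_precision hh)
  have hy : (1 + B h) (precision B h y) = y := by
    simpa using congrArg (fun T : V →L[ℝ] V => T y) (W.mul_precision hh)
  have hs : ∀ a b, ⟪B h a, b⟫ = ⟪a, B h b⟫ := W.symm h
  calc _ = ⟪precision B h x, (1 + B h) (precision B h y)⟫ := by rw [hy]
    _ = ⟪(1 + B h) (precision B h x), precision B h y⟫ := by
      simp [inner_add_left, inner_add_right, hs]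
    _ = _ := by rw [hx]

theorem precision_nonneg (hh : h ∈ Metric.closedBall (0 : E) δ) (x : V) :
    0 ≤ ⟪x, precision B h x⟫ := by
  have hx : (1 + B h) (precision B h x) = x := by
    simpa using congrArg (fun T : V →L[ℝ] V => T x) (W.mul_precision hh)
  set y := precision B h x with hy
  have h1 : ⟪x, y⟫ = ‖y‖ ^ 2 + ⟪B h y, y⟫ := by
    conv_lhs => rw [← hx]
    simp [inner_add_left]
  have h2 := abs_real_inner_le_norm (B h y) y
  have h3 : ‖B h y‖ ≤ 1 / 4 * ‖y‖ :=
    ((B h).le_opNorm y).trans (by gcongr; exact W.norm_B_le hh)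
  have h4 := neg_abs_le ⟪B h y, y⟫
  rw [h1]
  nlinarith [norm_nonneg y]

theorem zero_mem : (0 : E) ∈ Metric.closedBall (0 : E) δ :=
  Metric.mem_closedBall_self W.δ_pos.le

theorem Mη_nonneg : 0 ≤ Mη := (W.η_nonneg 0 W.zero_mem).trans (W.η_le 0 W.zero_mem)

theorem tame_resid {q : ℝ} (hq : 1 ≤ q) (hε : ‖ε‖ ≤ q) :
    Tame (Metric.closedBall (0 : E) δ) q (2 * K) 1 (fun h => ε - Z h) := by
  have hK := W.K_one
  refine ⟨fun _ => -Z, fun x hx => ⟨?_, ?_, ?_, fun y hy => ?_⟩⟩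
  · exact (Z.hasFDerivAt (x := x)).const_sub ε
  · rw [mem_closedBall_zero_iff] at hx
    have h1 : ‖Z x‖ ≤ 1 / 4 := (W.normZ x).trans ((by gcongr : K * ‖x‖ ≤ K * δ).trans W.Kδ)
    calc _ ≤ ‖ε‖ + ‖Z x‖ := norm_sub_le _ _
      _ ≤ q + 1 / 4 := by gcongr
      _ ≤ 2 * 1 * q ^ 1 := by linarith
      _ ≤ _ := by gcongr
  · rw [norm_neg]
    have h1 : ‖Z‖ ≤ K := Z.opNorm_le_bound (by linarith) W.normZ
    have : (1 : ℝ) ≤ q ^ (1 + 2) := one_le_pow₀ hq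
    nlinarith
  · rw [sub_self, norm_zero]; positivity

theorem tame_precision_resid {q : ℝ} (hq : 1 ≤ q) (hε : ‖ε‖ ≤ q) :
    Tame (Metric.closedBall (0 : E) δ) q (128 * K ^ 3) 1
      (fun h => precision B h (ε - Z h)) := by
  have hK := W.K_one
  refine ((W.tame_precision hq).bilin (convex_closedBall _ _) hq (by positivity) (by positivity)
    (ContinuousLinearMap.id ℝ (V →L[ℝ] V)) ContinuousLinearMap.norm_id_le
    (W.tame_resid ε hq hε)).mono hq (le_of_eq (by ring))

theorem tame_trace {q : ℝ} (hq : 1 ≤ q) (hN : (Module.finrank ℝ V : ℝ) ≤ q ^ 2) (e : E) :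
    Tame (Metric.closedBall (0 : E) δ) q (64 * K ^ 3 * ‖e‖) 2
      (fun h => trace (precision B h * B e)) := by
  have hK := W.K_one
  have h1 : Tame (Metric.closedBall (0 : E) δ) q (K * ‖e‖) 0 (fun _ : E => B e) :=
    tame_const hq (by rw [pow_zero, mul_one]; exact W.normB e)
  have h2 := (W.tame_precision hq).bilin (convex_closedBall _ _) hq (by positivity) (by positivity)
    (ContinuousLinearMap.mul ℝ (V →L[ℝ] V)) (ContinuousLinearMap.opNorm_mul_le _ _) h1
  refine (h2.clm_comp hq traceCLM (c := 1) (j := 2) zero_le_one fun A => ?_).mono hq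
    (le_of_eq (by ring))
  rw [one_mul]
  exact (abs_trace_le A).trans (by gcongr)

theorem tame_scoreAt {q : ℝ} (hq : 1 ≤ q) (hε : ‖ε‖ ≤ q)
    (hN : (Module.finrank ℝ V : ℝ) ≤ q ^ 2) (e : E) :
    Tame (Metric.closedBall (0 : E) δ) q (scoreConst K * ‖e‖) 2 (scoreAt B Z ε e) := by
  have hK := W.K_one
  have hc := convex_closedBall (0 : E) δ
  have hp := W.tame_precision_resid ε hq hε
  have hZ : Tame (Metric.closedBall (0 : E) δ) q (K * ‖e‖) 1 (fun _ : E => Z e) :=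
    tame_const hq ((W.normZ e).trans (le_mul_of_one_le_right (by positivity) (by simpa using hq)))
  have hB : Tame (Metric.closedBall (0 : E) δ) q (K * ‖e‖) 0 (fun _ : E => B e) :=
    tame_const hq (by rw [pow_zero, mul_one]; exact W.normB e)
  have t1 := hZ.bilin hc hq (by positivity) (by positivity) (innerSL ℝ)
    (norm_innerSL_le ℝ) hp
  have t2 := hB.bilin hc hq (by positivity) (by positivity)
    (ContinuousLinearMap.id ℝ (V →L[ℝ] V)) ContinuousLinearMap.norm_id_le hp
  have t3 := (W.tame_precision hq).bilin hc hq (by positivity) (by positivity)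
    (ContinuousLinearMap.id ℝ (V →L[ℝ] V)) ContinuousLinearMap.norm_id_le t2
  have t4 := (W.tame_resid ε hq hε).bilin hc hq (by positivity) (by positivity) (innerSL ℝ)
    (norm_innerSL_le ℝ) t3
  have t5 := (t1.add (t4.const_mul hq (1 / 2))).add ((W.tame_trace hq hN e).const_mul hq (-(1 / 2)))
  have e1 : scoreAt B Z ε e = fun h => innerSL ℝ (Z e) (precision B h (ε - Z h)) +
        1 / 2 * innerSL ℝ (ε - Z h) (ContinuousLinearMap.id ℝ (V →L[ℝ] V) (precision B h)
          (ContinuousLinearMap.id ℝ (V →L[ℝ] V) (B e) (precision B h (ε - Z h)))) +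
        -(1 / 2) * trace (precision B h * B e) := by
    ext h
    simp only [scoreAt, innerSL_apply_apply, ContinuousLinearMap.id_apply]
    ring
  rw [e1]
  refine t5.mono hq (le_of_eq ?_)
  rw [abs_neg, abs_of_pos (by norm_num : (0 : ℝ) < 1 / 2), scoreConst]
  ring

/-- The exponent of the weight is nonpositive because the precision is positive. -/
theorem weightAt_le (hh : h ∈ Metric.closedBall (0 : E) δ) : |weightAt B Z ε α η h| ≤ Mη := by
  have h1 := W.η_nonneg h hh
  have h2 := W.precision_nonneg hh (ε - Z h)
  have h3 := W.α_nonneg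
  rw [weightAt, abs_of_nonneg (by positivity)]
  refine (mul_le_of_le_one_right h1 ?_).trans (W.η_le h hh)
  rw [Real.exp_le_one_iff]
  nlinarith [mul_nonneg h3 h2]

/-- The gradient of the log-weight is `α` times the likelihood score. -/
theorem exists_hasFDerivAt_weightAt (hh : h ∈ Metric.closedBall (0 : E) δ) :
    ∃ L : E →L[ℝ] ℝ, HasFDerivAt (weightAt B Z ε α η) L h ∧
      ∀ v, L v = weightAt B Z ε α η h * (α * scoreAt B Z ε v h) := by
  have hr : HasFDerivAt (fun h => ε - Z h) (-Z) h := (Z.hasFDerivAt (x := h)).const_sub ε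
  have hPr := (W.hasFDerivAt_precision hh).clm_apply hr
  have hq := ((hr.inner ℝ hPr).const_mul (-(α / 2))).exp
  refine ⟨_, (W.η_deriv h hh).mul hq, fun v => ?_⟩
  simp only [add_apply, smul_apply, ContinuousLinearMap.comp_apply, traceCLM_apply, smul_eq_mul,
    ContinuousLinearMap.mul_apply', fderivInnerCLM_apply, ContinuousLinearMap.prod_apply,
    ContinuousLinearMap.flip_apply, neg_apply, ContinuousLinearMap.mulLeftRight_apply,
    weightAt, scoreAt, inner_add_right, inner_neg_right, inner_neg_left, map_neg]
  have e1 : ⟪ε - Z h, precision B h (Z v)⟫ = ⟪Z v, precision B h (ε - Z h)⟫ := by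
    rw [← W.precision_symm hh, real_inner_comm]
  have e2 : (precision B h * B v * precision B h) (ε - Z h) =
    precision B h (B v (precision B h (ε - Z h))) := rfl
  rw [e1, e2]
  ring

theorem tame_weightAt {q : ℝ} (hq : 1 ≤ q) (hε : ‖ε‖ ≤ q)
    (hN : (Module.finrank ℝ V : ℝ) ≤ q ^ 2) :
    Tame (Metric.closedBall (0 : E) δ) q (Mη * (1 + α * scoreConst K) ^ 2) 0
      (weightAt B Z ε α η) := by
  have hK := W.K_one
  have hα := W.α_nonneg
  have hc : 0 ≤ scoreConst K := by unfold scoreConst; positivity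
  choose! L hL hLv using fun h (hh : h ∈ Metric.closedBall (0 : E) δ) =>
    W.exists_hasFDerivAt_weightAt ε hh
  refine tame_of_log_deriv (convex_closedBall _ _) hq W.Mη_nonneg (by positivity)
    hL (u := fun v h => α * scoreAt B Z ε v h) hLv
    (fun x hx => W.weightAt_le ε hx) fun v => ?_
  refine ((W.tame_scoreAt ε hq hε hN v).const_mul hq α).mono hq (le_of_eq ?_)
  rw [abs_of_nonneg hα]; ring

theorem tame_eta {q : ℝ} (hq : 1 ≤ q) (hN : (Module.finrank ℝ V : ℝ) ≤ q ^ 2) :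
    Tame (Metric.closedBall (0 : E) δ) q (Mη * (1 + 32 * α * K ^ 3) ^ 2) 0 η := by
  have hK := W.K_one
  have hα := W.α_nonneg
  refine tame_of_log_deriv (convex_closedBall _ _) hq W.Mη_nonneg (by positivity)
    W.η_deriv (u := fun v h => -(α / 2) * trace (precision B h * B v)) (fun x hx v => ?_)
    (fun x hx => ?_) fun v => ?_
  · simp only [smul_apply, ContinuousLinearMap.comp_apply, traceCLM_apply, smul_eq_mul,
      ContinuousLinearMap.mul_apply']
    ring
  · rw [abs_of_nonneg (W.η_nonneg x hx)]; exact W.η_le x hx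
  · refine ((W.tame_trace hq hN v).const_mul hq _).mono hq (le_of_eq ?_)
    rw [abs_neg, abs_of_nonneg (by positivity)]; ring

/-- The estimating function has derivatives of polynomial size in the scale `q`, which bounds both
the noise and the square root of the dimension. -/
theorem tame_estFun {q : ℝ} (hq : 1 ≤ q) (hε : ‖ε‖ ≤ q)
    (hN : (Module.finrank ℝ V : ℝ) ≤ q ^ 2) (e : E) :
    Tame (Metric.closedBall (0 : E) δ) q (estConst K α Mη * ‖e‖) 2 (estFun B Z ε α η e) := by
  have hK := W.K_one
  have hα := W.α_nonneg
  have hM := W.Mη_nonneg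
  have hc := convex_closedBall (0 : E) δ
  have hc : 0 ≤ scoreConst K := by unfold scoreConst; positivity
  have t1 := ((W.tame_weightAt ε hq hε hN).mul (convex_closedBall _ _) hq (by positivity)
    (by positivity) (W.tame_scoreAt ε hq hε hN e)).const_mul hq (-(1 + α))
  have t2 := ((W.tame_eta hq hN).mul (convex_closedBall _ _) hq (by positivity)
    (by positivity) (W.tame_trace hq hN e)).const_mul hq
      (-(α / 2 * (1 + α) ^ (-(Module.finrank ℝ V / 2 : ℝ))))
  refine (t1.add t2).mono hq ?_
  have h1 : (1 + α) ^ (-(Module.finrank ℝ V / 2 : ℝ)) ≤ 1 :=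
    Real.rpow_le_one_of_one_le_of_nonpos (by linarith) (by
      rw [neg_nonpos]; positivity)
  rw [abs_neg, abs_neg, abs_of_nonneg (a := 1 + α) (by positivity),
    abs_of_nonneg (a := α / 2 * _) (by positivity)]
  calc _ ≤ (1 + α) * (4 * (Mη * (1 + α * scoreConst K) ^ 2) * (scoreConst K * ‖e‖)) +
        α / 2 * 1 * (4 * (Mη * (1 + 32 * α * K ^ 3) ^ 2) * (64 * K ^ 3 * ‖e‖)) := by gcongr
    _ = _ := by rw [estConst]; ring

end WhiteGroup

variable (B Z α) in
/-- The derivative at `h = 0` of `scoreAt` in the direction `e`, along the direction `k`. -/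
noncomputable def scoreDeriv (e k : E) : ℝ :=
  (trace (B k * B e) / 2 - ⟪Z e, Z k⟫) - (⟪Z e, B k ε⟫ + ⟪Z k, B e ε⟫) -
    (⟪ε, (B k * B e) ε⟫ + ⟪ε, (B e * B k) ε⟫) / 2

variable (B Z α) in
/-- The derivative at `h = 0` of the estimating function in the direction `e`, along the
direction `k`. -/
noncomputable def estDeriv (η₀ : ℝ) (e k : E) : ℝ :=
  -(1 + α) * (η₀ * (Real.exp (-(α / 2) * ‖ε‖ ^ 2) *
      (α * (score (Z k) (B k) ε * score (Z e) (B e) ε) + scoreDeriv B Z ε e k))) +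
    (α / 2 * (1 + α) ^ (-(Module.finrank ℝ V / 2 : ℝ))) *
      (η₀ * (α / 2 * (trace (B k) * trace (B e)) + trace (B k * B e)))

namespace WhiteGroup

variable (W : WhiteGroup B Z α η K δ Mη)

include W

theorem hasDerivAt_estFun (e k : E) :
    HasDerivAt (fun t : ℝ => estFun B Z ε α η e (t • k)) (estDeriv B Z ε α (η 0) e k) 0 := by
  have hline : HasDerivAt (fun t : ℝ => t • k) k 0 := by
    simpa using (hasDerivAt_id (0 : ℝ)).smul_const k
  have h0 : (0 : ℝ) • k ∈ Metric.closedBall (0 : E) δ := by rw [zero_smul]; exact W.zero_mem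
  have hP : HasDerivAt (fun t : ℝ => precision B (t • k)) (-(B k)) 0 := by
    have := (W.hasFDerivAt_precision h0).comp_hasDerivAt (0 : ℝ) hline
    simpa [precision_zero] using! this
  have hr : HasDerivAt (fun t : ℝ => ε - Z (t • k)) (-(Z k)) 0 :=
    (Z.hasFDerivAt.comp_hasDerivAt (0 : ℝ) hline).const_sub ε
  have hη : HasDerivAt (fun t : ℝ => η (t • k)) (-(α / 2) * η 0 * trace (B k)) 0 := by
    have := (W.η_deriv _ h0).comp_hasDerivAt (0 : ℝ) hline
    simpa [precision_zero, traceCLM_apply] using! this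
  have hw : HasDerivAt (fun t : ℝ => weightAt B Z ε α η (t • k))
      (weightAt B Z ε α η 0 * (α * score (Z k) (B k) ε)) 0 := by
    obtain ⟨L, hL, hLv⟩ := W.exists_hasFDerivAt_weightAt ε h0
    have := hL.comp_hasDerivAt (0 : ℝ) hline
    rw [hLv, zero_smul, scoreAt_zero] at this
    exact this
  have hPr := hP.clm_apply hr
  have hs : HasDerivAt (fun t : ℝ => scoreAt B Z ε e (t • k)) (scoreDeriv B Z ε e k) 0 := by
    have h1 := (hasDerivAt_const (0 : ℝ) (Z e)).inner ℝ hPr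
    have h2 := hr.inner ℝ (hP.clm_apply (((hasDerivAt_const (0 : ℝ) (B e))).clm_apply hPr))
    have h3 := (traceCLM (V := V)).hasFDerivAt.comp_hasDerivAt (0 : ℝ) (hP.mul_const (B e))
    refine (h1.add ((h2.sub h3).div_const 2)).congr_deriv ?_
    have hs : ∀ e a b, ⟪B e a, b⟫ = ⟪a, B e b⟫ := fun e => W.symm e
    simp only [zero_smul, precision_zero, map_zero, sub_zero, neg_apply, scoreDeriv,
      traceCLM_apply, inner_add_right, inner_neg_right, inner_neg_left, map_neg, map_add,
      zero_apply, inner_zero_left, inner_zero_right, one_apply_eq_self,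
      mul_apply_eq_comp, neg_mul]
    have h5 : ⟪ε, B e (Z k)⟫ = ⟪Z k, B e ε⟫ := by rw [← hs, real_inner_comm]
    rw [h5]
    ring
  have hT : HasDerivAt (fun t : ℝ => trace (precision B (t • k) * B e)) (-trace (B k * B e)) 0 := by
    have h3 := (traceCLM (V := V)).hasFDerivAt.comp_hasDerivAt (0 : ℝ) (hP.mul_const (B e))
    refine h3.congr_deriv ?_
    rw [neg_mul, map_neg]; rfl
  refine (((hw.mul hs).const_mul (-(1 + α))).add ((hη.mul hT).const_mul
    (-(α / 2 * (1 + α) ^ (-(Module.finrank ℝ V / 2 : ℝ)))))).congr_deriv ?_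
  simp only [zero_smul, scoreAt_zero, weightAt_zero, precision_zero, one_mul, estDeriv]
  ring

theorem abs_estFun_zero_le {q : ℝ} (hq : 1 ≤ q) (hε : ‖ε‖ ≤ q)
    (hN : (Module.finrank ℝ V : ℝ) ≤ q ^ 2) (e : E) :
    |estFun B Z ε α η e 0| ≤ estConst K α Mη * ‖e‖ * q ^ 2 := by
  obtain ⟨F', hF⟩ := W.tame_estFun ε hq hε hN e
  exact (hF 0 W.zero_mem).2.1

/-- The estimating function is differentiable at `h = 0` with derivative `estDeriv`, and it is close
to its linearization, uniformly in small balls. -/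
theorem exists_estDeriv {q : ℝ} (hq : 1 ≤ q) (hε : ‖ε‖ ≤ q)
    (hN : (Module.finrank ℝ V : ℝ) ≤ q ^ 2) (e : E) :
    ∃ L : E →L[ℝ] ℝ, (∀ k, L k = estDeriv B Z ε α (η 0) e k) ∧
      ‖L‖ ≤ estConst K α Mη * ‖e‖ * q ^ 4 ∧
      ∀ δ' ≤ δ, ∀ x ∈ Metric.closedBall (0 : E) δ', ∀ y ∈ Metric.closedBall (0 : E) δ',
        |estFun B Z ε α η e x - estFun B Z ε α η e y - L (x - y)| ≤
          estConst K α Mη * ‖e‖ * q ^ 6 * δ' * ‖x - y‖ := by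
  obtain ⟨F', hF⟩ := W.tame_estFun ε hq hε hN e
  refine ⟨F' 0, fun k => ?_, (hF 0 W.zero_mem).2.2.1, fun δ' hδ' x hx y hy => ?_⟩
  · have hline : HasDerivAt (fun t : ℝ => t • k) k 0 := by
      simpa using (hasDerivAt_id (0 : ℝ)).smul_const k
    have h1 : HasFDerivAt (estFun B Z ε α η e) (F' 0) ((0 : ℝ) • k) := by
      rw [zero_smul]; exact (hF 0 W.zero_mem).1
    have h2 := h1.comp_hasDerivAt (0 : ℝ) hline
    exact h2.unique (W.hasDerivAt_estFun ε e k)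
  · have hsub := Metric.closedBall_subset_closedBall (x := (0 : E)) hδ'
    have h := (convex_closedBall (0 : E) δ').norm_image_sub_le_of_norm_hasFDerivWithin_le'
      (fun z hz => (hF z (hsub hz)).1.hasFDerivWithinAt)
      (φ := F' 0) (C := estConst K α Mη * ‖e‖ * q ^ 6 * δ') (fun z hz => ?_) hy hx
    · exact h
    · have h2 := (hF z (hsub hz)).2.2.2 0 W.zero_mem
      have h3 : 0 ≤ estConst K α Mη * ‖e‖ * q ^ (2 + 4) := by
        have hK := W.K_one
        have hα := W.α_nonneg
        have hM := W.Mη_nonneg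
        have hc : 0 ≤ scoreConst K := by unfold scoreConst; positivity
        have : 0 ≤ estConst K α Mη := by unfold estConst; positivity
        positivity
      rw [mem_closedBall_zero_iff] at hz
      rw [sub_zero] at h2
      exact h2.trans (by gcongr)

variable [MeasurableSpace V] [BorelSpace V]

/-- The estimating functions are unbiased at the true parameter. -/
theorem integral_estFun_zero (e : E) :
    ∫ ε, estFun B Z ε α η e 0 ∂(stdGaussian V) = 0 := by
  have hα := W.α_nonneg
  have h1 := integral_exp_mul_score hα (Z e) (B e)
  have hi := (integrable_exp_mul_score hα (Z e) (B e)).const_mul (-(1 + α) * η 0)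
  have e1 : ∀ ε, estFun B Z ε α η e 0 = -(1 + α) * η 0 * (Real.exp (-(α / 2) * ‖ε‖ ^ 2) *
      score (Z e) (B e) ε) + -(α / 2 * (1 + α) ^ (-(Module.finrank ℝ V / 2 : ℝ))) *
        (η 0 * trace (B e)) := fun ε => by
    simp only [estFun, weightAt_zero, scoreAt_zero, precision_zero, one_mul]
    ring
  simp_rw [e1]
  rw [integral_add hi (integrable_const _), integral_const_mul, h1]
  simp only [integral_const, probReal_univ, smul_eq_mul]
  have h2 : (1 + α) * ((1 + α)⁻¹ - 1) = -α := by
    field_simp; ring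
  linear_combination (-(η 0) * (1 + α) ^ (-(Module.finrank ℝ V / 2 : ℝ)) * trace (B e) / 2) * h2

/-- The covariance of the estimating functions at the true parameter. -/
theorem integral_estFun_mul (e e' : E) :
    ∫ ε, estFun B Z ε α η e 0 * estFun B Z ε α η e' 0 ∂(stdGaussian V) =
      η 0 ^ 2 * ((1 + α) ^ 2 * ((1 + 2 * α) ^ (-(Module.finrank ℝ V / 2 : ℝ)) *
        ((1 + 2 * α)⁻¹ * ⟪Z e, Z e'⟫ + ((1 - (1 + 2 * α)⁻¹) ^ 2 * (trace (B e) * trace (B e')) +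
          2 * (1 + 2 * α)⁻¹ ^ 2 * trace (B e * B e')) / 4)) -
        α ^ 2 / 4 * ((1 + α) ^ (-(Module.finrank ℝ V / 2 : ℝ))) ^ 2 *
          (trace (B e) * trace (B e'))) := by
  have hα := W.α_nonneg
  set P := (1 + α) ^ (-(Module.finrank ℝ V / 2 : ℝ)) with hP
  have h1 := integral_exp_mul_score hα (Z e) (B e)
  have h1' := integral_exp_mul_score hα (Z e') (B e')
  have h2 := integral_exp_mul_score_mul_score (mul_nonneg zero_le_two hα) (Z e) (Z e')
    (W.symm e) (W.symm e')
  have i1 := (integrable_exp_mul_score hα (Z e) (B e)).const_mul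
    ((1 + α) * η 0 ^ 2 * (α / 2 * P * trace (B e')))
  have i1' := (integrable_exp_mul_score hα (Z e') (B e')).const_mul
    ((1 + α) * η 0 ^ 2 * (α / 2 * P * trace (B e)))
  have i2 := (integrable_exp_mul_score_mul_score (mul_nonneg zero_le_two hα) (Z e) (Z e')
    (B e) (B e')).const_mul ((1 + α) ^ 2 * η 0 ^ 2)
  set c := (α / 2 * P) ^ 2 * η 0 ^ 2 * (trace (B e) * trace (B e')) with hc
  have e1 : ∀ ε, estFun B Z ε α η e 0 * estFun B Z ε α η e' 0 =
      (1 + α) ^ 2 * η 0 ^ 2 * (Real.exp (-(2 * α / 2) * ‖ε‖ ^ 2) *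
        (score (Z e) (B e) ε * score (Z e') (B e') ε)) +
      ((1 + α) * η 0 ^ 2 * (α / 2 * P * trace (B e')) * (Real.exp (-(α / 2) * ‖ε‖ ^ 2) *
        score (Z e) (B e) ε) +
      ((1 + α) * η 0 ^ 2 * (α / 2 * P * trace (B e)) * (Real.exp (-(α / 2) * ‖ε‖ ^ 2) *
        score (Z e') (B e') ε) + c)) := fun ε => by
    have h3 : Real.exp (-(2 * α / 2) * ‖ε‖ ^ 2) = Real.exp (-(α / 2) * ‖ε‖ ^ 2) ^ 2 := by
      rw [← Real.exp_nat_mul]; congr 1; push_cast; ring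
    simp only [estFun, weightAt_zero, scoreAt_zero, precision_zero, one_mul, h3, hc]
    ring
  simp_rw [e1]
  have i3 : Integrable (fun ε => (1 + α) * η 0 ^ 2 * (α / 2 * P * trace (B e)) *
      (Real.exp (-(α / 2) * ‖ε‖ ^ 2) * score (Z e') (B e') ε) + c) (stdGaussian V) :=
    i1'.add (integrable_const c)
  have i4 : Integrable (fun ε => (1 + α) * η 0 ^ 2 * (α / 2 * P * trace (B e')) *
      (Real.exp (-(α / 2) * ‖ε‖ ^ 2) * score (Z e) (B e) ε) +
        ((1 + α) * η 0 ^ 2 * (α / 2 * P * trace (B e)) *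
      (Real.exp (-(α / 2) * ‖ε‖ ^ 2) * score (Z e') (B e') ε) + c)) (stdGaussian V) :=
    i1.add i3
  rw [integral_add i2 i4, integral_add i1 i3, integral_add i1' (integrable_const _),
    integral_const_mul, integral_const_mul,
    integral_const_mul, h1, h1', h2]
  simp only [integral_const, probReal_univ, smul_eq_mul, hc]
  have h2 : (1 + α) * ((1 + α)⁻¹ - 1) = -α := by
    field_simp; ring
  linear_combination (η 0 ^ 2 * α / 2 * P ^ 2 * trace (B e) * trace (B e')) * h2

/-- The mean derivative of the estimating functions at the true parameter. -/
theorem integral_estDeriv (e k : E) :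
    ∫ ε, estDeriv B Z ε α (η 0) e k ∂(stdGaussian V) =
      η 0 * (1 + α) ^ (-(Module.finrank ℝ V / 2 : ℝ)) * (⟪Z e, Z k⟫ + (1 + α)⁻¹ *
        (α ^ 2 * (trace (B e) * trace (B k)) + 2 * trace (B e * B k)) / 4) := by
  have hα := W.α_nonneg
  have hs : ∀ e a b, ⟪B e a, b⟫ = ⟪a, B e b⟫ := fun e => W.symm e
  have htr : trace (B k * B e) = trace (B e * B k) := by
    have := LinearMap.trace_mul_comm ℝ (B k : V →ₗ[ℝ] V) (B e)
    exact this
  set P := (1 + α) ^ (-(Module.finrank ℝ V / 2 : ℝ)) with hP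
  set c := trace (B k * B e) / 2 - ⟪Z e, Z k⟫ with hc
  set l := -(B k (Z e) + B e (Z k)) with hl
  set A := (-(1 / 2) : ℝ) • (B k * B e + B e * B k) with hA
  have e0 : ∀ ε, scoreDeriv B Z ε e k = c + ⟪l, ε⟫ + ⟪ε, A ε⟫ := fun ε => by
    simp only [scoreDeriv, hc, hl, hA, smul_apply, add_apply, inner_neg_left, inner_add_left, hs,
      inner_smul_right, inner_add_right]
    ring
  have htA : trace A = -trace (B e * B k) := by
    rw [hA, ← traceCLM_apply, map_smul, map_add, traceCLM_apply, traceCLM_apply, htr,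
      smul_eq_mul]
    ring
  have h1 := integral_exp_mul_quadratic hα c l A
  have h2 := integral_exp_mul_score_mul_score hα (Z k) (Z e) (W.symm k) (W.symm e)
  have i1 := (integrable_exp_mul_quadratic hα c l A).const_mul (-(1 + α) * η 0)
  have i2 := (integrable_exp_mul_score_mul_score hα (Z k) (Z e) (B k) (B e)).const_mul
    (-(1 + α) * η 0 * α)
  set d := (α / 2 * P) * (η 0 * (α / 2 * (trace (B k) * trace (B e)) + trace (B k * B e))) with hd
  have e1 : ∀ ε, estDeriv B Z ε α (η 0) e k =
      -(1 + α) * η 0 * α * (Real.exp (-(α / 2) * ‖ε‖ ^ 2) *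
        (score (Z k) (B k) ε * score (Z e) (B e) ε)) +
      (-(1 + α) * η 0 * (Real.exp (-(α / 2) * ‖ε‖ ^ 2) * (c + ⟪l, ε⟫ + ⟪ε, A ε⟫)) + d) :=
    fun ε => by
      rw [estDeriv, e0]; ring
  simp_rw [e1]
  have i3 : Integrable (fun ε => -(1 + α) * η 0 * (Real.exp (-(α / 2) * ‖ε‖ ^ 2) *
      (c + ⟪l, ε⟫ + ⟪ε, A ε⟫)) + d) (stdGaussian V) := i1.add (integrable_const d)
  rw [integral_add i2 i3, integral_add i1 (integrable_const _), integral_const_mul,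
    integral_const_mul, h1, h2]
  simp only [integral_const, probReal_univ, smul_eq_mul, hd, hc, htA, htr,
    real_inner_comm (Z e) (Z k)]
  have h3 : 1 + α ≠ 0 := by linarith
  field_simp
  ring

end WhiteGroup
end White


/-! ### A central limit theorem under Lyapunov's condition -/

section CLT

open scoped RealInnerProductSpace

theorem norm_cexp_sub_taylor_le (x : ℝ) :
    ‖Complex.exp (x * Complex.I) - (1 + x * Complex.I - x ^ 2 / 2)‖ ≤ 4 * |x| ^ 3 := by
  have hn : ‖(x * Complex.I : ℂ)‖ = |x| := by simp
  have e : (1 + x * Complex.I - x ^ 2 / 2 : ℂ) =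
      ∑ m ∈ Finset.range 3, (x * Complex.I : ℂ) ^ m / (m.factorial : ℂ) := by
    simp only [Finset.sum_range_succ, Finset.sum_range_zero, mul_pow, Complex.I_sq]
    norm_num [Nat.factorial]
    ring
  rcases le_or_gt |x| 1 with h | h
  · rw [e]
    refine (Complex.exp_bound (by rw [hn]; exact h) (n := 3) (by norm_num)).trans ?_
    rw [hn]
    norm_num [Nat.factorial]
    nlinarith [pow_nonneg (abs_nonneg x) 3]
  · have h1 : ‖(1 + x * Complex.I - x ^ 2 / 2 : ℂ)‖ ≤ 1 + |x| + |x| ^ 2 / 2 := by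
      refine (norm_sub_le _ _).trans (add_le_add ((norm_add_le _ _).trans ?_) ?_)
      · simp
      · simp
    have h2 : ‖Complex.exp (x * Complex.I)‖ = 1 := Complex.norm_exp_ofReal_mul_I x
    have h3 : |x| ≤ |x| ^ 3 := by nlinarith [mul_pos (by linarith : 0 < |x|) (by linarith : 0 < |x|)]
    have h4 : |x| ^ 2 ≤ |x| ^ 3 := pow_le_pow_right₀ h.le (by norm_num)
    calc _ ≤ ‖Complex.exp (x * Complex.I)‖ + ‖(1 + x * Complex.I - x ^ 2 / 2 : ℂ)‖ :=
          norm_sub_le _ _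
      _ ≤ _ := by rw [h2]; linarith

theorem norm_prod_sub_prod_le {ι : Type*} (s : Finset ι) (a b : ι → ℂ)
    (ha : ∀ i ∈ s, ‖a i‖ ≤ 1) (hb : ∀ i ∈ s, ‖b i‖ ≤ 1) :
    ‖∏ i ∈ s, a i - ∏ i ∈ s, b i‖ ≤ ∑ i ∈ s, ‖a i - b i‖ := by
  classical
  induction s using Finset.induction_on with
  | empty => simp
  | insert i s hi ih =>
    rw [Finset.prod_insert hi, Finset.prod_insert hi, Finset.sum_insert hi]
    have h1 := ih (fun j hj => ha j (Finset.mem_insert_of_mem hj))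
      (fun j hj => hb j (Finset.mem_insert_of_mem hj))
    have h2 : ‖∏ j ∈ s, a j‖ ≤ 1 := by
      rw [norm_prod]
      exact Finset.prod_le_one (fun _ _ => norm_nonneg _)
        fun j hj => ha j (Finset.mem_insert_of_mem hj)
    have h3 := hb i (Finset.mem_insert_self _ _)
    have e : a i * ∏ j ∈ s, a j - b i * ∏ j ∈ s, b j =
        (a i - b i) * ∏ j ∈ s, a j + b i * (∏ j ∈ s, a j - ∏ j ∈ s, b j) := by ring
    rw [e]
    refine (norm_add_le _ _).trans (add_le_add ?_ ?_)
    · rw [norm_mul]; exact mul_le_of_le_one_right (norm_nonneg _) h2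
    · rw [norm_mul]; exact (mul_le_of_le_one_left (norm_nonneg _) h3).trans h1

variable {S : Type*} [MeasurableSpace S] {μ : Measure S} [IsProbabilityMeasure μ]

theorem norm_integral_cexp_sub_le {X : S → ℝ} (hX : AEMeasurable X μ)
    (h3 : Integrable (fun ω => |X ω| ^ 3) μ) (h0 : ∫ ω, X ω ∂μ = 0) :
    ‖∫ ω, Complex.exp (X ω * Complex.I) ∂μ - (1 - (∫ ω, X ω ^ 2 ∂μ : ℝ) / 2)‖ ≤
      4 * ∫ ω, |X ω| ^ 3 ∂μ := by
  have hL3 : MemLp X 3 μ := by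
    refine (integrable_norm_rpow_iff hX.aestronglyMeasurable (by norm_num) (by norm_num)).1 ?_
    refine h3.congr (Eventually.of_forall fun ω => ?_)
    change |X ω| ^ 3 = ‖X ω‖ ^ (3 : ENNReal).toReal
    rw [Real.norm_eq_abs, show (3 : ENNReal).toReal = ((3 : ℕ) : ℝ) by norm_num,
      Real.rpow_natCast]
  have h1 : Integrable X μ := (hL3.mono_exponent (by norm_num : (1 : ENNReal) ≤ 3)).integrable le_rfl
  have h2 : Integrable (fun ω => X ω ^ 2) μ :=
    (hL3.mono_exponent (by norm_num : (2 : ENNReal) ≤ 3)).integrable_sq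
  have he : Integrable (fun ω => Complex.exp (X ω * Complex.I)) μ := by
    refine Integrable.of_bound (by fun_prop) 1 (Eventually.of_forall fun ω => ?_)
    rw [Complex.norm_exp_ofReal_mul_I]
  have h1c : Integrable (fun ω => (X ω : ℂ) * Complex.I) μ := h1.ofReal.mul_const _
  have h2c : Integrable (fun ω => (X ω : ℂ) ^ 2 / 2) μ := by
    have := (h2.ofReal (𝕜 := ℂ)).div_const 2
    simpa using this
  have h12 : Integrable (fun ω => 1 + (X ω : ℂ) * Complex.I) μ := (integrable_const _).add h1c
  have e : ∫ ω, (1 + X ω * Complex.I - X ω ^ 2 / 2 : ℂ) ∂μ =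
      1 - ((∫ ω, X ω ^ 2 ∂μ : ℝ) : ℂ) / 2 := by
    rw [integral_sub h12 h2c, integral_add (integrable_const _) h1c, integral_mul_const,
      integral_div, integral_complex_ofReal, h0]
    have : ∫ ω, (X ω : ℂ) ^ 2 ∂μ = ((∫ ω, X ω ^ 2 ∂μ : ℝ) : ℂ) := by
      rw [← integral_complex_ofReal]; push_cast; rfl
    rw [this]
    simp
  have h123 : Integrable (fun ω => 1 + (X ω : ℂ) * Complex.I - (X ω : ℂ) ^ 2 / 2) μ := h12.sub h2c
  rw [← e, ← integral_sub he h123, ← integral_const_mul]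
  refine norm_integral_le_of_norm_le (h3.const_mul 4) (Eventually.of_forall fun ω => ?_)
  exact norm_cexp_sub_taylor_le _

theorem abs_exp_neg_sub_le {v : ℝ} (hv : 0 ≤ v) : |Real.exp (-(v / 2)) - (1 - v / 2)| ≤ v ^ 2 := by
  have h1 := Real.add_one_le_exp (-(v / 2))
  have h2 : Real.exp (-(v / 2)) ≤ (1 + v / 2)⁻¹ := by
    rw [Real.exp_neg]
    have := Real.add_one_le_exp (v / 2)
    exact inv_anti₀ (by linarith) (by linarith)
  have h3 : (1 + v / 2)⁻¹ ≤ 1 - v / 2 + v ^ 2 := by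
    rw [inv_le_iff_one_le_mul₀ (by positivity)]
    nlinarith [pow_nonneg hv 3]
  rw [abs_of_nonneg (by linarith)]
  linarith

/-- Characteristic functions of row sums of a triangular array that satisfies Lyapunov's
condition. -/
theorem tendsto_prod_charFun_of_lyapunov {X : ℕ → ℕ → S → ℝ} {v : ℝ}
    (hX : ∀ n i, AEMeasurable (X n i) μ)
    (h3 : ∀ n i, Integrable (fun ω => |X n i ω| ^ 3) μ)
    (h0 : ∀ n i, ∫ ω, X n i ω ∂μ = 0)
    (hv : Tendsto (fun n => ∑ i ∈ Finset.range n, ∫ ω, X n i ω ^ 2 ∂μ) atTop (𝓝 v))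
    (hρ : Tendsto (fun n => ∑ i ∈ Finset.range n, ∫ ω, |X n i ω| ^ 3 ∂μ) atTop (𝓝 0)) :
    Tendsto (fun n => ∏ i ∈ Finset.range n, ∫ ω, Complex.exp (X n i ω * Complex.I) ∂μ) atTop
      (𝓝 (Complex.exp (-(v / 2 : ℝ)))) := by
  set s : ℕ → ℕ → ℝ := fun n i => ∫ ω, X n i ω ^ 2 ∂μ with hs
  set ρ : ℕ → ℕ → ℝ := fun n i => ∫ ω, |X n i ω| ^ 3 ∂μ with hρdef
  have s0 : ∀ n i, 0 ≤ s n i := fun n i => integral_nonneg fun ω => sq_nonneg _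
  have ρ0 : ∀ n i, 0 ≤ ρ n i := fun n i => integral_nonneg fun ω => by
    change 0 ≤ |X n i ω| ^ 3; positivity
  have hsum0 : ∀ n, 0 ≤ ∑ i ∈ Finset.range n, ρ n i := fun n => Finset.sum_nonneg fun i _ => ρ0 n i
  -- Variances are controlled by third moments: `x² ≤ l² + x³ / l` for every `l > 0`.
  have hsρ : ∀ l : ℝ, 0 < l → ∀ n i, s n i ≤ l ^ 2 + ρ n i / l := fun l hl n i => by
    have h : s n i ≤ ∫ ω, (l ^ 2 + |X n i ω| ^ 3 / l) ∂μ := by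
      refine integral_mono_of_nonneg (Eventually.of_forall fun ω => sq_nonneg _)
        ((integrable_const _).add ((h3 n i).div_const l)) (Eventually.of_forall fun ω => ?_)
      change X n i ω ^ 2 ≤ l ^ 2 + |X n i ω| ^ 3 / l
      rw [← sq_abs]
      have hx := abs_nonneg (X n i ω)
      rcases le_or_gt |X n i ω| l with hle | hlt
      · have : 0 ≤ |X n i ω| ^ 3 / l := by positivity
        nlinarith
      · have : |X n i ω| ^ 2 ≤ |X n i ω| ^ 3 / l := by
          rw [le_div_iff₀ hl]; nlinarith [sq_nonneg |X n i ω|]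
        nlinarith
    rw [integral_add (integrable_const _) ((h3 n i).div_const l), integral_div] at h
    simpa using h
  -- Each factor is close to the Gaussian one, as both agree with `1 - s / 2` up to small errors.
  have hmain : Tendsto (fun n => ∏ i ∈ Finset.range n, ∫ ω, Complex.exp (X n i ω * Complex.I) ∂μ -
      ∏ i ∈ Finset.range n, Complex.exp (-(s n i / 2 : ℝ))) atTop (𝓝 0) := by
    have hbound : ∀ n, ‖∏ i ∈ Finset.range n, ∫ ω, Complex.exp (X n i ω * Complex.I) ∂μ -
        ∏ i ∈ Finset.range n, Complex.exp (-(s n i / 2 : ℝ))‖ ≤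
        4 * (∑ i ∈ Finset.range n, ρ n i) + ∑ i ∈ Finset.range n, s n i ^ 2 := fun n => by
      refine (norm_prod_sub_prod_le _ _ _ (fun i _ => ?_) (fun i _ => ?_)).trans ?_
      · refine (norm_integral_le_integral_norm _).trans (le_of_eq ?_)
        simp [Complex.norm_exp_ofReal_mul_I]
      · rw [← Complex.ofReal_neg, ← Complex.ofReal_exp, Complex.norm_real, Real.norm_eq_abs,
          abs_of_pos (Real.exp_pos _), Real.exp_le_one_iff]
        linarith [s0 n i]
      · rw [Finset.mul_sum, ← Finset.sum_add_distrib]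
        refine Finset.sum_le_sum fun i _ => ?_
        have h1 := norm_integral_cexp_sub_le (hX n i) (h3 n i) (h0 n i)
        have h2 : ‖(1 - (s n i : ℂ) / 2) - Complex.exp (-(s n i / 2 : ℝ))‖ ≤ s n i ^ 2 := by
          have := abs_exp_neg_sub_le (s0 n i)
          rw [abs_sub_comm] at this
          rw [← Complex.ofReal_neg, ← Complex.ofReal_exp]
          have e : (1 - (s n i : ℂ) / 2) - (Real.exp (-(s n i / 2)) : ℂ) =
            (((1 - s n i / 2) - Real.exp (-(s n i / 2)) : ℝ) : ℂ) := by push_cast; ring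
          rw [e, Complex.norm_real]
          exact this
        calc _ ≤ ‖∫ ω, Complex.exp (X n i ω * Complex.I) ∂μ - (1 - (s n i : ℂ) / 2)‖ +
              ‖(1 - (s n i : ℂ) / 2) - Complex.exp (-(s n i / 2 : ℝ))‖ :=
              norm_sub_le_norm_sub_add_norm_sub _ _ _
          _ ≤ _ := add_le_add h1 h2
    -- If the variances add up to at most `C`, then `s² ≤ s l² + C ρ / l` for every `l > 0`.
    have hs2 : Tendsto (fun n => ∑ i ∈ Finset.range n, s n i ^ 2) atTop (𝓝 0) := by
      rw [Metric.tendsto_atTop]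
      intro ε hε
      have hev : ∀ᶠ n in atTop, ∑ i ∈ Finset.range n, s n i < |v| + 1 :=
        hv.eventually_lt_const (by linarith [le_abs_self v])
      set C := |v| + 1 with hC
      have hC0 : 0 < C := by positivity
      obtain ⟨l, hl, hl2⟩ : ∃ l : ℝ, 0 < l ∧ C * l ^ 2 < ε / 2 := by
        refine ⟨min 1 (ε / (4 * C)), by positivity, ?_⟩
        have h1 : min 1 (ε / (4 * C)) ≤ 1 := min_le_left _ _
        have h2 : min 1 (ε / (4 * C)) ≤ ε / (4 * C) := min_le_right _ _
        have h0 : 0 < min 1 (ε / (4 * C)) := by positivity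
        have h3 : min 1 (ε / (4 * C)) ^ 2 ≤ ε / (4 * C) := by nlinarith
        calc _ ≤ C * (ε / (4 * C)) := by gcongr
          _ = ε / 4 := by field_simp
          _ < _ := by linarith
      have hev2 : ∀ᶠ n in atTop, ∑ i ∈ Finset.range n, ρ n i < ε * l / (2 * C) :=
        hρ.eventually_lt_const (by positivity)
      obtain ⟨N, hN⟩ := eventually_atTop.1 (hev.and hev2)
      refine ⟨N, fun n hn => ?_⟩
      obtain ⟨ha, hb⟩ := hN n hn
      have hnn : 0 ≤ ∑ i ∈ Finset.range n, s n i ^ 2 := Finset.sum_nonneg fun i _ => sq_nonneg _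
      rw [Real.dist_eq, sub_zero, abs_of_nonneg hnn]
      have hsle : ∀ i ∈ Finset.range n, s n i ≤ C := fun i hi =>
        (Finset.single_le_sum (fun j _ => s0 n j) hi).trans ha.le
      calc ∑ i ∈ Finset.range n, s n i ^ 2
          ≤ ∑ i ∈ Finset.range n, (s n i * l ^ 2 + C * (ρ n i / l)) := by
            refine Finset.sum_le_sum fun i hi => ?_
            have h1 := hsρ l hl n i
            have h2 := hsle i hi
            have h3 : 0 ≤ ρ n i / l := div_nonneg (ρ0 n i) hl.le
            nlinarith [s0 n i]
        _ = (∑ i ∈ Finset.range n, s n i) * l ^ 2 + C / l * ∑ i ∈ Finset.range n, ρ n i := by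
            rw [Finset.sum_add_distrib, Finset.sum_mul, Finset.mul_sum]
            congr 1
            exact Finset.sum_congr rfl fun i _ => by ring
        _ ≤ C * l ^ 2 + C / l * (ε * l / (2 * C)) := by gcongr
        _ = C * l ^ 2 + ε / 2 := by field_simp
        _ < ε := by linarith
    refine squeeze_zero_norm hbound ?_
    simpa using (hρ.const_mul 4).add hs2
  have hexp : Tendsto (fun n => ∏ i ∈ Finset.range n, Complex.exp (-(s n i / 2 : ℝ))) atTop
      (𝓝 (Complex.exp (-(v / 2 : ℝ)))) := by
    have e : ∀ n, ∏ i ∈ Finset.range n, Complex.exp (-(s n i / 2 : ℝ)) =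
        Complex.exp (((-((∑ i ∈ Finset.range n, s n i) / 2) : ℝ)) : ℂ) := fun n => by
      rw [← Complex.exp_sum]
      congr 1
      push_cast
      rw [Finset.sum_neg_distrib, Finset.sum_div]
    simp_rw [e]
    have hc := (Complex.continuous_exp.comp Complex.continuous_ofReal).tendsto (-(v / 2))
    have := hc.comp (hv.div_const 2).neg
    simpa [Function.comp_def] using this
  simpa using hmain.add hexp

/-- A multivariate central limit theorem for independent centred vectors, normalized by linear
maps `L n`, under Lyapunov's condition. -/
theorem tendstoInDistribution_of_lyapunov {F : Type*} [NormedAddCommGroup F]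
    [InnerProductSpace ℝ F] [FiniteDimensional ℝ F] [MeasurableSpace F] [BorelSpace F]
    {ξ : ℕ → S → F} (hξ : ∀ i, AEMeasurable (ξ i) μ) (hind : iIndepFun ξ μ) (L : ℕ → F →L[ℝ] F)
    (h3 : ∀ i, Integrable (fun ω => ‖ξ i ω‖ ^ 3) μ)
    (h0 : ∀ i, ∀ t : F, ∫ ω, ⟪t, ξ i ω⟫ ∂μ = 0)
    (hv : ∀ t : F, Tendsto (fun n => ∑ i ∈ Finset.range n, ∫ ω, ⟪t, L n (ξ i ω)⟫ ^ 2 ∂μ) atTop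
      (𝓝 (‖t‖ ^ 2)))
    (hρ : Tendsto (fun n => ‖L n‖ ^ 3 * ∑ i ∈ Finset.range n, ∫ ω, ‖ξ i ω‖ ^ 3 ∂μ) atTop (𝓝 0)) :
    TendstoInDistribution (fun n ω => ∑ i ∈ Finset.range n, L n (ξ i ω)) atTop (id : F → F)
      (fun _ => μ) (stdGaussian F) where
  forall_aemeasurable n := by
    refine Finset.aemeasurable_fun_sum _ fun i _ => ?_
    exact (L n).continuous.measurable.comp_aemeasurable (hξ i)
  tendsto := by
    have hm : ∀ n i, AEMeasurable (fun ω => L n (ξ i ω)) μ := fun n i =>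
      (L n).continuous.measurable.comp_aemeasurable (hξ i)
    refine ProbabilityMeasure.tendsto_iff_tendsto_charFun.2 fun t => ?_
    simp only [ProbabilityMeasure.coe_mk, Measure.map_id, charFun_stdGaussian]
    have hbd : ∀ n i ω, |⟪t, L n (ξ i ω)⟫| ^ 3 ≤ ‖t‖ ^ 3 * ‖L n‖ ^ 3 * ‖ξ i ω‖ ^ 3 :=
      fun n i ω => by
        have h1 := abs_real_inner_le_norm t (L n (ξ i ω))
        have h2 := (L n).le_opNorm (ξ i ω)
        calc _ ≤ (‖t‖ * (‖L n‖ * ‖ξ i ω‖)) ^ 3 := by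
              gcongr
              exact h1.trans (by gcongr)
          _ = _ := by ring
    have hi3 : ∀ n i, Integrable (fun ω => |⟪t, L n (ξ i ω)⟫| ^ 3) μ := fun n i => by
      refine ((h3 i).const_mul (‖t‖ ^ 3 * ‖L n‖ ^ 3)).mono' ?_ (Eventually.of_forall fun ω => ?_)
      · have := hm n i
        exact AEMeasurable.aestronglyMeasurable (by fun_prop)
      · rw [Real.norm_eq_abs, abs_of_nonneg (by positivity)]
        exact hbd n i ω
    have key := tendsto_prod_charFun_of_lyapunov (μ := μ) (v := ‖t‖ ^ 2)
      (X := fun n i ω => ⟪t, L n (ξ i ω)⟫) (fun n i => by have := hm n i; fun_prop) hi3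
      (fun n i => by
        have := h0 i (ContinuousLinearMap.adjoint (L n) t)
        simpa [ContinuousLinearMap.adjoint_inner_left] using this) (hv t) (by
          have := hρ.const_mul (‖t‖ ^ 3)
          rw [mul_zero] at this
          refine squeeze_zero (fun n => Finset.sum_nonneg fun i _ => integral_nonneg fun ω => ?_)
            (fun n => ?_) this
          · change 0 ≤ |⟪t, L n (ξ i ω)⟫| ^ 3; positivity
          · rw [← mul_assoc, Finset.mul_sum]
            refine Finset.sum_le_sum fun i _ => ?_
            rw [← integral_const_mul]
            exact integral_mono (hi3 n i) ((h3 i).const_mul _) (hbd n i))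
    have e : ∀ n, charFun (μ.map fun ω => ∑ i ∈ Finset.range n, L n (ξ i ω)) t =
        ∏ i ∈ Finset.range n, ∫ ω, Complex.exp (⟪t, L n (ξ i ω)⟫ * Complex.I) ∂μ := fun n => by
      have hind' : iIndepFun (fun i ω => L n (ξ i ω)) μ :=
        hind.comp (fun _ => L n) fun _ => (L n).continuous.measurable
      rw [(hind'.restrict _).charFun_map_fun_finsetSum_eq_prod fun i _ => hm n i,
        Finset.prod_apply]
      refine Finset.prod_congr rfl fun i _ => ?_
      rw [charFun_apply, integral_map (hm n i) (by fun_prop)]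
      simp_rw [real_inner_comm]
    simp_rw [e]
    refine key.trans (le_of_eq ?_)
    congr 2
    push_cast
    ring

end CLT


/-! ### Roots of random equations that are nearly linear -/

section ZEstimation

variable {E : Type*} [NormedAddCommGroup E] [NormedSpace ℝ E]

/-- The Newton step for the equation `G x = 0` with a fixed approximation `L` to the inverse of
the derivative. -/
def newtonStep (L : E →L[ℝ] E) (G : E → E) (x : E) : E := x - L (G x)

/-- If `G` differs from a linear bijection by a map with small Lipschitz constant, the Newton
iteration is a contraction, so it converges to a root. -/
theorem exists_tendsto_iterate_newtonStep [CompleteSpace E] {G : E → E} {A L : E →L[ℝ] E}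
    {θ₀ : E} {a δ : ℝ} (ha : 0 < a) (hδ : 0 ≤ δ) (hLA : ∀ v, L (A v) = v) (hAL : ∀ v, A (L v) = v)
    (hL : ∀ v, ‖L v‖ ≤ a⁻¹ * ‖v‖)
    (hlin : ∀ x ∈ Metric.closedBall θ₀ δ, ∀ y ∈ Metric.closedBall θ₀ δ,
      ‖G x - G y - A (x - y)‖ ≤ a / 2 * ‖x - y‖)
    (h0 : ‖G θ₀‖ ≤ a * δ / 2) :
    ∃ l ∈ Metric.closedBall θ₀ δ, Tendsto (fun j => (newtonStep L G)^[j] θ₀) atTop (𝓝 l) ∧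
      G l = 0 := by
  have hstep : ∀ x ∈ Metric.closedBall θ₀ δ, ∀ y ∈ Metric.closedBall θ₀ δ,
      ‖newtonStep L G x - newtonStep L G y‖ ≤ 1 / 2 * ‖x - y‖ := fun x hx y hy => by
    have e : newtonStep L G x - newtonStep L G y = -L (G x - G y - A (x - y)) := by
      simp only [newtonStep, map_sub, hLA]
      abel
    rw [e, norm_neg]
    calc _ ≤ a⁻¹ * ‖G x - G y - A (x - y)‖ := hL _
      _ ≤ a⁻¹ * (a / 2 * ‖x - y‖) := by gcongr; exact hlin x hx y hy
      _ = _ := by field_simp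
  have hθ : θ₀ ∈ Metric.closedBall θ₀ δ := Metric.mem_closedBall_self hδ
  have hmaps : Set.MapsTo (newtonStep L G) (Metric.closedBall θ₀ δ) (Metric.closedBall θ₀ δ) :=
    fun x hx => by
      have h1 := hstep x hx θ₀ hθ
      have h2 : ‖newtonStep L G θ₀ - θ₀‖ ≤ δ / 2 := by
        have e : newtonStep L G θ₀ - θ₀ = -L (G θ₀) := by simp [newtonStep]
        rw [e, norm_neg]
        calc _ ≤ a⁻¹ * ‖G θ₀‖ := hL _
          _ ≤ a⁻¹ * (a * δ / 2) := by gcongr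
          _ = _ := by field_simp
      rw [mem_closedBall_iff_norm] at hx ⊢
      calc _ = ‖(newtonStep L G x - newtonStep L G θ₀) + (newtonStep L G θ₀ - θ₀)‖ := by
            congr 1; abel
        _ ≤ 1 / 2 * ‖x - θ₀‖ + δ / 2 := (norm_add_le _ _).trans (add_le_add h1 h2)
        _ ≤ δ := by linarith
  have hcontr : ContractingWith (1 / 2) (hmaps.restrict (newtonStep L G) _ _) := by
    refine ⟨by rw [← NNReal.coe_lt_coe]; norm_num, LipschitzWith.of_dist_le_mul fun x y => ?_⟩
    rw [Subtype.dist_eq, Subtype.dist_eq, dist_eq_norm, dist_eq_norm]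
    simpa using hstep x x.2 y y.2
  obtain ⟨l, hl, hfix, hlim, -⟩ := hcontr.exists_fixedPoint' Metric.isClosed_closedBall.isComplete
    hmaps hθ (edist_ne_top _ _)
  refine ⟨l, hl, hlim, ?_⟩
  have h : L (G l) = 0 := by
    have : l - L (G l) = l := hfix
    simpa using this
  rw [← hAL (G l), h, map_zero]

variable {S : Type*} [MeasurableSpace S] {μ : Measure S}

/-- The random maps `T n` are, uniformly in small neighbourhoods of `θ₀` and up to events of
small probability, close to affine maps with linear parts `A n`. -/
def LocallyLinear (T : ℕ → S → E → E) (A : ℕ → E →L[ℝ] E) (θ₀ : E) (μ : Measure S) : Prop :=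
  ∀ c : ℝ, 0 < c → ∀ η : ENNReal, 0 < η → ∃ δ : ℝ, 0 < δ ∧ ∀ᶠ n in atTop,
    μ {ω | ¬ ∀ x ∈ Metric.closedBall θ₀ δ, ∀ y ∈ Metric.closedBall θ₀ δ,
      ‖T n ω x - T n ω y - A n (x - y)‖ ≤ c * ‖x - y‖} ≤ η

/-- The sequence of random vectors `R n` is bounded in probability. -/
def BoundedInProbability (R : ℕ → S → E) (μ : Measure S) : Prop :=
  ∀ η : ENNReal, 0 < η → ∃ M : ℝ, 0 < M ∧ ∀ᶠ n in atTop, μ {ω | M < ‖R n ω‖} ≤ η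

theorem LocallyLinear.mono_radius {T : ℕ → S → E → E} {A : ℕ → E →L[ℝ] E} {θ₀ : E}
    (h : LocallyLinear T A θ₀ μ) {c : ℝ} (hc : 0 < c) {η : ENNReal} (hη : 0 < η) {ρ : ℝ}
    (hρ : 0 < ρ) : ∃ δ : ℝ, 0 < δ ∧ δ ≤ ρ ∧ ∀ᶠ n in atTop,
    μ {ω | ¬ ∀ x ∈ Metric.closedBall θ₀ δ, ∀ y ∈ Metric.closedBall θ₀ δ,
      ‖T n ω x - T n ω y - A n (x - y)‖ ≤ c * ‖x - y‖} ≤ η := by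
  obtain ⟨δ, hδ, h⟩ := h c hc η hη
  refine ⟨min δ ρ, lt_min hδ hρ, min_le_right _ _, h.mono fun n hn => (measure_mono ?_).trans hn⟩
  have hsub := Metric.closedBall_subset_closedBall (x := θ₀) (min_le_left δ ρ)
  intro ω hω hall
  exact hω fun x hx y hy => hall x (hsub hx) y (hsub hy)

/-- Limits of Newton iterations give measurable roots that converge in probability to `θ₀`, and
that lie in any prescribed neighbourhood of `θ₀` with probability tending to one. -/
theorem LocallyLinear.exists_measurable_roots [CompleteSpace E] [SecondCountableTopology E]
    [MeasurableSpace E] [BorelSpace E] {Ω : ℕ → Type*} [∀ n, MeasurableSpace (Ω n)]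
    {G : (n : ℕ) → Ω n → E → E} (hG : ∀ n, Measurable fun p : Ω n × E => G n p.1 p.2)
    {Y : (n : ℕ) → S → Ω n} {A L : ℕ → E →L[ℝ] E} {θ₀ : E} {a : ℝ} (ha : 0 < a)
    (hA : ∀ᶠ n in atTop, (∀ v, L n (A n v) = v) ∧ (∀ v, A n (L n v) = v) ∧
      ∀ v, ‖L n v‖ ≤ a⁻¹ * ‖v‖)
    (hlin : LocallyLinear (fun n ω => G n (Y n ω)) A θ₀ μ)
    (h0 : TendstoInMeasure μ (fun n ω => G n (Y n ω) θ₀) atTop fun _ => 0)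
    {U : Set E} (hU : U ∈ 𝓝 θ₀) :
    ∃ est : (n : ℕ) → Ω n → E, (∀ n, Measurable (est n)) ∧
      Tendsto (fun n => μ {ω | ¬ (est n (Y n ω) ∈ U ∧ G n (Y n ω) (est n (Y n ω)) = 0)}) atTop
        (𝓝 0) ∧
      TendstoInMeasure μ (fun n ω => est n (Y n ω)) atTop fun _ => θ₀ := by
  have : Nonempty E := ⟨0⟩
  set est : (n : ℕ) → Ω n → E := fun n y =>
    limUnder atTop fun j => (newtonStep (L n) (G n y))^[j] θ₀ with hest
  have hmeas : ∀ n, Measurable (est n) := fun n => by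
    have hiter : ∀ j, Measurable fun y => (newtonStep (L n) (G n y))^[j] θ₀ := fun j => by
      induction j with
      | zero => exact measurable_const
      | succ j ih =>
        simp only [Function.iterate_succ_apply', newtonStep]
        exact ih.sub ((L n).continuous.measurable.comp ((hG n).comp (measurable_id.prodMk ih)))
    exact (StronglyMeasurable.limUnder fun j => (hiter j).stronglyMeasurable).measurable
  -- In every ball around `θ₀` there is a root, up to an event of small probability.
  have key : ∀ ρ : ℝ, 0 < ρ → ∀ η : ENNReal, 0 < η → ∀ᶠ n in atTop,
      μ {ω | ¬ (est n (Y n ω) ∈ Metric.closedBall θ₀ ρ ∧ G n (Y n ω) (est n (Y n ω)) = 0)} ≤ η := by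
    intro ρ hρ η hη
    have hη2 : 0 < η / 2 := ENNReal.half_pos hη.ne'
    obtain ⟨δ, hδ, hδρ, hev⟩ := hlin.mono_radius (half_pos ha) hη2 hρ
    have hev0 := (ENNReal.tendsto_nhds_zero.1
      (tendstoInMeasure_iff_norm.1 h0 (a * δ / 2) (by positivity))) (η / 2) hη2
    filter_upwards [hev, hev0, hA] with n h1 h2 h3
    refine (measure_mono ?_).trans ((measure_union_le _ _).trans
      ((add_le_add h1 h2).trans (ENNReal.add_halves η).le))
    intro ω hω
    by_contra hcon
    simp only [Set.mem_union, Set.mem_ofPred_eq, not_or, not_not, not_le, sub_zero] at hcon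
    obtain ⟨hc1, hc2⟩ := hcon
    obtain ⟨l, hl, hlim, hroot⟩ := exists_tendsto_iterate_newtonStep ha hδ.le h3.1 h3.2.1 h3.2.2
      hc1 hc2.le
    have hle : est n (Y n ω) = l := hlim.limUnder_eq
    apply hω
    rw [hle]
    exact ⟨Metric.closedBall_subset_closedBall hδρ hl, hroot⟩
  refine ⟨est, hmeas, ?_, ?_⟩
  · obtain ⟨ρ, hρ, hsub⟩ := Metric.nhds_basis_closedBall.mem_iff.1 hU
    refine ENNReal.tendsto_nhds_zero.2 fun η hη => (key ρ hρ η hη).mono fun n hn =>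
      le_trans (measure_mono ?_) hn
    intro ω hω h
    exact hω ⟨hsub h.1, h.2⟩
  · refine tendstoInMeasure_iff_norm.2 fun ε hε => ENNReal.tendsto_nhds_zero.2 fun η hη =>
      (key (ε / 2) (half_pos hε) η hη).mono fun n hn => le_trans (measure_mono ?_) hn
    intro ω hω h
    have h1 := mem_closedBall_iff_norm.1 h.1
    have h2 : ε ≤ ‖est n (Y n ω) - θ₀‖ := hω
    linarith

/-- The asymptotic linear representation of a consistent sequence of roots. -/
theorem LocallyLinear.tendstoInMeasure_linearization {T : ℕ → S → E → E} {A L : ℕ → E →L[ℝ] E}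
    {θ₀ : E} {a : ℝ} (ha : 0 < a)
    (hA : ∀ᶠ n in atTop, (∀ v, L n (A n v) = v) ∧ ∀ v, ‖L n v‖ ≤ a⁻¹ * ‖v‖)
    (hlin : LocallyLinear T A θ₀ μ)
    (h0 : BoundedInProbability (fun (n : ℕ) ω => √(n : ℝ) • T n ω θ₀) μ) {θhat : ℕ → S → E}
    (hroot : Tendsto (fun n => μ {ω | ¬ T n ω (θhat n ω) = 0}) atTop (𝓝 0))
    (hcons : TendstoInMeasure μ θhat atTop fun _ => θ₀) :
    TendstoInMeasure μ
      (fun (n : ℕ) ω => A n (√(n : ℝ) • (θhat n ω - θ₀)) + √(n : ℝ) • T n ω θ₀) atTop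
      fun _ => 0 := by
  refine tendstoInMeasure_iff_norm.2 fun ε hε => ENNReal.tendsto_nhds_zero.2 fun η hη => ?_
  have hη4 : 0 < η / 2 / 2 := ENNReal.half_pos (ENNReal.half_pos hη.ne').ne'
  obtain ⟨M, hM, hMev⟩ := h0 _ hη4
  -- The bound `a / 2` controls `‖d‖` by `‖T n ω θ₀‖`; the other one makes the remainder, at most
  -- `c * (2 / a) * M` when `‖√n T n ω θ₀‖ ≤ M`, no larger than `ε / 2`.
  set c : ℝ := min (a / 2) (a * ε / (4 * M)) with hc
  have hc0 : 0 < c := by positivity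
  obtain ⟨δ, hδ, hδev⟩ := hlin c hc0 _ hη4
  have hrev := ENNReal.tendsto_nhds_zero.1 hroot _ hη4
  have hcev := ENNReal.tendsto_nhds_zero.1 (tendstoInMeasure_iff_norm.1 hcons δ hδ) _ hη4
  filter_upwards [hMev, hδev, hrev, hcev, hA] with n h1 h2 h3 h4 h5
  have hsum : η / 2 / 2 + η / 2 / 2 + (η / 2 / 2 + η / 2 / 2) = η := by
    rw [ENNReal.add_halves, ENNReal.add_halves]
  refine (measure_mono ?_).trans ((measure_union_le _ _).trans
    ((add_le_add ((measure_union_le _ _).trans (add_le_add h1 h2))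
      ((measure_union_le _ _).trans (add_le_add h3 h4))).trans hsum.le))
  intro ω hω
  by_contra hcon
  simp only [Set.mem_union, Set.mem_ofPred_eq, not_or, not_not, not_le, not_lt] at hcon
  obtain ⟨⟨hc1, hc2⟩, hc3, hc4⟩ := hcon
  set d : E := θhat n ω - θ₀ with hd
  have hb := hc2 (θhat n ω) (mem_closedBall_iff_norm.2 hc4.le) θ₀ (Metric.mem_closedBall_self hδ.le)
  rw [hc3, ← hd, zero_sub, ← neg_add', norm_neg, add_comm] at hb
  -- `‖d‖` is of the order of `‖T n ω θ₀‖`.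
  have hd1 : ‖d‖ ≤ 2 * a⁻¹ * ‖T n ω θ₀‖ := by
    have e1 : ‖d‖ ≤ a⁻¹ * ‖A n d‖ := by
      have := h5.2 (A n d)
      rwa [h5.1] at this
    have e2 : ‖A n d‖ ≤ a / 2 * ‖d‖ + ‖T n ω θ₀‖ := by
      calc ‖A n d‖ = ‖(A n d + T n ω θ₀) - T n ω θ₀‖ := by rw [add_sub_cancel_right]
        _ ≤ c * ‖d‖ + ‖T n ω θ₀‖ := (norm_sub_le _ _).trans (by gcongr)
        _ ≤ _ := by gcongr; exact min_le_left _ _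
    have e3 : a⁻¹ * ‖A n d‖ ≤ a⁻¹ * (a / 2 * ‖d‖ + ‖T n ω θ₀‖) := by gcongr
    have e4 : a⁻¹ * (a / 2 * ‖d‖ + ‖T n ω θ₀‖) = ‖d‖ / 2 + a⁻¹ * ‖T n ω θ₀‖ := by field_simp
    linarith
  have hfin : ‖A n (√(n : ℝ) • d) + √(n : ℝ) • T n ω θ₀‖ ≤ ε / 2 := by
    rw [map_smul, ← smul_add, norm_smul, Real.norm_eq_abs, abs_of_nonneg (Real.sqrt_nonneg _)]
    rw [norm_smul, Real.norm_eq_abs, abs_of_nonneg (Real.sqrt_nonneg _)] at hc1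
    calc √(n : ℝ) * ‖A n d + T n ω θ₀‖ ≤ √(n : ℝ) * (c * (2 * a⁻¹ * ‖T n ω θ₀‖)) := by
          gcongr
          exact hb.trans (by gcongr)
      _ = c * (2 * a⁻¹) * (√(n : ℝ) * ‖T n ω θ₀‖) := by ring
      _ ≤ (a * ε / (4 * M)) * (2 * a⁻¹) * M := by
          gcongr
          exact min_le_right _ _
      _ = ε / 2 := by field_simp; ring
  have hω' : ε ≤ ‖A n (√(n : ℝ) • d) + √(n : ℝ) • T n ω θ₀ - 0‖ := hω
  rw [sub_zero] at hω'
  linarith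

/-- Chebyshev's inequality: random vectors with bounded second moments are bounded in
probability. -/
theorem boundedInProbability_of_integral_sq_le [MeasurableSpace E] [OpensMeasurableSpace E]
    [IsFiniteMeasure μ] {R : ℕ → S → E}
    (hi : ∀ n, Integrable (fun ω => ‖R n ω‖ ^ 2) μ) {C : ℝ}
    (hC : ∀ᶠ n in atTop, ∫ ω, ‖R n ω‖ ^ 2 ∂μ ≤ C) : BoundedInProbability R μ := by
  intro η hη
  rcases eq_or_ne η ⊤ with rfl | hη'
  · exact ⟨1, one_pos, Eventually.of_forall fun n => le_top⟩
  have hpos : 0 < η.toReal := ENNReal.toReal_pos hη.ne' hη'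
  refine ⟨√(|C| / η.toReal) + 1, by positivity, hC.mono fun n hn => ?_⟩
  set M := √(|C| / η.toReal) + 1 with hM
  have hM2 : |C| / η.toReal ≤ M ^ 2 := by
    have := Real.sq_sqrt (show 0 ≤ |C| / η.toReal by positivity)
    nlinarith [Real.sqrt_nonneg (|C| / η.toReal)]
  have hMpos : 0 < M := by positivity
  have hmk := mul_meas_ge_le_integral_of_nonneg
    (Eventually.of_forall fun ω => sq_nonneg ‖R n ω‖) (hi n) (M ^ 2)
  have h1 : μ.real {ω | M ^ 2 ≤ ‖R n ω‖ ^ 2} ≤ η.toReal := by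
    rw [div_le_iff₀ hpos] at hM2
    have h3 : M ^ 2 * μ.real {ω | M ^ 2 ≤ ‖R n ω‖ ^ 2} ≤ M ^ 2 * η.toReal := by
      refine hmk.trans (hn.trans ((le_abs_self C).trans ?_))
      linarith
    exact le_of_mul_le_mul_left h3 (by positivity)
  calc μ {ω | M < ‖R n ω‖} ≤ μ {ω | M ^ 2 ≤ ‖R n ω‖ ^ 2} := by
        refine measure_mono fun ω hω => ?_
        have : M < ‖R n ω‖ := hω
        change M ^ 2 ≤ ‖R n ω‖ ^ 2
        gcongr
    _ ≤ η := by
        rw [← ENNReal.ofReal_toReal hη', ← ENNReal.ofReal_toReal (measure_ne_top μ _)]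
        exact ENNReal.ofReal_le_ofReal h1

end ZEstimation


/-! ### Averages of independent white groups -/

section WhiteSystem

open scoped RealInnerProductSpace

section Average

variable {S : Type*} [MeasurableSpace S] {μ : Measure S} [IsProbabilityMeasure μ]

theorem variance_sum_le {X : ℕ → S → ℝ} (hX : ∀ i, MemLp (X i) 2 μ) (hind : iIndepFun X μ)
    (n : ℕ) : ∫ ω, (∑ i ∈ Finset.range n, X i ω - ∑ i ∈ Finset.range n, ∫ ω', X i ω' ∂μ) ^ 2 ∂μ ≤
      ∑ i ∈ Finset.range n, ∫ ω, X i ω ^ 2 ∂μ := by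
  have h1 := IndepFun.variance_sum (μ := μ) (X := X) (s := Finset.range n) (fun i _ => hX i)
    (fun i _ j _ hij => hind.indepFun hij)
  have hae : AEMeasurable (∑ i ∈ Finset.range n, X i) μ :=
    Finset.aemeasurable_sum _ fun i _ => (hX i).aestronglyMeasurable.aemeasurable
  rw [variance_eq_integral hae] at h1
  simp only [Finset.sum_apply] at h1
  rw [integral_finsetSum _ fun i _ => (hX i).integrable (by norm_num)] at h1
  rw [h1]
  refine Finset.sum_le_sum fun i _ => ?_
  exact variance_le_expectation_sq (hX i).aestronglyMeasurable

/-- The centred average of independent variables tends to zero in mean square if the second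
moments do not grow too fast. -/
theorem tendsto_integral_centred_average_sq {X : ℕ → S → ℝ} (hX : ∀ i, MemLp (X i) 2 μ)
    (hind : iIndepFun X μ) {b : ℕ → ℝ} (hb : ∀ i, ∫ ω, X i ω ^ 2 ∂μ ≤ b i)
    (hlim : Tendsto (fun n : ℕ => (1 / n : ℝ) ^ 2 * ∑ i ∈ Finset.range n, b i) atTop (𝓝 0)) :
    Tendsto (fun n : ℕ => ∫ ω, ((1 / n : ℝ) * ∑ i ∈ Finset.range n, X i ω -
      (1 / n : ℝ) * ∑ i ∈ Finset.range n, ∫ ω', X i ω' ∂μ) ^ 2 ∂μ) atTop (𝓝 0) := by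
  refine squeeze_zero (fun n => integral_nonneg fun ω => sq_nonneg _) (fun n => ?_) hlim
  simp_rw [← mul_sub, mul_pow]
  rw [integral_const_mul]
  gcongr
  exact (variance_sum_le hX hind n).trans (Finset.sum_le_sum fun i _ => hb i)

end Average

section Size

/-- If the cubes of the sizes have bounded averages, the sum of the fourth powers is of smaller
order than the square of the number of groups. -/
theorem tendsto_sum_pow_four {d : ℕ → ℝ} (hd : ∀ i, 1 ≤ d i) {C : ℝ}
    (hC : ∀ n : ℕ, ∑ i ∈ Finset.range n, d i ^ 3 ≤ C * n) :
    Tendsto (fun n : ℕ => (1 / n : ℝ) ^ 2 * ∑ i ∈ Finset.range n, d i ^ 4) atTop (𝓝 0) := by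
  have hC1 : 0 ≤ C := by
    have := hC 1
    simp only [Finset.sum_range_one, Nat.cast_one, mul_one] at this
    exact le_trans (by have := hd 0; positivity) this
  have hb : ∀ n : ℕ, 0 < n → (1 / n : ℝ) ^ 2 * ∑ i ∈ Finset.range n, d i ^ 4 ≤
      C * √C * (√(n : ℝ))⁻¹ := fun n hn => by
    have hn' : (0 : ℝ) < n := by exact_mod_cast hn
    -- Every single size is at most of order `√n`, because already its square is bounded by `C n`.
    have h1 : ∀ i ∈ Finset.range n, d i ≤ √(C * n) := fun i hi => by
      refine Real.le_sqrt_of_sq_le (le_trans ?_ ((Finset.single_le_sum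
        (f := fun j => d j ^ 3) (fun j _ => ?_) hi).trans (hC n)))
      · exact pow_le_pow_right₀ (hd i) (by norm_num)
      · have := hd j; positivity
    have h2 : ∑ i ∈ Finset.range n, d i ^ 4 ≤ √(C * n) * (C * n) := by
      calc ∑ i ∈ Finset.range n, d i ^ 4 ≤ ∑ i ∈ Finset.range n, √(C * n) * d i ^ 3 := by
            refine Finset.sum_le_sum fun i hi => ?_
            have := hd i
            calc d i ^ 4 = d i * d i ^ 3 := by ring
              _ ≤ _ := by gcongr; exact h1 i hi
        _ ≤ _ := by rw [← Finset.mul_sum]; gcongr; exact hC n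
    calc _ ≤ (1 / n : ℝ) ^ 2 * (√(C * n) * (C * n)) := by gcongr
      _ = C * √C * (√(n : ℝ))⁻¹ := by
        rw [Real.sqrt_mul hC1]
        have hs : √(n : ℝ) ≠ 0 := (Real.sqrt_pos.2 hn').ne'
        have hs2 : √(n : ℝ) ^ 2 = n := Real.sq_sqrt hn'.le
        generalize √(n : ℝ) = s at hs hs2
        rw [← hs2]
        field_simp
  have hlim : Tendsto (fun n : ℕ => C * √C * (√(n : ℝ))⁻¹) atTop (𝓝 0) := by
    have : Tendsto (fun n : ℕ => (√(n : ℝ))⁻¹) atTop (𝓝 0) :=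
      (Real.tendsto_sqrt_atTop.comp tendsto_natCast_atTop_atTop).inv_tendsto_atTop
    simpa using this.const_mul (C * √C)
  refine squeeze_zero' (Eventually.of_forall fun n => ?_) ((eventually_gt_atTop 0).mono hb) hlim
  exact mul_nonneg (sq_nonneg _) (Finset.sum_nonneg fun i _ => by have := hd i; positivity)

end Size

section Linear

variable {E V : Type*} [NormedAddCommGroup E] [NormedSpace ℝ E] [NormedAddCommGroup V]
  [InnerProductSpace ℝ V] (B : E →L[ℝ] V →L[ℝ] V) (Z : E →L[ℝ] V) (ε : V) (α : ℝ) (η : E → ℝ)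

theorem estFun_sum_smul {κ : Type*} (s : Finset κ) (c : κ → ℝ) (b : κ → E) (h : E) :
    estFun B Z ε α η (∑ a ∈ s, c a • b a) h = ∑ a ∈ s, c a * estFun B Z ε α η (b a) h := by
  have hlin : IsLinearMap ℝ fun e => estFun B Z ε α η e h := by
    constructor
    · intro e e'
      simp only [estFun, scoreAt, trace, map_add, mul_add, inner_add_left, inner_add_right,
        add_apply, ContinuousLinearMap.toLinearMap_add]
      ring
    · intro c e
      simp only [estFun, scoreAt, trace, map_smul, mul_smul_comm, inner_smul_left, smul_apply,
        inner_smul_right, ContinuousLinearMap.toLinearMap_smul, smul_eq_mul, conj_trivial]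
      ring
  refine (map_sum (hlin.mk' _) (fun a => c a • b a) s).trans (Finset.sum_congr rfl fun a _ => ?_)
  exact hlin.map_smul _ _

variable {κ : Type*} [Fintype κ] [DecidableEq κ]

/-- The vector of the estimating functions of one group. -/
noncomputable def estVec (B : EuclideanSpace ℝ κ →L[ℝ] V →L[ℝ] V) (Z : EuclideanSpace ℝ κ →L[ℝ] V)
    (ε : V) (α : ℝ) (η : EuclideanSpace ℝ κ → ℝ) (h : EuclideanSpace ℝ κ) :
    EuclideanSpace ℝ κ :=
  WithLp.toLp 2 fun a => estFun B Z ε α η (EuclideanSpace.single a 1) h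

theorem inner_estVec (B : EuclideanSpace ℝ κ →L[ℝ] V →L[ℝ] V) (Z : EuclideanSpace ℝ κ →L[ℝ] V)
    (ε : V) (α : ℝ) (η : EuclideanSpace ℝ κ → ℝ) (t h : EuclideanSpace ℝ κ) :
    ⟪t, estVec B Z ε α η h⟫ = estFun B Z ε α η t h := by
  have ht : t = ∑ a, t a • EuclideanSpace.single a (1 : ℝ) := by
    have := (EuclideanSpace.basisFun κ ℝ).sum_repr t
    simpa using this.symm
  conv_rhs => rw [ht, estFun_sum_smul]
  simp only [PiLp.inner_apply, estVec, RCLike.inner_apply, conj_trivial]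
  exact Finset.sum_congr rfl fun a _ => mul_comm _ _

theorem norm_euclidean_le_sum (v : EuclideanSpace ℝ κ) : ‖v‖ ≤ ∑ a, |v a| := by
  have h : v = ∑ a, v a • EuclideanSpace.single a (1 : ℝ) := by
    have := (EuclideanSpace.basisFun κ ℝ).sum_repr v
    simpa using this.symm
  conv_lhs => rw [h]
  refine (norm_sum_le _ _).trans (Finset.sum_le_sum fun a _ => ?_)
  rw [norm_smul]; simp

end Linear

section Continuity

variable {E V : Type*} [NormedAddCommGroup E] [NormedSpace ℝ E] [NormedAddCommGroup V]
  [InnerProductSpace ℝ V] (B : E →L[ℝ] V →L[ℝ] V) (Z : E →L[ℝ] V) (α : ℝ) (η : E → ℝ)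

theorem continuous_estFun (e h : E) : Continuous fun ε => estFun B Z ε α η e h := by
  unfold estFun weightAt scoreAt
  fun_prop

theorem continuous_estDeriv (η₀ : ℝ) (e k : E) : Continuous fun ε => estDeriv B Z ε α η₀ e k := by
  unfold estDeriv score scoreDeriv
  fun_prop

end Continuity

variable {κ : Type*} [Fintype κ] [DecidableEq κ] {V : ℕ → Type} [∀ i, NormedAddCommGroup (V i)]
  [∀ i, InnerProductSpace ℝ (V i)] [∀ i, FiniteDimensional ℝ (V i)] [∀ i, MeasurableSpace (V i)]
  [∀ i, BorelSpace (V i)] {S : Type*} [MeasurableSpace S]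

/-- A sequence of independent white groups with common constants, whose dimensions have third
powers with bounded averages. -/
structure WhiteSystem (B : (i : ℕ) → EuclideanSpace ℝ κ →L[ℝ] V i →L[ℝ] V i)
    (Z : (i : ℕ) → EuclideanSpace ℝ κ →L[ℝ] V i) (α : ℝ) (η : ℕ → EuclideanSpace ℝ κ → ℝ)
    (ε : (i : ℕ) → S → V i) (μ : Measure S) (K δ Mη C : ℝ) : Prop where
  group : ∀ i, WhiteGroup (B i) (Z i) α (η i) K δ Mη
  indep : iIndepFun ε μ
  law : ∀ i, HasLaw (ε i) (stdGaussian (V i)) μ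
  size : ∀ n : ℕ, ∑ i ∈ Finset.range n, (1 + Module.finrank ℝ (V i) : ℝ) ^ 3 ≤ C * n

/-- The average of the estimating functions of the first `n` groups. -/
noncomputable def avgEst (B : (i : ℕ) → EuclideanSpace ℝ κ →L[ℝ] V i →L[ℝ] V i)
    (Z : (i : ℕ) → EuclideanSpace ℝ κ →L[ℝ] V i) (α : ℝ) (η : ℕ → EuclideanSpace ℝ κ → ℝ)
    (ε : (i : ℕ) → S → V i) (n : ℕ) (ω : S) (h : EuclideanSpace ℝ κ) : EuclideanSpace ℝ κ :=
  (1 / n : ℝ) • ∑ i ∈ Finset.range n, estVec (B i) (Z i) (ε i ω) α (η i) h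

/-- The square of the scale `q` at which the estimates for a white group hold. -/
noncomputable def scaleSq (ε : (i : ℕ) → S → V i) (i : ℕ) (ω : S) : ℝ :=
  1 + Module.finrank ℝ (V i) + ‖ε i ω‖ ^ 2

variable {B : (i : ℕ) → EuclideanSpace ℝ κ →L[ℝ] V i →L[ℝ] V i}
  {Z : (i : ℕ) → EuclideanSpace ℝ κ →L[ℝ] V i} {α : ℝ} {η : ℕ → EuclideanSpace ℝ κ → ℝ}
  {ε : (i : ℕ) → S → V i} {μ : Measure S} [IsProbabilityMeasure μ] {K δ Mη C : ℝ}

namespace WhiteSystem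

variable (W : WhiteSystem B Z α η ε μ K δ Mη C)

theorem one_le_scaleSq (i : ℕ) (ω : S) : 1 ≤ scaleSq ε i ω := by
  unfold scaleSq
  have : (0 : ℝ) ≤ Module.finrank ℝ (V i) := Nat.cast_nonneg _
  nlinarith [sq_nonneg ‖ε i ω‖]

theorem scale_bounds (i : ℕ) (ω : S) : 1 ≤ √(scaleSq ε i ω) ∧ ‖ε i ω‖ ≤ √(scaleSq ε i ω) ∧
    (Module.finrank ℝ (V i) : ℝ) ≤ √(scaleSq ε i ω) ^ 2 := by
  have h0 := one_le_scaleSq (ε := ε) i ω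
  have hN : (0 : ℝ) ≤ Module.finrank ℝ (V i) := Nat.cast_nonneg _
  refine ⟨Real.one_le_sqrt.2 h0, Real.le_sqrt_of_sq_le ?_, ?_⟩
  · unfold scaleSq; linarith
  · rw [Real.sq_sqrt (by linarith)]; unfold scaleSq; nlinarith [sq_nonneg ‖ε i ω‖]

include W

theorem integrable_scaleSq_pow (i p : ℕ) : Integrable (fun ω => scaleSq ε i ω ^ p) μ := by
  have h : Integrable (fun x : V i => (1 + Module.finrank ℝ (V i) + ‖x‖ ^ 2 : ℝ) ^ p)
      (stdGaussian (V i)) := by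
    refine integrable_of_poly_bound (by fun_prop) ((1 + Module.finrank ℝ (V i) : ℝ) ^ p) (2 * p)
      fun x => ?_
    have hN : (0 : ℝ) ≤ Module.finrank ℝ (V i) := Nat.cast_nonneg _
    rw [abs_of_nonneg (by positivity), pow_mul, ← mul_pow]
    gcongr
    have := norm_nonneg x
    nlinarith [mul_nonneg hN (by positivity : 0 ≤ 2 * ‖x‖ + ‖x‖ ^ 2)]
  rw [← (W.law i).map_eq] at h
  exact h.comp_aemeasurable (W.law i).aemeasurable

theorem exists_integral_scaleSq_pow_le (p : ℕ) : ∃ M : ℝ, 0 ≤ M ∧ ∀ i,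
    ∫ ω, scaleSq ε i ω ^ (p + 1) ∂μ ≤ M * (1 + Module.finrank ℝ (V i) : ℝ) ^ (p + 1) := by
  obtain ⟨M, hM, h⟩ := exists_integral_pow_le p
  refine ⟨M, hM, fun i => ?_⟩
  have := (W.law i).integral_comp (f := fun x : V i =>
    (1 + Module.finrank ℝ (V i) + ‖x‖ ^ 2 : ℝ) ^ (p + 1)) (by fun_prop)
  exact (le_of_eq this).trans (h (V i))

theorem abs_estFun_le (e : EuclideanSpace ℝ κ) (i : ℕ) (ω : S) :
    |estFun (B i) (Z i) (ε i ω) α (η i) e 0| ≤ estConst K α Mη * ‖e‖ * scaleSq ε i ω := by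
  obtain ⟨h1, h2, h3⟩ := scale_bounds (ε := ε) i ω
  have := (W.group i).abs_estFun_zero_le (ε i ω) h1 h2 h3 e
  rwa [Real.sq_sqrt (by linarith [one_le_scaleSq (ε := ε) i ω])] at this

theorem estConst_nonneg : 0 ≤ estConst K α Mη := by
  have hK := (W.group 0).K_one
  have hα := (W.group 0).α_nonneg
  have hM := (W.group 0).Mη_nonneg
  unfold estConst scoreConst
  positivity

theorem norm_estVec_le (i : ℕ) (ω : S) : ‖estVec (B i) (Z i) (ε i ω) α (η i) 0‖ ≤
    Fintype.card κ * estConst K α Mη * scaleSq ε i ω := by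
  refine (norm_euclidean_le_sum _).trans ?_
  calc _ ≤ ∑ _a : κ, estConst K α Mη * scaleSq ε i ω := by
        refine Finset.sum_le_sum fun a _ => ?_
        simpa [estVec] using W.abs_estFun_le (EuclideanSpace.single a 1) i ω
    _ = _ := by simp; ring

theorem aemeasurable_comp {i : ℕ} {F : Type*} [TopologicalSpace F] [MeasurableSpace F] [BorelSpace F]
    {f : V i → F} (hf : Continuous f) : AEMeasurable (fun ω => f (ε i ω)) μ :=
  hf.measurable.comp_aemeasurable (W.law i).aemeasurable

theorem integral_comp_eq {i : ℕ} {f : V i → ℝ} (hf : Continuous f) :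
    ∫ ω, f (ε i ω) ∂μ = ∫ x, f x ∂(stdGaussian (V i)) :=
  (W.law i).integral_comp hf.aestronglyMeasurable

theorem size_pow_le {p : ℕ} (hp : p ≤ 3) (n : ℕ) :
    ∑ i ∈ Finset.range n, (1 + Module.finrank ℝ (V i) : ℝ) ^ p ≤ C * n := by
  refine (Finset.sum_le_sum fun i _ => ?_).trans (W.size n)
  have hN : (0 : ℝ) ≤ Module.finrank ℝ (V i) := Nat.cast_nonneg _
  exact pow_le_pow_right₀ (by linarith) hp

theorem C_nonneg : 0 ≤ C := by
  have := W.size 1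
  simp only [Finset.sum_range_one, Nat.cast_one, mul_one] at this
  exact le_trans (by positivity) this

/-- The average of the estimating functions at the true parameter is of order `n ^ (-1/2)`. -/
theorem boundedInProbability_avgEst :
    BoundedInProbability (fun (n : ℕ) ω => √(n : ℝ) • avgEst B Z α η ε n ω 0) μ := by
  obtain ⟨M, hM, hMle⟩ := W.exists_integral_scaleSq_pow_le 1
  set c := estConst K α Mη with hc
  have hc0 : 0 ≤ c := W.estConst_nonneg
  have hC := W.C_nonneg
  have hm : ∀ (a : κ) i, MemLp (fun ω => estFun (B i) (Z i) (ε i ω) α (η i)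
      (EuclideanSpace.single a 1) 0) 2 μ := fun a i => by
    have hae := W.aemeasurable_comp (continuous_estFun (B i) (Z i) α (η i)
      (EuclideanSpace.single a 1) 0)
    refine (memLp_two_iff_integrable_sq hae.aestronglyMeasurable).2 ?_
    refine ((W.integrable_scaleSq_pow i 2).const_mul (c ^ 2)).mono'
      (hae.pow_const 2).aestronglyMeasurable (Eventually.of_forall fun ω => ?_)
    rw [Real.norm_eq_abs, abs_pow, ← mul_pow]
    gcongr
    simpa using W.abs_estFun_le (EuclideanSpace.single a 1) i ω
  have hsq : ∀ (a : κ) i, ∫ ω, estFun (B i) (Z i) (ε i ω) α (η i)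
      (EuclideanSpace.single a 1) 0 ^ 2 ∂μ ≤
        c ^ 2 * M * (1 + Module.finrank ℝ (V i) : ℝ) ^ 2 := fun a i => by
    refine le_trans (integral_mono (hm a i).integrable_sq
      ((W.integrable_scaleSq_pow i 2).const_mul (c ^ 2)) fun ω => ?_) ?_
    · change _ ^ 2 ≤ c ^ 2 * _
      rw [← sq_abs, ← mul_pow]
      gcongr
      simpa using W.abs_estFun_le (EuclideanSpace.single a 1) i ω
    · rw [integral_const_mul, mul_assoc]
      gcongr
      exact hMle i
  have hzero : ∀ (a : κ) i, ∫ ω, estFun (B i) (Z i) (ε i ω) α (η i)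
      (EuclideanSpace.single a 1) 0 ∂μ = 0 := fun a i => by
    rw [W.integral_comp_eq (continuous_estFun (B i) (Z i) α (η i) (EuclideanSpace.single a 1) 0),
      (W.group i).integral_estFun_zero]
  have hind : ∀ a : κ, iIndepFun (fun i ω => estFun (B i) (Z i) (ε i ω) α (η i)
      (EuclideanSpace.single a 1) 0) μ := fun a =>
    W.indep.comp (fun i x => estFun (B i) (Z i) x α (η i) (EuclideanSpace.single a 1) 0)
      fun i => (continuous_estFun _ _ _ _ _ _).measurable
  have hnorm : ∀ (n : ℕ) ω, ‖√(n : ℝ) • avgEst B Z α η ε n ω 0‖ ^ 2 = ∑ a, n * (1 / n : ℝ) ^ 2 *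
      (∑ i ∈ Finset.range n, estFun (B i) (Z i) (ε i ω) α (η i)
        (EuclideanSpace.single a 1) 0) ^ 2 := fun n ω => by
    rw [norm_smul, mul_pow, EuclideanSpace.norm_sq_eq, Real.norm_eq_abs, sq_abs,
      Real.sq_sqrt (Nat.cast_nonneg n), Finset.mul_sum]
    refine Finset.sum_congr rfl fun a _ => ?_
    simp only [avgEst, PiLp.smul_apply, WithLp.ofLp_sum, Finset.sum_apply, estVec, smul_eq_mul,
      Real.norm_eq_abs, sq_abs]
    ring
  have hisq : ∀ (n : ℕ) (a : κ), Integrable (fun ω => (n * (1 / n : ℝ) ^ 2 *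
      (∑ i ∈ Finset.range n, estFun (B i) (Z i) (ε i ω) α (η i)
        (EuclideanSpace.single a 1) 0) ^ 2 : ℝ)) μ := fun n a =>
    ((memLp_finsetSum _ fun i _ => hm a i).integrable_sq).const_mul _
  refine boundedInProbability_of_integral_sq_le (fun n => ?_)
    (C := Fintype.card κ * (c ^ 2 * M * C)) ((eventually_gt_atTop 0).mono fun n hn => ?_)
  · simp_rw [hnorm]
    exact integrable_finsetSum _ fun a _ => hisq n a
  · have hn' : (0 : ℝ) < n := by exact_mod_cast hn
    simp_rw [hnorm]
    rw [integral_finsetSum _ fun a _ => hisq n a]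
    calc _ ≤ ∑ _a : κ, c ^ 2 * M * C := by
          refine Finset.sum_le_sum fun a _ => ?_
          rw [integral_const_mul]
          have h1 := variance_sum_le (hm a) (hind a) n
          simp only [hzero, Finset.sum_const_zero, sub_zero] at h1
          have h2 : ∑ i ∈ Finset.range n, ∫ ω, estFun (B i) (Z i) (ε i ω) α (η i)
              (EuclideanSpace.single a 1) 0 ^ 2 ∂μ ≤ c ^ 2 * M * (C * n) := by
            refine (Finset.sum_le_sum fun i _ => hsq a i).trans ?_
            rw [← Finset.mul_sum]
            gcongr
            exact W.size_pow_le (by norm_num) n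
          calc _ ≤ n * (1 / n : ℝ) ^ 2 * (c ^ 2 * M * (C * n)) := by
                gcongr
                exact h1.trans h2
            _ = _ := by field_simp
      _ = _ := by simp

/-- The expected derivatives determine the local behaviour of the estimating equations: the average
derivative at `0` obeys a law of large numbers, and its variation over a small ball is controlled by
the average of the third powers of `scaleSq`. -/
theorem locallyLinear {A : ℕ → EuclideanSpace ℝ κ →L[ℝ] EuclideanSpace ℝ κ}
    (hA : ∀ n a b, A n (EuclideanSpace.single b 1) a = (1 / n : ℝ) * ∑ i ∈ Finset.range n,
      ∫ x, estDeriv (B i) (Z i) x α (η i 0) (EuclideanSpace.single a 1)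
        (EuclideanSpace.single b 1) ∂(stdGaussian (V i))) :
    LocallyLinear (avgEst B Z α η ε) A 0 μ := by
  set c₀ := estConst K α Mη with hc₀
  have hc0 : 0 ≤ c₀ := W.estConst_nonneg
  have hC := W.C_nonneg
  set X : κ → κ → ℕ → S → ℝ := fun a b i ω => estDeriv (B i) (Z i) (ε i ω) α (η i 0)
    (EuclideanSpace.single a 1) (EuclideanSpace.single b 1) with hX
  have hXc : ∀ a b i, Continuous fun x : V i => estDeriv (B i) (Z i) x α (η i 0)
    (EuclideanSpace.single a 1) (EuclideanSpace.single b 1) := fun a b i =>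
      continuous_estDeriv _ _ _ _ _ _
  choose L hL hLn hLlin using fun (a : κ) (i : ℕ) (ω : S) =>
    (W.group i).exists_estDeriv (ε i ω) (scale_bounds (ε := ε) i ω).1
      (scale_bounds (ε := ε) i ω).2.1 (scale_bounds (ε := ε) i ω).2.2
      (EuclideanSpace.single a (1 : ℝ))
  have hq : ∀ i ω, √(scaleSq ε i ω) ^ 2 = scaleSq ε i ω := fun i ω =>
    Real.sq_sqrt (zero_le_one.trans (one_le_scaleSq i ω))
  have hXle : ∀ a b i ω, |X a b i ω| ≤ c₀ * scaleSq ε i ω ^ 2 := fun a b i ω => by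
    have h1 := (L a i ω).le_opNorm (EuclideanSpace.single b 1)
    rw [hL] at h1
    refine h1.trans ?_
    have h2 := hLn a i ω
    rw [show (4 : ℕ) = 2 * 2 by norm_num, pow_mul, hq] at h2
    simpa using h2
  have hm : ∀ a b i, MemLp (X a b i) 2 μ := fun a b i => by
    have hae : AEMeasurable (X a b i) μ := W.aemeasurable_comp (hXc a b i)
    refine (memLp_two_iff_integrable_sq hae.aestronglyMeasurable).2 ?_
    refine ((W.integrable_scaleSq_pow i 4).const_mul (c₀ ^ 2)).mono'
      (hae.pow_const 2).aestronglyMeasurable (Eventually.of_forall fun ω => ?_)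
    rw [Real.norm_eq_abs, abs_pow]
    calc _ ≤ (c₀ * scaleSq ε i ω ^ 2) ^ 2 := by gcongr; exact hXle a b i ω
      _ = _ := by ring
  obtain ⟨M4, hM4, hM4le⟩ := W.exists_integral_scaleSq_pow_le 3
  have hsq : ∀ a b i, ∫ ω, X a b i ω ^ 2 ∂μ ≤
      c₀ ^ 2 * M4 * (1 + Module.finrank ℝ (V i) : ℝ) ^ 4 := fun a b i => by
    refine le_trans (integral_mono (hm a b i).integrable_sq
      ((W.integrable_scaleSq_pow i 4).const_mul (c₀ ^ 2)) fun ω => ?_) ?_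
    · change _ ^ 2 ≤ c₀ ^ 2 * _
      rw [← sq_abs]
      calc _ ≤ (c₀ * scaleSq ε i ω ^ 2) ^ 2 := by gcongr; exact hXle a b i ω
        _ = _ := by ring
    · rw [integral_const_mul, mul_assoc]
      gcongr
      exact hM4le i
  have hind : ∀ a b, iIndepFun (X a b) μ := fun a b =>
    W.indep.comp (fun i x => estDeriv (B i) (Z i) x α (η i 0) (EuclideanSpace.single a 1)
      (EuclideanSpace.single b 1)) fun i => (hXc a b i).measurable
  have hsize : Tendsto (fun n : ℕ => (1 / n : ℝ) ^ 2 * ∑ i ∈ Finset.range n,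
      c₀ ^ 2 * M4 * (1 + Module.finrank ℝ (V i) : ℝ) ^ 4) atTop (𝓝 0) := by
    have := (tendsto_sum_pow_four (d := fun i => (1 + Module.finrank ℝ (V i) : ℝ))
      (fun i => by simp) W.size).const_mul (c₀ ^ 2 * M4)
    rw [mul_zero] at this
    refine this.congr fun n => ?_
    rw [← Finset.mul_sum]; ring
  -- The error in the entries of the average derivative.
  set D : κ → κ → ℕ → S → ℝ := fun a b n ω => (1 / n : ℝ) * ∑ i ∈ Finset.range n, X a b i ω -
    A n (EuclideanSpace.single b 1) a with hD
  have hDi : ∀ a b n, Integrable (fun ω => D a b n ω ^ 2) μ := fun a b n => by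
    have : MemLp (fun ω => D a b n ω) 2 μ :=
      ((memLp_finsetSum _ fun i _ => hm a b i).const_mul _).sub (memLp_const _)
    exact this.integrable_sq
  have hDlim : Tendsto (fun n => ∫ ω, ∑ a, ∑ b, D a b n ω ^ 2 ∂μ) atTop (𝓝 0) := by
    have h1 : ∀ a b, Tendsto (fun n => ∫ ω, D a b n ω ^ 2 ∂μ) atTop (𝓝 0) := fun a b => by
      refine (tendsto_integral_centred_average_sq (hm a b) (hind a b) (hsq a b) hsize).congr
        fun n => ?_
      simp only [hD, hA, hX]
      refine integral_congr_ae (Eventually.of_forall fun ω => ?_)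
      simp only
      congr 3
      exact Finset.sum_congr rfl fun i _ => W.integral_comp_eq (hXc a b i)
    have h2 := tendsto_finsetSum (Finset.univ : Finset κ) fun a _ =>
      tendsto_finsetSum (Finset.univ : Finset κ) fun b _ => h1 a b
    simp only [Finset.sum_const_zero] at h2
    refine h2.congr fun n => ?_
    rw [integral_finsetSum _ fun a _ => integrable_finsetSum _ fun b _ => hDi a b n]
    exact Finset.sum_congr rfl fun a _ => (integral_finsetSum _ fun b _ => hDi a b n).symm
  obtain ⟨M3, hM3, hM3le⟩ := W.exists_integral_scaleSq_pow_le 2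
  -- The average of the Lipschitz constants of the derivatives.
  set R : ℕ → S → ℝ := fun n ω => (1 / n : ℝ) * ∑ i ∈ Finset.range n, scaleSq ε i ω ^ 3 with hR
  have hRi : ∀ n, Integrable (R n) μ := fun n =>
    (integrable_finsetSum _ fun i _ => W.integrable_scaleSq_pow i 3).const_mul _
  have hR0 : ∀ n ω, 0 ≤ R n ω := fun n ω => mul_nonneg (by positivity)
    (Finset.sum_nonneg fun i _ => by
      have := one_le_scaleSq (ε := ε) i ω
      positivity)
  have hRle : ∀ n : ℕ, 0 < n → ∫ ω, R n ω ∂μ ≤ M3 * C := fun n hn => by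
    have hn' : (0 : ℝ) < n := by exact_mod_cast hn
    rw [integral_const_mul, integral_finsetSum _ fun i _ => W.integrable_scaleSq_pow i 3]
    calc _ ≤ (1 / n : ℝ) * ∑ i ∈ Finset.range n,
          M3 * (1 + Module.finrank ℝ (V i) : ℝ) ^ 3 := by
            gcongr with i
            exact hM3le i
      _ ≤ (1 / n : ℝ) * (M3 * (C * n)) := by
            rw [← Finset.mul_sum]; gcongr; exact W.size n
      _ = _ := by field_simp
  -- On each realization, the Lipschitz constant of `avgEst - A n` on the ball of radius `δ'`.
  have hdet : ∀ n ω δ', δ' ≤ δ → ∀ x ∈ Metric.closedBall (0 : EuclideanSpace ℝ κ) δ',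
      ∀ y ∈ Metric.closedBall (0 : EuclideanSpace ℝ κ) δ',
      ‖avgEst B Z α η ε n ω x - avgEst B Z α η ε n ω y - A n (x - y)‖ ≤
        (Fintype.card κ * c₀ * δ' * R n ω + ∑ a, ∑ b, |D a b n ω|) * ‖x - y‖ := by
    intro n ω δ' hδ' x hx y hy
    have hδ0 : 0 ≤ δ' := (norm_nonneg _).trans (mem_closedBall_iff_norm.1 hx)
    refine (norm_euclidean_le_sum _).trans ?_
    have hexp : ∀ (v : EuclideanSpace ℝ κ), v = ∑ b, v b • EuclideanSpace.single b (1 : ℝ) :=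
      fun v => by simpa using ((EuclideanSpace.basisFun κ ℝ).sum_repr v).symm
    have hterm : ∀ a, |(avgEst B Z α η ε n ω x - avgEst B Z α η ε n ω y - A n (x - y)) a| ≤
        c₀ * δ' * R n ω * ‖x - y‖ + (∑ b, |D a b n ω|) * ‖x - y‖ := fun a => by
      have e1 : (avgEst B Z α η ε n ω x - avgEst B Z α η ε n ω y - A n (x - y)) a =
          (1 / n : ℝ) * ∑ i ∈ Finset.range n,
            (estFun (B i) (Z i) (ε i ω) α (η i) (EuclideanSpace.single a 1) x -
              estFun (B i) (Z i) (ε i ω) α (η i) (EuclideanSpace.single a 1) y -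
                L a i ω (x - y)) +
          ((1 / n : ℝ) * ∑ i ∈ Finset.range n, L a i ω (x - y) - A n (x - y) a) := by
        simp only [avgEst, PiLp.sub_apply, PiLp.smul_apply, WithLp.ofLp_sum, Finset.sum_apply,
          estVec, smul_eq_mul, Finset.sum_sub_distrib]
        ring
      have e2 : (1 / n : ℝ) * ∑ i ∈ Finset.range n, L a i ω (x - y) - A n (x - y) a =
          ∑ b, (x - y) b * D a b n ω := by
        have h1 : ∀ i, L a i ω (x - y) = ∑ b, (x - y) b * X a b i ω := fun i => by
          conv_lhs => rw [hexp (x - y), map_sum]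
          exact Finset.sum_congr rfl fun b _ => by rw [map_smul, hL, smul_eq_mul]
        have h2 : A n (x - y) a = ∑ b, (x - y) b * A n (EuclideanSpace.single b 1) a := by
          conv_lhs => rw [hexp (x - y), map_sum]
          simp only [map_smul, WithLp.ofLp_sum, Finset.sum_apply, PiLp.smul_apply, smul_eq_mul]
        simp only [h1]
        rw [h2, Finset.sum_comm, Finset.mul_sum, ← Finset.sum_sub_distrib]
        refine Finset.sum_congr rfl fun b _ => ?_
        rw [hD, ← Finset.mul_sum]
        ring
      rw [e1, e2]
      refine (abs_add_le _ _).trans (add_le_add ?_ ?_)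
      · rw [abs_mul, abs_of_nonneg (by positivity : (0 : ℝ) ≤ 1 / n), hR]
        calc _ ≤ (1 / n : ℝ) * ∑ i ∈ Finset.range n,
              c₀ * scaleSq ε i ω ^ 3 * δ' * ‖x - y‖ := by
                gcongr
                refine (Finset.abs_sum_le_sum_abs _ _).trans (Finset.sum_le_sum fun i _ => ?_)
                refine (hLlin a i ω δ' hδ' x hx y hy).trans (le_of_eq ?_)
                rw [show (6 : ℕ) = 2 * 3 by norm_num, pow_mul, hq]
                simp [hc₀]
          _ = _ := by
            simp only [Finset.mul_sum, Finset.sum_mul]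
            exact Finset.sum_congr rfl fun i _ => by ring
      · refine (Finset.abs_sum_le_sum_abs _ _).trans ?_
        rw [Finset.sum_mul]
        refine Finset.sum_le_sum fun b _ => ?_
        rw [abs_mul, mul_comm]
        gcongr
        exact PiLp.norm_apply_le (x - y) b
    calc _ ≤ ∑ a, (c₀ * δ' * R n ω * ‖x - y‖ + (∑ b, |D a b n ω|) * ‖x - y‖) :=
          Finset.sum_le_sum fun a _ => hterm a
      _ = _ := by
        rw [Finset.sum_add_distrib, Finset.sum_const, Finset.card_univ, nsmul_eq_mul,
          ← Finset.sum_mul]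
        ring
  intro c hc θ hθ
  rcases eq_or_ne θ ⊤ with rfl | hθ'
  · exact ⟨1, one_pos, Eventually.of_forall fun n => le_top⟩
  have hpos : 0 < θ.toReal := ENNReal.toReal_pos hθ.ne' hθ'
  set N : ℝ := (Fintype.card κ : ℝ) with hN
  have hN0 : 0 ≤ N := Nat.cast_nonneg _
  -- Markov's inequality bounds `R n` by `t` and the sum of the squares of the errors `D` by
  -- `s ^ 2`, up to probability `θ / 2` each; then `δ'` is chosen so small that both
  -- contribute at most `c / 2`.
  set t : ℝ := 2 * (M3 * C + 1) / θ.toReal with ht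
  have ht0 : 0 < t := by positivity
  set δ' : ℝ := min δ (c / (2 * (N * c₀ * t + 1))) with hδ'
  have hδ0 : 0 < δ' := lt_min (W.group 0).δ_pos (by positivity)
  set s : ℝ := c / (2 * (N + 1)) with hs
  have hs0 : 0 < s := by positivity
  refine ⟨δ', hδ0, ?_⟩
  have hev := hDlim.eventually_lt_const (show (0 : ℝ) < s ^ 2 * (θ.toReal / 2) by positivity)
  filter_upwards [hev, eventually_gt_atTop 0] with n hn1 hn2
  have hsub : {ω | ¬ ∀ x ∈ Metric.closedBall (0 : EuclideanSpace ℝ κ) δ',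
      ∀ y ∈ Metric.closedBall (0 : EuclideanSpace ℝ κ) δ',
      ‖avgEst B Z α η ε n ω x - avgEst B Z α η ε n ω y - A n (x - y)‖ ≤ c * ‖x - y‖} ⊆
      {ω | t ≤ R n ω} ∪ {ω | s ^ 2 ≤ ∑ a, ∑ b, D a b n ω ^ 2} := by
    intro ω hω
    by_contra hcon
    simp only [Set.mem_union, Set.mem_ofPred_eq, not_or, not_le] at hcon
    refine hω fun x hx y hy => (hdet n ω δ' (min_le_left _ _) x hx y hy).trans ?_
    gcongr
    have h1 : N * c₀ * δ' * R n ω ≤ c / 2 := by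
      calc _ ≤ N * c₀ * (c / (2 * (N * c₀ * t + 1))) * t := by
            gcongr
            · exact hR0 n ω
            · exact min_le_right _ _
            · exact hcon.1.le
        _ = (N * c₀ * t) / (N * c₀ * t + 1) * (c / 2) := by field_simp
        _ ≤ 1 * (c / 2) := by
            gcongr
            rw [div_le_one (by positivity)]
            linarith
        _ = _ := one_mul _
    have h2 : ∑ a, ∑ b, |D a b n ω| ≤ c / 2 := by
      have hcs : (∑ p : κ × κ, |D p.1 p.2 n ω|) ^ 2 ≤ N ^ 2 * ∑ p : κ × κ, D p.1 p.2 n ω ^ 2 := by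
        have := sq_sum_le_card_mul_sum_sq (s := (Finset.univ : Finset (κ × κ)))
          (f := fun p => |D p.1 p.2 n ω|)
        simpa [hN, Fintype.card_prod, sq] using this
      rw [Fintype.sum_prod_type, Fintype.sum_prod_type] at hcs
      have h3 : (∑ a, ∑ b, |D a b n ω|) ^ 2 ≤ (N * s) ^ 2 := by
        rw [mul_pow]
        exact hcs.trans (by gcongr; exact hcon.2.le)
      have h4 := abs_le_of_sq_le_sq h3 (by positivity)
      refine (le_abs_self _).trans (h4.trans ?_)
      have : N * s = N / (N + 1) * (c / 2) := by rw [hs]; field_simp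
      rw [this]
      have : N / (N + 1) ≤ 1 := by rw [div_le_one (by positivity)]; linarith
      nlinarith
    linarith
  have hmk1 := mul_meas_ge_le_integral_of_nonneg (Eventually.of_forall fun ω => hR0 n ω)
    (hRi n) t
  have hDs0 : ∀ ω, 0 ≤ ∑ a, ∑ b, D a b n ω ^ 2 := fun ω =>
    Finset.sum_nonneg fun a _ => Finset.sum_nonneg fun b _ => sq_nonneg _
  have hmk2 := mul_meas_ge_le_integral_of_nonneg (Eventually.of_forall hDs0)
    (integrable_finsetSum _ fun a _ => integrable_finsetSum _ fun b _ => hDi a b n) (s ^ 2)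
  have hr1 : μ.real {ω | t ≤ R n ω} ≤ θ.toReal / 2 := by
    have h1 : t * μ.real {ω | t ≤ R n ω} ≤ t * (θ.toReal / 2) := by
      refine hmk1.trans ((hRle n hn2).trans ?_)
      have : t * (θ.toReal / 2) = M3 * C + 1 := by rw [ht]; field_simp
      linarith
    exact le_of_mul_le_mul_left h1 ht0
  have hr2 : μ.real {ω | s ^ 2 ≤ ∑ a, ∑ b, D a b n ω ^ 2} ≤ θ.toReal / 2 :=
    le_of_mul_le_mul_left (hmk2.trans hn1.le) (by positivity)
  refine (measure_mono hsub).trans ((measure_union_le _ _).trans ?_)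
  rw [← ENNReal.ofReal_toReal hθ', ← ENNReal.ofReal_toReal (measure_ne_top μ {ω | t ≤ R n ω}),
    ← ENNReal.ofReal_toReal (measure_ne_top μ {ω | s ^ 2 ≤ ∑ a, ∑ b, D a b n ω ^ 2}),
    ← ENNReal.ofReal_add ENNReal.toReal_nonneg ENNReal.toReal_nonneg]
  refine ENNReal.ofReal_le_ofReal ?_
  have := add_le_add hr1 hr2
  simpa [Measure.real] using this.trans (le_of_eq (add_halves _))

/-- The central limit theorem for the estimating functions, normalized by bounded maps `Q n` that
turn their covariances into one that tends to the identity. -/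
theorem tendstoInDistribution_avgEst {Q : ℕ → EuclideanSpace ℝ κ →L[ℝ] EuclideanSpace ℝ κ} {c : ℝ}
    (hQ : ∀ᶠ n in atTop, ‖Q n‖ ≤ c)
    (hcov : ∀ t, Tendsto (fun n : ℕ => (1 / n : ℝ) * ∑ i ∈ Finset.range n,
      ∫ x, estFun (B i) (Z i) x α (η i) (ContinuousLinearMap.adjoint (Q n) t) 0 ^ 2
        ∂(stdGaussian (V i))) atTop (𝓝 (‖t‖ ^ 2))) :
    TendstoInDistribution (fun (n : ℕ) ω => Q n (√(n : ℝ) • avgEst B Z α η ε n ω 0)) atTop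
      (id : EuclideanSpace ℝ κ → EuclideanSpace ℝ κ) (fun _ => μ)
      (stdGaussian (EuclideanSpace ℝ κ)) := by
  set c₀ := estConst K α Mη with hc₀
  have hc0 : 0 ≤ c₀ := W.estConst_nonneg
  have hC := W.C_nonneg
  set N : ℝ := (Fintype.card κ : ℝ) with hN
  have hN0 : 0 ≤ N := Nat.cast_nonneg _
  obtain ⟨M3, hM3, hM3le⟩ := W.exists_integral_scaleSq_pow_le 2
  have hcont : ∀ i, Continuous fun x : V i => estVec (B i) (Z i) x α (η i) 0 := fun i => by
    unfold estVec
    exact (PiLp.continuous_toLp 2 _).comp (continuous_pi fun a => continuous_estFun _ _ _ _ _ _)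
  have hn3 : ∀ i ω, ‖estVec (B i) (Z i) (ε i ω) α (η i) 0‖ ^ 3 ≤
      (N * c₀) ^ 3 * scaleSq ε i ω ^ 3 := fun i ω => by
    rw [← mul_pow]
    gcongr
    exact W.norm_estVec_le i ω
  have hi3 : ∀ i, Integrable (fun ω => ‖estVec (B i) (Z i) (ε i ω) α (η i) 0‖ ^ 3) μ := fun i => by
    refine ((W.integrable_scaleSq_pow i 3).const_mul ((N * c₀) ^ 3)).mono'
      (W.aemeasurable_comp ((hcont i).norm.pow 3)).aestronglyMeasurable
      (Eventually.of_forall fun ω => ?_)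
    rw [Real.norm_eq_abs, abs_of_nonneg (by positivity)]
    exact hn3 i ω
  have hsum3 : ∀ n, ∑ i ∈ Finset.range n, ∫ ω, ‖estVec (B i) (Z i) (ε i ω) α (η i) 0‖ ^ 3 ∂μ ≤
      (N * c₀) ^ 3 * M3 * (C * n) := fun n => by
    calc _ ≤ ∑ i ∈ Finset.range n,
          (N * c₀) ^ 3 * (M3 * (1 + Module.finrank ℝ (V i) : ℝ) ^ 3) := by
          refine Finset.sum_le_sum fun i _ => ?_
          refine (integral_mono (hi3 i) ((W.integrable_scaleSq_pow i 3).const_mul _)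
            (hn3 i)).trans ?_
          rw [integral_const_mul]
          gcongr
          exact hM3le i
      _ ≤ _ := by
          simp_rw [← mul_assoc]
          rw [← Finset.mul_sum, mul_assoc _ C]
          gcongr
          exact W.size n
  have key := tendstoInDistribution_of_lyapunov (μ := μ)
    (ξ := fun i ω => estVec (B i) (Z i) (ε i ω) α (η i) 0)
    (fun i => W.aemeasurable_comp (hcont i))
    (W.indep.comp (fun i x => estVec (B i) (Z i) x α (η i) 0) fun i => (hcont i).measurable)
    (fun n => (√(n : ℝ))⁻¹ • Q n) hi3 (fun i t => by
      simp_rw [inner_estVec]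
      rw [W.integral_comp_eq (continuous_estFun (B i) (Z i) α (η i) t 0),
        (W.group i).integral_estFun_zero])
    (fun t => by
      refine (hcov t).congr' ((eventually_gt_atTop 0).mono fun n hn => ?_)
      have hn' : (0 : ℝ) < n := by exact_mod_cast hn
      rw [Finset.mul_sum]
      refine Finset.sum_congr rfl fun i _ => ?_
      rw [← integral_const_mul, ← W.integral_comp_eq (f := fun x => (1 / n : ℝ) *
        estFun (B i) (Z i) x α (η i) (ContinuousLinearMap.adjoint (Q n) t) 0 ^ 2)
        (((continuous_estFun _ _ _ _ _ _).pow 2).const_mul _)]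
      refine integral_congr_ae (Eventually.of_forall fun ω => ?_)
      simp only [smul_apply, inner_smul_right]
      rw [← ContinuousLinearMap.adjoint_inner_left, inner_estVec, mul_pow, inv_pow,
        Real.sq_sqrt hn'.le, one_div])
    (by
      have hlim : Tendsto (fun n : ℕ => c ^ 3 * ((N * c₀) ^ 3 * M3 * C) * (√(n : ℝ))⁻¹) atTop
          (𝓝 0) := by
        have : Tendsto (fun n : ℕ => (√(n : ℝ))⁻¹) atTop (𝓝 0) :=
          (Real.tendsto_sqrt_atTop.comp tendsto_natCast_atTop_atTop).inv_tendsto_atTop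
        simpa using this.const_mul (c ^ 3 * ((N * c₀) ^ 3 * M3 * C))
      refine squeeze_zero' (Eventually.of_forall fun n => ?_) ?_ hlim
      · exact mul_nonneg (by positivity) (Finset.sum_nonneg fun i _ => integral_nonneg fun ω => by
          change 0 ≤ _ ^ 3; positivity)
      · filter_upwards [hQ, eventually_gt_atTop 0] with n hn hpos
        have hn' : (0 : ℝ) < n := by exact_mod_cast hpos
        have hc : 0 ≤ c := (norm_nonneg _).trans hn
        rw [norm_smul, norm_inv, Real.norm_eq_abs, abs_of_nonneg (Real.sqrt_nonneg _), mul_pow]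
        calc _ ≤ ((√(n : ℝ))⁻¹ ^ 3 * c ^ 3) * ((N * c₀) ^ 3 * M3 * (C * n)) := by
              gcongr
              exact hsum3 n
          _ = _ := by
            have hs : √(n : ℝ) ≠ 0 := (Real.sqrt_pos.2 hn').ne'
            have hs2 : √(n : ℝ) ^ 2 = n := Real.sq_sqrt hn'.le
            generalize √(n : ℝ) = s at hs hs2
            rw [← hs2]
            field_simp)
  refine key.congr (fun n => Eventually.of_forall fun ω => ?_) EventuallyEq.rfl
  simp only [smul_apply, avgEst, map_smul, map_sum, ← Finset.smul_sum, smul_smul]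
  congr 1
  rcases Nat.eq_zero_or_pos n with rfl | hn
  · simp
  · have hn' : (0 : ℝ) < n := by exact_mod_cast hn
    have hs : √(n : ℝ) ≠ 0 := (Real.sqrt_pos.2 hn').ne'
    have hs2 : √(n : ℝ) ^ 2 = n := Real.sq_sqrt hn'.le
    generalize √(n : ℝ) = s at hs hs2
    rw [← hs2]
    field_simp

end WhiteSystem
end WhiteSystem


/-! ### Asymptotic independence of blocks -/

section Blocks

variable {E F₁ F₂ : Type*} [NormedAddCommGroup E] [InnerProductSpace ℝ E] [FiniteDimensional ℝ E]
  [MeasurableSpace E] [BorelSpace E] [NormedAddCommGroup F₁] [InnerProductSpace ℝ F₁]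
  [FiniteDimensional ℝ F₁] [MeasurableSpace F₁] [BorelSpace F₁] [NormedAddCommGroup F₂]
  [InnerProductSpace ℝ F₂] [FiniteDimensional ℝ F₂] [MeasurableSpace F₂] [BorelSpace F₂]

theorem charFun_map_continuousLinearMap (p : E →L[ℝ] F₁) (ν : Measure E) (t : F₁) :
    charFun (ν.map p) t = charFun ν (ContinuousLinearMap.adjoint p t) := by
  rw [charFun_apply, charFun_apply, integral_map p.continuous.aemeasurable (by fun_prop)]
  simp_rw [ContinuousLinearMap.adjoint_inner_right]

/-- A coisometry, such as a coordinate projection, maps the standard Gaussian law to the standard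
Gaussian law. -/
theorem map_stdGaussian_of_adjoint_isometry {p : E →L[ℝ] F₁}
    (hp : ∀ t, ‖ContinuousLinearMap.adjoint p t‖ = ‖t‖) :
    (stdGaussian E).map p = stdGaussian F₁ := by
  have : IsProbabilityMeasure ((stdGaussian E).map p) :=
    Measure.isProbabilityMeasure_map p.continuous.aemeasurable
  refine Measure.ext_of_charFun (funext fun t => ?_)
  rw [charFun_map_continuousLinearMap, charFun_stdGaussian, charFun_stdGaussian, hp]

/-- Complementary orthogonal projections of a standard Gaussian vector are independent. -/
theorem indepFun_stdGaussian_of_orthogonal {p₁ : E →L[ℝ] F₁} {p₂ : E →L[ℝ] F₂}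
    (hp : ∀ t₁ t₂, ‖ContinuousLinearMap.adjoint p₁ t₁ + ContinuousLinearMap.adjoint p₂ t₂‖ ^ 2 =
      ‖t₁‖ ^ 2 + ‖t₂‖ ^ 2) : IndepFun p₁ p₂ (stdGaussian E) := by
  have h1 : ∀ t, ‖ContinuousLinearMap.adjoint p₁ t‖ ^ 2 = ‖t‖ ^ 2 := fun t => by
    simpa using hp t 0
  have h2 : ∀ t, ‖ContinuousLinearMap.adjoint p₂ t‖ ^ 2 = ‖t‖ ^ 2 := fun t => by
    simpa using hp 0 t
  rw [indepFun_iff_charFun_prod p₁.continuous.aemeasurable p₂.continuous.aemeasurable]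
  intro t
  have e : charFun ((stdGaussian E).map fun ω => WithLp.toLp 2 (p₁ ω, p₂ ω)) t =
      charFun (stdGaussian E) (ContinuousLinearMap.adjoint p₁ t.ofLp.1 +
        ContinuousLinearMap.adjoint p₂ t.ofLp.2) := by
    rw [charFun_apply, charFun_apply, integral_map (by fun_prop) (by fun_prop)]
    simp_rw [inner_add_right, ContinuousLinearMap.adjoint_inner_right, WithLp.prod_inner_apply]
  rw [e, charFun_map_continuousLinearMap, charFun_map_continuousLinearMap, charFun_stdGaussian,
    charFun_stdGaussian, charFun_stdGaussian, ← Complex.exp_add]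
  congr 1
  norm_cast
  rw [hp, h1, h2]
  ring

variable {S : Type*} [MeasurableSpace S] {μ : Measure S} [IsProbabilityMeasure μ]

theorem tendstoInMeasure_const {F : Type*} [PseudoEMetricSpace F] {x : ℕ → F} {a : F}
    (h : Tendsto x atTop (𝓝 a)) : TendstoInMeasure μ (fun n _ => x n) atTop fun _ => a := by
  intro ε hε
  have h1 := (EMetric.tendsto_nhds.1 h) ε hε
  refine tendsto_const_nhds.congr' (h1.mono fun n hn => ?_)
  simp [not_le.2 hn]

/-- If a vector is asymptotically standard normal, bounded linear images of its projections to
two orthogonal subspaces are asymptotically independent. The linear maps need not converge, but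
every subsequence has a further one along which they do. -/
theorem asymptoticallyIndep_of_blocks {W : ℕ → S → E}
    (hW : TendstoInDistribution W atTop (id : E → E) (fun _ => μ) (stdGaussian E))
    {p₁ : E →L[ℝ] F₁} {p₂ : E →L[ℝ] F₂}
    (hp : ∀ t₁ t₂, ‖ContinuousLinearMap.adjoint p₁ t₁ + ContinuousLinearMap.adjoint p₂ t₂‖ ^ 2 =
      ‖t₁‖ ^ 2 + ‖t₂‖ ^ 2)
    {N₁ : ℕ → F₁ →L[ℝ] F₁} {N₂ : ℕ → F₂ →L[ℝ] F₂} {c : ℝ} (hN₁ : ∀ᶠ n in atTop, ‖N₁ n‖ ≤ c)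
    (hN₂ : ∀ᶠ n in atTop, ‖N₂ n‖ ≤ c) {A : ℕ → S → F₁} {B : ℕ → S → F₂}
    (hA : ∀ᶠ n in atTop, ∀ ω, A n ω = N₁ n (p₁ (W n ω)))
    (hB : ∀ᶠ n in atTop, ∀ ω, B n ω = N₂ n (p₂ (W n ω))) : AsymptoticallyIndep A B μ := by
  let _ : MeasurableSpace (F₁ →L[ℝ] F₁) := borel _
  let _ : MeasurableSpace (F₂ →L[ℝ] F₂) := borel _
  have : BorelSpace (F₁ →L[ℝ] F₁) := ⟨rfl⟩
  have : BorelSpace (F₂ →L[ℝ] F₂) := ⟨rfl⟩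
  intro f g
  refine tendsto_of_subseq_tendsto fun ns hns => ?_
  have hfreq : ∃ᶠ n in atTop, (N₁ (ns n), N₂ (ns n)) ∈
      Metric.closedBall (0 : (F₁ →L[ℝ] F₁) × (F₂ →L[ℝ] F₂)) c := by
    refine (((hns.eventually hN₁).and (hns.eventually hN₂)).mono fun n hn => ?_).frequently
    rw [mem_closedBall_zero_iff, Prod.norm_mk]
    exact max_le hn.1 hn.2
  obtain ⟨a, -, φ, hφ, hlim⟩ :=
    tendsto_subseq_of_frequently_bounded Metric.isBounded_closedBall hfreq
  refine ⟨φ, ?_⟩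
  have hsub : Tendsto (fun n => ns (φ n)) atTop atTop := hns.comp hφ.tendsto_atTop
  have hpair : TendstoInDistribution (fun n ω => (W (ns (φ n)) ω, (N₁ (ns (φ n)), N₂ (ns (φ n)))))
      atTop (fun x : E => (x, a)) (fun _ => μ) (stdGaussian E) := by
    have hW' : TendstoInDistribution (fun n => W (ns (φ n))) atTop (id : E → E) (fun _ => μ)
        (stdGaussian E) :=
      ⟨fun n => hW.forall_aemeasurable _, hW.aemeasurable_limit, hW.tendsto.comp hsub⟩
    exact hW'.prodMk_of_tendstoInMeasure_const _ (fun n _ => (N₁ (ns (φ n)), N₂ (ns (φ n)))) _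
      (tendstoInMeasure_const hlim) fun n => aemeasurable_const
  have hint : ∀ H : (E × ((F₁ →L[ℝ] F₁) × (F₂ →L[ℝ] F₂))) →ᵇ ℝ,
      Tendsto (fun n => ∫ ω, H (W (ns (φ n)) ω, (N₁ (ns (φ n)), N₂ (ns (φ n)))) ∂μ) atTop
        (𝓝 (∫ x, H (x, a) ∂(stdGaussian E))) := fun H => by
    have h := (ProbabilityMeasure.tendsto_iff_forall_integral_tendsto.1 hpair.tendsto) H
    simp only [ProbabilityMeasure.coe_mk] at h
    rw [integral_map hpair.aemeasurable_limit H.continuous.aestronglyMeasurable] at h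
    refine h.congr fun n => ?_
    exact integral_map (hpair.forall_aemeasurable n) H.continuous.aestronglyMeasurable
  set H₁ : (E × ((F₁ →L[ℝ] F₁) × (F₂ →L[ℝ] F₂))) →ᵇ ℝ :=
    f.compContinuous ⟨fun x => x.2.1 (p₁ x.1), by fun_prop⟩ with hH₁
  set H₂ : (E × ((F₁ →L[ℝ] F₁) × (F₂ →L[ℝ] F₂))) →ᵇ ℝ :=
    g.compContinuous ⟨fun x => x.2.2 (p₂ x.1), by fun_prop⟩ with hH₂
  have l1 := hint H₁
  have l2 := hint H₂
  have l12 := hint (H₁ * H₂)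
  have hind : IndepFun (fun x : E => f (a.1 (p₁ x))) (fun x => g (a.2 (p₂ x))) (stdGaussian E) :=
    (indepFun_stdGaussian_of_orthogonal hp).comp
      (φ := fun y => f (a.1 y)) (ψ := fun y => g (a.2 y))
      (f.continuous.comp a.1.continuous).measurable (g.continuous.comp a.2.continuous).measurable
  have hfac : ∫ x, (H₁ * H₂) (x, a) ∂(stdGaussian E) =
      (∫ x, H₁ (x, a) ∂(stdGaussian E)) * ∫ x, H₂ (x, a) ∂(stdGaussian E) :=
    hind.integral_fun_mul_eq_mul_integral
      ((f.continuous.comp (a.1.continuous.comp p₁.continuous)).aestronglyMeasurable)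
      ((g.continuous.comp (a.2.continuous.comp p₂.continuous)).aestronglyMeasurable)
  have hfin := l12.sub (l1.mul l2)
  rw [hfac, sub_self] at hfin
  refine hfin.congr' ?_
  filter_upwards [hsub.eventually hA, hsub.eventually hB] with n hAn hBn
  simp only [hAn, hBn]
  rfl

end Blocks


/-! ### Whitening a group of the mixed model -/

section MatrixFacts

variable {ι : Type*} [Fintype ι] [DecidableEq ι]

theorem trace_toEuclideanCLM (A : Matrix ι ι ℝ) :
    trace (Matrix.toEuclideanCLM (𝕜 := ℝ) A) = A.trace := by
  rw [trace, LinearMap.trace_eq_sum_inner _ (EuclideanSpace.basisFun ι ℝ)]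
  simp [Matrix.trace, Matrix.inner_toEuclideanCLM]

theorem inverse_toEuclideanCLM (A : Matrix ι ι ℝ) :
    Ring.inverse (Matrix.toEuclideanCLM (𝕜 := ℝ) A) = Matrix.toEuclideanCLM (𝕜 := ℝ) A⁻¹ := by
  by_cases h : IsUnit A
  · have h1 : A * A⁻¹ = 1 := Matrix.mul_nonsing_inv A ((Matrix.isUnit_iff_isUnit_det A).1 h)
    have h2 : Matrix.toEuclideanCLM (𝕜 := ℝ) A * Matrix.toEuclideanCLM (𝕜 := ℝ) A⁻¹ = 1 := by
      rw [← map_mul, h1, map_one]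
    have h3 : IsUnit (Matrix.toEuclideanCLM (𝕜 := ℝ) A) := h.map _
    calc _ = Ring.inverse (Matrix.toEuclideanCLM (𝕜 := ℝ) A) *
          (Matrix.toEuclideanCLM (𝕜 := ℝ) A * Matrix.toEuclideanCLM (𝕜 := ℝ) A⁻¹) := by
          rw [h2, mul_one]
      _ = _ := by rw [← mul_assoc, Ring.inverse_mul_cancel _ h3, one_mul]
  · have h3 : ¬ IsUnit (Matrix.toEuclideanCLM (𝕜 := ℝ) A) := fun hu => h (by
      have := hu.map (Matrix.toEuclideanCLM (𝕜 := ℝ) (n := ι)).symm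
      simpa using this)
    rw [Ring.inverse_non_unit _ h3, Matrix.nonsing_inv_eq_ringInverse, Ring.inverse_non_unit _ h,
      map_zero]

theorem isSymmetric_toEuclideanCLM {A : Matrix ι ι ℝ} (hA : A.IsHermitian) :
    (Matrix.toEuclideanCLM (𝕜 := ℝ) A : EuclideanSpace ℝ ι →ₗ[ℝ] EuclideanSpace ℝ ι).IsSymmetric := by
  intro x y
  change inner ℝ (Matrix.toEuclideanCLM (𝕜 := ℝ) A x) y = inner ℝ x (Matrix.toEuclideanCLM (𝕜 := ℝ) A y)
  have hT : Aᵀ = A := by simpa using hA.eq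
  rw [real_inner_comm, Matrix.inner_toEuclideanCLM, Matrix.inner_toEuclideanCLM,
    Matrix.dotProduct_mulVec, ← Matrix.mulVec_transpose, hT, dotProduct_comm]

/-- A positive semidefinite matrix has operator norm at most `c` if its quadratic form is at most
`c ‖x‖²`. -/
theorem norm_toEuclideanCLM_le {A : Matrix ι ι ℝ} (hA : A.PosSemidef) {c : ℝ} (hc : 0 ≤ c)
    (h : ∀ x : ι → ℝ, x ⬝ᵥ (A *ᵥ x) ≤ c * (x ⬝ᵥ x)) :
    ‖Matrix.toEuclideanCLM (𝕜 := ℝ) A‖ ≤ c := by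
  refine ContinuousLinearMap.opNorm_le_bound _ hc fun x => ?_
  set T := Matrix.toEuclideanCLM (𝕜 := ℝ) A with hT
  have hnn : ∀ x, 0 ≤ inner ℝ x (T x) := fun x => by
    rw [hT, Matrix.inner_toEuclideanCLM]
    simpa using hA.dotProduct_mulVec_nonneg x.ofLp
  have hle : ∀ x, inner ℝ x (T x) ≤ c * ‖x‖ ^ 2 := fun x => by
    rw [hT, Matrix.inner_toEuclideanCLM, EuclideanSpace.norm_sq_eq]
    simpa [dotProduct, sq] using h x.ofLp
  have hsym : ∀ x y, inner ℝ (T x) y = inner ℝ x (T y) :=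
    fun x y => isSymmetric_toEuclideanCLM hA.1 x y
  have hcs := LinearMap.BilinForm.apply_mul_apply_le_of_forall_zero_le
    ((innerₗ (EuclideanSpace ℝ ι)).compl₂ (T : EuclideanSpace ℝ ι →ₗ[ℝ] EuclideanSpace ℝ ι))
    (fun x => hnn x) (T x) x
  change inner ℝ (T x) (T x) * inner ℝ x (T (T x)) ≤ inner ℝ (T x) (T (T x)) * inner ℝ x (T x)
    at hcs
  rw [← hsym x (T x), real_inner_self_eq_norm_sq] at hcs
  have h1 : ‖T x‖ ^ 2 * ‖T x‖ ^ 2 ≤ ‖T x‖ ^ 2 * (c * ‖x‖) ^ 2 := by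
    refine hcs.trans ?_
    calc _ ≤ (c * ‖T x‖ ^ 2) * (c * ‖x‖ ^ 2) :=
          mul_le_mul (hle _) (hle _) (hnn _) (by positivity)
      _ = _ := by ring
  rcases (norm_nonneg (T x)).eq_or_lt with h0 | h0
  · rw [← h0]; positivity
  · have h2 := le_of_mul_le_mul_left h1 (by positivity)
    exact (pow_le_pow_iff_left₀ h0.le (by positivity) two_ne_zero).1 h2

theorem pow_le_det {A : Matrix ι ι ℝ} (hA : A.IsHermitian) {c : ℝ} (hc : 0 ≤ c)
    (h : ∀ x : ι → ℝ, c * (x ⬝ᵥ x) ≤ x ⬝ᵥ (A *ᵥ x)) : c ^ Fintype.card ι ≤ A.det := by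
  rw [hA.det_eq_prod_eigenvalues]
  have hev : ∀ i, c ≤ hA.eigenvalues i := fun i => by
    have h1 := h (hA.eigenvectorBasis i).ofLp
    have h2 : (hA.eigenvectorBasis i).ofLp ⬝ᵥ (hA.eigenvectorBasis i).ofLp = 1 := by
      have := hA.eigenvectorBasis.orthonormal.1 i
      have h3 : ‖hA.eigenvectorBasis i‖ ^ 2 = 1 := by rw [this]; norm_num
      rw [EuclideanSpace.norm_sq_eq] at h3
      simpa [dotProduct, sq] using h3
    rw [hA.mulVec_eigenvectorBasis, dotProduct_smul, h2] at h1
    simpa using h1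
  calc c ^ Fintype.card ι = ∏ _i : ι, c := by simp
    _ ≤ _ := Finset.prod_le_prod (fun _ _ => hc) fun i _ => by simpa using hev i

theorem differentiable_det : Differentiable ℝ fun A : ι → ι → ℝ => Matrix.det (Matrix.of A) := by
  simp only [Matrix.det_apply', Matrix.of_apply]
  fun_prop

end MatrixFacts

namespace Design

variable {k r : ℕ} (D : Design k r) {α : ℝ} {θ : Param k r}

theorem U_posSemidef (i : ℕ) (j : Fin (r + 1)) : (D.U i j).PosSemidef := by
  refine Fin.cases ?_ (fun j => ?_) j
  · exact Matrix.PosSemidef.one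
  · have := Matrix.posSemidef_self_mul_conjTranspose (D.Z i j)
    simpa [U] using this

theorem V_posDef (hθ : θ ∈ paramSpace k r) (i : ℕ) : (D.V θ i).PosDef := by
  rw [V, Fin.sum_univ_succ]
  refine Matrix.PosDef.add_posSemidef ?_ ?_
  · exact Matrix.PosDef.one.smul (hθ 0)
  · exact Matrix.posSemidef_sum _ fun j _ => (D.U_posSemidef i _).smul (hθ _).le

/-- The symmetric square root of `V_i⁻¹`. -/
noncomputable def whitener (θ : Param k r) (i : ℕ) : Matrix (Fin (D.m i)) (Fin (D.m i)) ℝ :=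
  CFC.sqrt (D.V θ i)⁻¹

theorem whitener_posSemidef (i : ℕ) : (D.whitener θ i).PosSemidef :=
  Matrix.nonneg_iff_posSemidef.1 (CFC.sqrt_nonneg _)

theorem whitener_transpose (i : ℕ) : (D.whitener θ i)ᵀ = D.whitener θ i := by
  simpa using (D.whitener_posSemidef (θ := θ) i).1.eq

theorem whitener_mul_self (hθ : θ ∈ paramSpace k r) (i : ℕ) :
    D.whitener θ i * D.whitener θ i = (D.V θ i)⁻¹ :=
  CFC.sqrt_mul_sqrt_self _ (Matrix.nonneg_iff_posSemidef.2 (D.V_posDef hθ i).inv.posSemidef)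

theorem isUnit_det_V (hθ : θ ∈ paramSpace k r) (i : ℕ) : IsUnit (D.V θ i).det :=
  (D.V_posDef hθ i).det_pos.ne'.isUnit

theorem whitener_mul_V_mul_whitener (hθ : θ ∈ paramSpace k r) (i : ℕ) :
    D.whitener θ i * D.V θ i * D.whitener θ i = 1 := by
  rw [mul_assoc]
  refine mul_eq_one_comm.1 ?_
  rw [mul_assoc, D.whitener_mul_self hθ, Matrix.mul_nonsing_inv _ (D.isUnit_det_V hθ i)]

theorem isUnit_det_whitener (hθ : θ ∈ paramSpace k r) (i : ℕ) :
    IsUnit (D.whitener θ i).det :=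
  Matrix.isUnit_det_of_left_inverse (D.whitener_mul_V_mul_whitener hθ i)

/-- The matrix `U_{ij}` in the coordinates in which `V_i` is the identity. -/
noncomputable def whiteU (θ : Param k r) (i : ℕ) (j : Fin (r + 1)) :
    Matrix (Fin (D.m i)) (Fin (D.m i)) ℝ :=
  D.whitener θ i * D.U i j * D.whitener θ i

theorem whiteU_posSemidef (i : ℕ) (j : Fin (r + 1)) : (D.whiteU θ i j).PosSemidef := by
  have := (D.U_posSemidef i j).conjTranspose_mul_mul_same (D.whitener θ i)
  simpa [whiteU, whitener_transpose] using this

theorem whitener_mul_V_add_mul_whitener (hθ : θ ∈ paramSpace k r) (i : ℕ) (h : Param k r) :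
    D.whitener θ i * D.V (θ + h) i * D.whitener θ i =
      1 + ∑ j, varPart h j • D.whiteU θ i j := by
  have e : D.V (θ + h) i = D.V θ i + ∑ j, varPart h j • D.U i j := by
    simp [V, varPart, add_smul, Finset.sum_add_distrib]
  rw [e, mul_add, add_mul, D.whitener_mul_V_mul_whitener hθ]
  simp [whiteU, Matrix.mul_sum, Matrix.sum_mul]

theorem sum_smul_whiteU (hθ : θ ∈ paramSpace k r) (i : ℕ) :
    ∑ j, varPart θ j • D.whiteU θ i j = 1 := by
  rw [← D.whitener_mul_V_mul_whitener hθ i, V]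
  simp [whiteU, Matrix.mul_sum, Matrix.sum_mul]

/-- The matrices `σⱼ² V_i^{-1/2} U_{ij} V_i^{-1/2}` are positive semidefinite and add up to the
identity, so each of them is at most the identity. -/
theorem quadForm_whiteU_le (hθ : θ ∈ paramSpace k r) (i : ℕ) (j : Fin (r + 1))
    (x : Fin (D.m i) → ℝ) :
    x ⬝ᵥ (D.whiteU θ i j *ᵥ x) ≤ (varPart θ j)⁻¹ * (x ⬝ᵥ x) := by
  have h1 : x ⬝ᵥ x = ∑ l, varPart θ l * (x ⬝ᵥ (D.whiteU θ i l *ᵥ x)) := by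
    have : x ⬝ᵥ x = x ⬝ᵥ ((1 : Matrix (Fin (D.m i)) (Fin (D.m i)) ℝ) *ᵥ x) := by
      rw [Matrix.one_mulVec]
    rw [this, ← D.sum_smul_whiteU hθ i, Matrix.sum_mulVec, dotProduct_sum]
    simp [Matrix.smul_mulVec]
  have hnn : ∀ l, 0 ≤ x ⬝ᵥ (D.whiteU θ i l *ᵥ x) := fun l => by
    simpa using (D.whiteU_posSemidef (θ := θ) i l).dotProduct_mulVec_nonneg x
  have h2 : varPart θ j * (x ⬝ᵥ (D.whiteU θ i j *ᵥ x)) ≤ x ⬝ᵥ x := by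
    rw [h1]
    exact Finset.single_le_sum (f := fun l => varPart θ l * (x ⬝ᵥ (D.whiteU θ i l *ᵥ x)))
      (fun l _ => mul_nonneg (hθ l).le (hnn l)) (Finset.mem_univ j)
  rw [inv_mul_eq_div, le_div_iff₀ (hθ j), mul_comm]
  exact h2

/-- The linear part of the covariance in whitened coordinates: `V_i^{-1/2} V_i(θ + h) V_i^{-1/2}` is
`1 + whiteB h`, where `V_i` is taken at `θ`. -/
noncomputable def whiteB (θ : Param k r) (i : ℕ) :
    Param k r →L[ℝ] EuclideanSpace ℝ (Fin (D.m i)) →L[ℝ] EuclideanSpace ℝ (Fin (D.m i)) :=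
  ∑ j, (EuclideanSpace.proj (Sum.inr j) : Param k r →L[ℝ] ℝ).smulRight
    (Matrix.toEuclideanCLM (𝕜 := ℝ) (D.whiteU θ i j))

/-- The shift `V_i^{-1/2} X_i h_β` of the mean in whitened coordinates. -/
noncomputable def whiteZ (θ : Param k r) (i : ℕ) :
    Param k r →L[ℝ] EuclideanSpace ℝ (Fin (D.m i)) :=
  ∑ a, (EuclideanSpace.proj (Sum.inl a) : Param k r →L[ℝ] ℝ).smulRight
    (WithLp.toLp 2 (D.whiteCol θ i a))

/-- The standardized residual `V_i^{-1/2} (y - X_i β)`. -/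
noncomputable def whiteNoise (θ : Param k r) (i : ℕ) (y : EuclideanSpace ℝ (Fin (D.m i))) :
    EuclideanSpace ℝ (Fin (D.m i)) :=
  Matrix.toEuclideanCLM (𝕜 := ℝ) (D.whitener θ i) (y - D.mean θ i)

theorem whiteB_apply (i : ℕ) (h : Param k r) : D.whiteB θ i h =
    Matrix.toEuclideanCLM (𝕜 := ℝ) (∑ j, varPart h j • D.whiteU θ i j) := by
  simp [whiteB, varPart]

theorem whiteB_single_inl (i : ℕ) (a : Fin k) :
    D.whiteB θ i (EuclideanSpace.single (Sum.inl a) 1) = 0 := by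
  simp [whiteB_apply, varPart]

theorem whiteB_single_inr (i : ℕ) (j : Fin (r + 1)) :
    D.whiteB θ i (EuclideanSpace.single (Sum.inr j) 1) =
      Matrix.toEuclideanCLM (𝕜 := ℝ) (D.whiteU θ i j) := by
  simp [whiteB_apply, varPart]

theorem whiteZ_apply (i : ℕ) (h : Param k r) : D.whiteZ θ i h =
    WithLp.toLp 2 (D.whitener θ i *ᵥ (D.X i *ᵥ fixedPart h)) := by
  ext s
  simp only [whiteZ, sum_apply, ContinuousLinearMap.smulRight_apply,
    WithLp.ofLp_sum, Finset.sum_apply, PiLp.smul_apply, whiteCol, whitener, Matrix.mulVec,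
    dotProduct, smul_eq_mul, Finset.mul_sum, fixedPart]
  rw [Finset.sum_comm]
  refine Finset.sum_congr rfl fun t _ => Finset.sum_congr rfl fun a _ => ?_
  simp
  ring

theorem whiteZ_single_inl (i : ℕ) (a : Fin k) :
    D.whiteZ θ i (EuclideanSpace.single (Sum.inl a) 1) = WithLp.toLp 2 (D.whiteCol θ i a) := by
  simp [whiteZ]

theorem whiteZ_single_inr (i : ℕ) (j : Fin (r + 1)) :
    D.whiteZ θ i (EuclideanSpace.single (Sum.inr j) 1) = 0 := by
  simp [whiteZ]

theorem one_add_whiteB (hθ : θ ∈ paramSpace k r) (i : ℕ) (h : Param k r) :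
    1 + D.whiteB θ i h = Matrix.toEuclideanCLM (𝕜 := ℝ)
      (D.whitener θ i * D.V (θ + h) i * D.whitener θ i) := by
  rw [D.whitener_mul_V_add_mul_whitener hθ, whiteB_apply, map_add, map_one]

/-- The inverse of the covariance in whitened coordinates. -/
noncomputable def whitePrec (θ : Param k r) (i : ℕ) (h : Param k r) :
    Matrix (Fin (D.m i)) (Fin (D.m i)) ℝ :=
  (D.whitener θ i * D.V (θ + h) i * D.whitener θ i)⁻¹

theorem precision_whiteB (hθ : θ ∈ paramSpace k r) (i : ℕ) (h : Param k r) :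
    precision (D.whiteB θ i) h = Matrix.toEuclideanCLM (𝕜 := ℝ) (D.whitePrec θ i h) := by
  rw [precision, D.one_add_whiteB hθ, inverse_toEuclideanCLM, whitePrec]

theorem V_add_inv (hθ : θ ∈ paramSpace k r) (i : ℕ) (h : Param k r) :
    (D.V (θ + h) i)⁻¹ = D.whitener θ i * D.whitePrec θ i h * D.whitener θ i := by
  have hu := D.isUnit_det_whitener hθ i
  rw [whitePrec, Matrix.mul_inv_rev, Matrix.mul_inv_rev, ← mul_assoc, ← mul_assoc,
    Matrix.mul_nonsing_inv _ hu, one_mul, mul_assoc, Matrix.nonsing_inv_mul _ hu, mul_one]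

theorem whitener_mulVec_resid (i : ℕ) (h : Param k r) (y : EuclideanSpace ℝ (Fin (D.m i))) :
    D.whitener θ i *ᵥ D.resid (θ + h) i y = (D.whiteNoise θ i y - D.whiteZ θ i h).ofLp := by
  rw [whiteZ_apply, whiteNoise, WithLp.ofLp_sub, Matrix.ofLp_toEuclideanCLM, ← Matrix.mulVec_sub]
  congr 1
  have e : D.mean (θ + h) i = D.mean θ i + WithLp.toLp 2 (D.X i *ᵥ fixedPart h) := by
    have : (fixedPart (θ + h)).ofLp = fixedPart θ + fixedPart h := by ext; simp [fixedPart]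
    rw [mean, mean, this, Matrix.mulVec_add]; rfl
  simp only [resid, e, WithLp.ofLp_sub, WithLp.ofLp_add]
  abel

end Design


/-! ### The estimating equations in whitened coordinates -/

namespace Design

variable {k r : ℕ} (D : Design k r) {α : ℝ} {θ : Param k r}

theorem map_whiteNoise (hθ : θ ∈ paramSpace k r) (i : ℕ) :
    (multivariateGaussian (D.mean θ i) (D.V θ i)).map (D.whiteNoise θ i) =
      stdGaussian (EuclideanSpace ℝ (Fin (D.m i))) := by
  have hV := Matrix.nonneg_iff_posSemidef.2 (D.V_posDef hθ i).posSemidef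
  set R := CFC.sqrt (D.V θ i) with hR
  have hRR : R * R = D.V θ i := CFC.sqrt_mul_sqrt_self _ hV
  have hRT : Rᴴ = R := (Matrix.nonneg_iff_posSemidef.1 (CFC.sqrt_nonneg (D.V θ i))).1.eq
  have hWT : (D.whitener θ i)ᴴ = D.whitener θ i := (D.whitener_posSemidef (θ := θ) i).1.eq
  have hcont : Continuous (D.whiteNoise θ i) := by
    unfold whiteNoise; fun_prop
  have hcomp : D.whiteNoise θ i ∘ (fun x => D.mean θ i + Matrix.toEuclideanCLM (𝕜 := ℝ) R x) =
      Matrix.toEuclideanCLM (𝕜 := ℝ) (D.whitener θ i * R) := by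
    funext x
    simp [whiteNoise, map_mul]
  rw [multivariateGaussian, Measure.map_map hcont.measurable (by fun_prop), hcomp]
  refine map_stdGaussian_of_adjoint_isometry fun t => ?_
  have hadj : ContinuousLinearMap.adjoint (Matrix.toEuclideanCLM (𝕜 := ℝ) (D.whitener θ i * R)) =
      Matrix.toEuclideanCLM (𝕜 := ℝ) (R * D.whitener θ i) := by
    rw [← ContinuousLinearMap.star_eq_adjoint, ← map_star, Matrix.star_eq_conjTranspose,
      Matrix.conjTranspose_mul, hRT, hWT]
  have h2 : ‖Matrix.toEuclideanCLM (𝕜 := ℝ) (R * D.whitener θ i) t‖ ^ 2 = ‖t‖ ^ 2 := by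
    rw [← real_inner_self_eq_norm_sq, ← ContinuousLinearMap.adjoint_inner_right, ← hadj,
      ContinuousLinearMap.adjoint_adjoint, hadj, ← ContinuousLinearMap.comp_apply,
      ← ContinuousLinearMap.mul_def, ← map_mul]
    have e : D.whitener θ i * R * (R * D.whitener θ i) = 1 := by
      rw [← D.whitener_mul_V_mul_whitener hθ i, ← hRR]
      simp only [mul_assoc]
    rw [e, map_one, one_apply_eq_self, real_inner_self_eq_norm_sq]
  rw [hadj]
  exact (pow_left_inj₀ (norm_nonneg _) (norm_nonneg _) two_ne_zero).1 h2

theorem continuous_whiteNoise (i : ℕ) : Continuous (D.whiteNoise θ i) := by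
  unfold whiteNoise; fun_prop

theorem hasLaw_whiteNoise (hθ : θ ∈ paramSpace k r) {S : Type*} [MeasurableSpace S]
    {μ : Measure S} {Y : (i : ℕ) → S → EuclideanSpace ℝ (Fin (D.m i))} (hY : D.IsModel θ Y μ)
    (i : ℕ) : HasLaw (fun ω => D.whiteNoise θ i (Y i ω)) (stdGaussian _) μ where
  aemeasurable := (D.continuous_whiteNoise i).measurable.comp_aemeasurable (hY.law i).aemeasurable
  map_eq := by
    have h := AEMeasurable.map_map_of_aemeasurable
      (D.continuous_whiteNoise (θ := θ) i).measurable.aemeasurable (hY.law i).aemeasurable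
    rw [(hY.law i).map_eq, D.map_whiteNoise hθ] at h
    exact h.symm

/-- The vector of the left-hand sides of the estimating equations. -/
noncomputable def estEq (α : ℝ) (θ : Param k r) {n : ℕ} (y : D.Sample n) : Param k r :=
  WithLp.toLp 2 (Sum.elim (D.betaEq α θ y) (D.sigmaEq α θ y))

theorem isRoot_iff {n : ℕ} (y : D.Sample n) :
    D.IsRoot α θ y ↔ θ ∈ paramSpace k r ∧ D.estEq α θ y = 0 := by
  rw [IsRoot, and_congr_right_iff]
  intro _
  constructor
  · rintro ⟨h1, h2⟩
    ext a
    rcases a with a | j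
    · simpa [estEq] using congrFun h1 a
    · simpa [estEq] using h2 j
  · intro h
    refine ⟨funext fun a => ?_, fun j => ?_⟩
    · simpa [estEq] using congrArg (fun v : Param k r => v (Sum.inl a)) h
    · simpa [estEq] using congrArg (fun v : Param k r => v (Sum.inr j)) h

theorem mulVec_dotProduct_whitener (i : ℕ) (u v : Fin (D.m i) → ℝ) :
    u ⬝ᵥ (D.whitener θ i *ᵥ v) = (D.whitener θ i *ᵥ u) ⬝ᵥ v := by
  rw [Matrix.dotProduct_mulVec, ← Matrix.mulVec_transpose, whitener_transpose]

theorem weight_add (hθ : θ ∈ paramSpace k r) (i : ℕ) (h : Param k r)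
    (y : EuclideanSpace ℝ (Fin (D.m i))) :
    D.weight α (θ + h) i y = weightAt (D.whiteB θ i) (D.whiteZ θ i) (D.whiteNoise θ i y) α
      (fun h => D.eta α (θ + h) i) h := by
  rw [weight, weightAt, D.precision_whiteB hθ, Matrix.inner_toEuclideanCLM,
    ← D.whitener_mulVec_resid, D.V_add_inv hθ, ← Matrix.mulVec_mulVec, ← Matrix.mulVec_mulVec,
    mulVec_dotProduct_whitener]

theorem trace_VU_add (hθ : θ ∈ paramSpace k r) (i : ℕ) (h : Param k r) (j : Fin (r + 1)) :
    (D.VU (θ + h) i j).trace = (D.whitePrec θ i h * D.whiteU θ i j).trace := by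
  rw [VU, D.V_add_inv hθ, whiteU, mul_assoc, mul_assoc, Matrix.trace_mul_comm]
  simp only [mul_assoc]

theorem estEq_add (hα : 0 ≤ α) (hθ : θ ∈ paramSpace k r) (h : Param k r) {n : ℕ} (y : D.Sample n) :
    D.estEq α (θ + h) y = (1 / n : ℝ) • ∑ i : Fin n, estVec (D.whiteB θ i) (D.whiteZ θ i)
      (D.whiteNoise θ i (y i)) α (fun h => D.eta α (θ + h) i) h := by
  ext a
  rcases a with a | j
  · simp only [estEq, Sum.elim_inl, betaEq, PiLp.smul_apply, WithLp.ofLp_sum, Finset.sum_apply,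
      Pi.smul_apply, smul_eq_mul, estVec]
    congr 1
    refine Finset.sum_congr rfl fun i _ => ?_
    have e : ((D.X i)ᵀ *ᵥ ((D.V (θ + h) i)⁻¹ *ᵥ D.resid (θ + h) i (y i))) a =
        D.whiteCol θ i a ⬝ᵥ (D.whitePrec θ i h *ᵥ
          (D.whiteNoise θ i (y i) - D.whiteZ θ i h).ofLp) := by
      rw [← D.whitener_mulVec_resid, D.V_add_inv hθ, ← Matrix.mulVec_mulVec,
        ← Matrix.mulVec_mulVec]
      exact D.mulVec_dotProduct_whitener i (fun s => D.X i s a) _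
    rw [e, D.weight_add hθ, estFun, scoreAt, whiteB_single_inl, whiteZ_single_inl,
      D.precision_whiteB hθ, Matrix.inner_toEuclideanCLM]
    simp [trace]
    ring
  · simp only [estEq, Sum.elim_inr, sigmaEq, PiLp.smul_apply, WithLp.ofLp_sum, Finset.sum_apply,
      smul_eq_mul, estVec]
    congr 1
    refine Finset.sum_congr rfl fun i _ => ?_
    have e : D.resid (θ + h) i (y i) ⬝ᵥ ((D.VU (θ + h) i j * (D.V (θ + h) i)⁻¹) *ᵥ
        D.resid (θ + h) i (y i)) = (D.whiteNoise θ i (y i) - D.whiteZ θ i h).ofLp ⬝ᵥ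
          ((D.whitePrec θ i h * (D.whiteU θ i j * D.whitePrec θ i h)) *ᵥ
            (D.whiteNoise θ i (y i) - D.whiteZ θ i h).ofLp) := by
      rw [← D.whitener_mulVec_resid, ← mulVec_dotProduct_whitener, VU, D.V_add_inv hθ, whiteU]
      simp only [Matrix.mulVec_mulVec, mul_assoc]
    have e2 : precision (D.whiteB θ i) h (Matrix.toEuclideanCLM (𝕜 := ℝ) (D.whiteU θ i j)
        (precision (D.whiteB θ i) h (D.whiteNoise θ i (y i) - D.whiteZ θ i h))) =
        Matrix.toEuclideanCLM (𝕜 := ℝ)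
          (D.whitePrec θ i h * (D.whiteU θ i j * D.whitePrec θ i h))
          (D.whiteNoise θ i (y i) - D.whiteZ θ i h) := by
      rw [D.precision_whiteB hθ, map_mul, map_mul]; rfl
    rw [e, D.weight_add hθ, estFun, scoreAt, whiteB_single_inr, whiteZ_single_inr, e2,
      Matrix.inner_toEuclideanCLM, D.precision_whiteB hθ, ← map_mul, trace_toEuclideanCLM,
      D.trace_VU_add hθ, inner_zero_left, finrank_euclideanSpace_fin]
    have hp : (1 + α) ^ (-((D.m i : ℝ) / 2)) = ((α + 1) ^ ((D.m i : ℝ) / 2))⁻¹ := by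
      rw [Real.rpow_neg (by linarith), add_comm]
    rw [hp]
    field_simp
    ring

theorem avgEst_white (hα : 0 ≤ α) (hθ : θ ∈ paramSpace k r) {S : Type*}
    (Y : (i : ℕ) → S → EuclideanSpace ℝ (Fin (D.m i))) (n : ℕ) (ω : S) (h : Param k r) :
    avgEst (D.whiteB θ) (D.whiteZ θ) α (fun i h => D.eta α (θ + h) i)
      (fun i ω => D.whiteNoise θ i (Y i ω)) n ω h =
      D.estEq α (θ + h) (fun i : Fin n => Y i ω) := by
  rw [D.estEq_add hα hθ, avgEst, Finset.sum_range]

theorem continuous_V_add {n : ℕ} (i : ℕ) :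
    Continuous fun p : D.Sample n × Param k r => D.V (θ + p.2) i := by
  simp only [V, varPart]
  fun_prop

theorem measurable_det_V_add {n : ℕ} (i : ℕ) :
    Measurable fun p : D.Sample n × Param k r => (D.V (θ + p.2) i).det :=
  (D.continuous_V_add i).matrix_det.measurable

theorem measurable_V_add_inv {n : ℕ} (i : ℕ) (a b : Fin (D.m i)) :
    Measurable fun p : D.Sample n × Param k r => (D.V (θ + p.2) i)⁻¹ a b := by
  simp only [Matrix.inv_def, Ring.inverse_eq_inv', Matrix.smul_apply, smul_eq_mul]
  exact (D.measurable_det_V_add i).inv.mul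
    ((D.continuous_V_add i).matrix_adjugate.matrix_elem a b).measurable

theorem measurable_resid_add {n : ℕ} (i : Fin n) (a : Fin (D.m i)) :
    Measurable fun p : D.Sample n × Param k r => D.resid (θ + p.2) i (p.1 i) a := by
  have hc : Continuous fun p : D.Sample n × Param k r => D.mean (θ + p.2) i a := by
    simp only [mean, fixedPart, Matrix.mulVec, dotProduct]
    fun_prop
  have hc2 : Continuous fun p : D.Sample n × Param k r => (p.1 i) a := by fun_prop
  exact (hc2.sub hc).measurable

theorem measurable_eta_add {n : ℕ} (i : ℕ) :
    Measurable fun p : D.Sample n × Param k r => D.eta α (θ + p.2) i :=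
  ((D.measurable_det_V_add i).pow_const _).const_mul _

theorem measurable_weight_add {n : ℕ} (i : Fin n) :
    Measurable fun p : D.Sample n × Param k r => D.weight α (θ + p.2) i (p.1 i) := by
  simp only [weight, Matrix.mulVec, dotProduct]
  refine (D.measurable_eta_add i).mul (Measurable.exp (Measurable.const_mul
    (Finset.measurable_fun_sum _ fun a _ => (D.measurable_resid_add i a).mul
      (Finset.measurable_fun_sum _ fun b _ => (D.measurable_V_add_inv i a b).mul
        (D.measurable_resid_add i b))) _))

theorem measurable_VU_add {n : ℕ} (i : ℕ) (j : Fin (r + 1)) (a b : Fin (D.m i)) :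
    Measurable fun p : D.Sample n × Param k r => D.VU (θ + p.2) i j a b := by
  simp only [VU, Matrix.mul_apply]
  exact Finset.measurable_fun_sum _ fun c _ => (D.measurable_V_add_inv i a c).mul_const _

theorem measurable_estEq (n : ℕ) :
    Measurable fun p : D.Sample n × Param k r => D.estEq α (θ + p.2) p.1 := by
  refine (WithLp.measurable_toLp 2 _).comp (measurable_pi_lambda _ fun a => ?_)
  rcases a with a | j
  · simp only [Sum.elim_inl, betaEq, Pi.smul_apply, Finset.sum_apply, Matrix.mulVec, dotProduct,
      smul_eq_mul]
    exact (Finset.measurable_fun_sum _ fun i _ => ((D.measurable_weight_add i).const_mul _).neg.mul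
      (Finset.measurable_fun_sum _ fun s _ => (Finset.measurable_fun_sum _ fun t _ =>
        (D.measurable_V_add_inv i s t).mul (D.measurable_resid_add i t)).const_mul _)).const_mul _
  · have htr : ∀ i : ℕ, Measurable fun p : D.Sample n × Param k r =>
        (D.VU (θ + p.2) i j).trace := fun i =>
      Finset.measurable_fun_sum _ fun s _ => D.measurable_VU_add i j s s
    have hq : ∀ i : Fin n, Measurable fun p : D.Sample n × Param k r =>
        D.resid (θ + p.2) i (p.1 i) ⬝ᵥ ((D.VU (θ + p.2) i j * (D.V (θ + p.2) i)⁻¹) *ᵥ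
          D.resid (θ + p.2) i (p.1 i)) := fun i => by
      simp only [Matrix.mulVec, dotProduct, Matrix.mul_apply]
      exact Finset.measurable_fun_sum _ fun s _ => (D.measurable_resid_add i s).mul
        (Finset.measurable_fun_sum _ fun t _ => (Finset.measurable_fun_sum _ fun u _ =>
          (D.measurable_VU_add i j s u).mul (D.measurable_V_add_inv i u t)).mul
            (D.measurable_resid_add i t))
    simp only [Sum.elim_inr, sigmaEq]
    exact (Finset.measurable_fun_sum _ fun (i : Fin n) _ =>
      ((((htr i).const_mul _).mul (D.measurable_eta_add i)).div_const _).neg.add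
        (((D.measurable_weight_add i).const_mul _).mul ((htr i).sub (hq i)))).const_mul _

end Design


/-! ### The groups of the mixed model are white groups with common constants -/

section Determinant

variable {ι : Type*} [Fintype ι] [DecidableEq ι]

theorem hasDerivAt_det_add_smul {M : Matrix ι ι ℝ} (hM : IsUnit M.det) (N : Matrix ι ι ℝ) :
    HasDerivAt (fun t : ℝ => (M + t • N).det) (M.det * (M⁻¹ * N).trace) 0 := by
  set P := (1 + (Polynomial.X : Polynomial ℝ) • (M⁻¹ * N).map Polynomial.C).det.divX.divX with hP
  have e : (fun t : ℝ => (M + t • N).det) =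
      fun t => M.det * (1 + (M⁻¹ * N).trace * t + P.eval t * t ^ 2) := funext fun t => by
    rw [hP, ← Matrix.det_one_add_smul, ← Matrix.det_mul, mul_add, mul_one, mul_smul_comm,
      ← mul_assoc, Matrix.mul_nonsing_inv _ hM, one_mul]
  rw [e]
  have h1 : HasDerivAt (fun t : ℝ => 1 + (M⁻¹ * N).trace * t) ((M⁻¹ * N).trace) 0 := by
    simpa using ((hasDerivAt_id (0 : ℝ)).const_mul ((M⁻¹ * N).trace)).const_add 1
  have h2 := (P.hasDerivAt (0 : ℝ)).mul (hasDerivAt_pow 2 (0 : ℝ))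
  refine ((h1.add h2).const_mul M.det).congr_deriv ?_
  simp

/-- The derivative of the logarithm of `det (1 + B h)`. -/
noncomputable def logDetDeriv {E V : Type*} [NormedAddCommGroup E] [NormedSpace ℝ E]
    [NormedAddCommGroup V] [InnerProductSpace ℝ V] [FiniteDimensional ℝ V]
    (B : E →L[ℝ] V →L[ℝ] V) (h : E) : E →L[ℝ] ℝ :=
  traceCLM ∘L (ContinuousLinearMap.mul ℝ (V →L[ℝ] V) (precision B h)) ∘L B

theorem logDetDeriv_apply {E V : Type*} [NormedAddCommGroup E] [NormedSpace ℝ E]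
    [NormedAddCommGroup V] [InnerProductSpace ℝ V] [FiniteDimensional ℝ V]
    (B : E →L[ℝ] V →L[ℝ] V) (h v : E) : logDetDeriv B h v = trace (precision B h * B v) := rfl

end Determinant

namespace Design

variable {k r : ℕ} (D : Design k r) {α : ℝ} {θ : Param k r}

theorem differentiable_det_V_add (i : ℕ) :
    Differentiable ℝ fun h : Param k r => (D.V (θ + h) i).det := by
  have h1 : Differentiable ℝ fun h : Param k r => fun a b => D.V (θ + h) i a b := by
    refine differentiable_pi.2 fun a => differentiable_pi.2 fun b => ?_
    simp only [V, varPart, Matrix.sum_apply, Matrix.smul_apply, smul_eq_mul, PiLp.add_apply]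
    fun_prop
  have h2 := differentiable_det.comp h1
  exact h2

/-- Jacobi's formula along the parameter. -/
theorem hasFDerivAt_det_V_add (hθ : θ ∈ paramSpace k r) (i : ℕ) {h : Param k r}
    (hh : θ + h ∈ paramSpace k r) :
    HasFDerivAt (fun h : Param k r => (D.V (θ + h) i).det)
      ((D.V (θ + h) i).det • logDetDeriv (D.whiteB θ i) h) h := by
  have hd := (D.differentiable_det_V_add (θ := θ) i h).hasFDerivAt
  convert! hd using 1
  ext v
  have hline : HasDerivAt (fun t : ℝ => h + t • v) v 0 := by
    simpa using ((hasDerivAt_id (0 : ℝ)).smul_const v).const_add h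
  have hd0 : HasFDerivAt (fun h : Param k r => (D.V (θ + h) i).det)
      (fderiv ℝ (fun h : Param k r => (D.V (θ + h) i).det) h) (h + (0 : ℝ) • v) := by
    rwa [zero_smul, add_zero]
  have h1 := hd0.comp_hasDerivAt (0 : ℝ) hline
  have e : ∀ t : ℝ, D.V (θ + (h + t • v)) i = D.V (θ + h) i + t • ∑ j, varPart v j • D.U i j :=
    fun t => by
      simp [V, varPart, add_smul, mul_smul, Finset.sum_add_distrib, Finset.smul_sum, add_assoc]
  have h2 := hasDerivAt_det_add_smul (D.isUnit_det_V hh i) (∑ j, varPart v j • D.U i j)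
  simp_rw [← e] at h2
  have h3 := h1.unique h2
  rw [h3, D.V_add_inv hθ]
  rw [smul_apply, logDetDeriv_apply, smul_eq_mul]
  rw [D.precision_whiteB hθ, whiteB_apply, ← map_mul, trace_toEuclideanCLM]
  congr 1
  have e3 : ∑ j, varPart v j • D.whiteU θ i j =
      D.whitener θ i * (∑ j, varPart v j • D.U i j) * D.whitener θ i := by
    simp [whiteU, Matrix.mul_sum, Matrix.sum_mul]
  rw [e3]
  simp only [mul_assoc]
  rw [Matrix.trace_mul_comm (D.whitener θ i)]
  simp only [mul_assoc]

theorem hasFDerivAt_eta_add (hθ : θ ∈ paramSpace k r) (i : ℕ) {h : Param k r}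
    (hh : θ + h ∈ paramSpace k r) :
    HasFDerivAt (fun h : Param k r => D.eta α (θ + h) i)
      ((-(α / 2) * D.eta α (θ + h) i) • logDetDeriv (D.whiteB θ i) h) h := by
  have hpos := (D.V_posDef hh i).det_pos
  have h1 := ((D.hasFDerivAt_det_V_add hθ i hh).rpow_const (p := -(α / 2))
    (Or.inl hpos.ne')).const_mul ((2 * Real.pi) ^ (-(D.m i * α / 2)))
  convert! h1 using 1
  rw [smul_smul, smul_smul, eta, Real.rpow_sub_one hpos.ne']
  congr 1
  field_simp

theorem eta_nonneg (hθ : θ ∈ paramSpace k r) (i : ℕ) : 0 ≤ D.eta α θ i :=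
  mul_nonneg (Real.rpow_nonneg (by positivity) _)
    (Real.rpow_nonneg (D.V_posDef hθ i).det_pos.le _)

/-- The factor `(2π) ^ (-n_i α / 2)` makes up for the change of the determinant in a
neighbourhood of `θ` whose size does not depend on `n_i`. -/
theorem eta_add_le (hα : 0 ≤ α) (hθ : θ ∈ paramSpace k r) (i : ℕ) {h : Param k r}
    (hh : ∀ j, |varPart h j| ≤ varPart θ j / 4) {c : ℝ} (hc : 0 < c) (hdet : c ≤ (D.V θ i).det) :
    D.eta α (θ + h) i ≤ c ^ (-(α / 2)) := by
  have hh' : θ + h ∈ paramSpace k r := fun j => by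
    have h1 := hθ j
    have h2 := neg_abs_le (varPart h j)
    have h3 := hh j
    have : varPart (θ + h) j = varPart θ j + varPart h j := rfl
    rw [this]
    linarith
  have hpos := (D.V_posDef hh' i).det_pos
  set A := D.whitener θ i * D.V (θ + h) i * D.whitener θ i with hA
  have hherm : A.IsHermitian := by
    have := ((D.V_posDef hh' i).posSemidef.conjTranspose_mul_mul_same (D.whitener θ i)).1
    simpa [whitener_transpose] using this
  have hq : ∀ x : Fin (D.m i) → ℝ, 3 / 4 * (x ⬝ᵥ x) ≤ x ⬝ᵥ (A *ᵥ x) := fun x => by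
    have hnn : ∀ l, 0 ≤ x ⬝ᵥ (D.whiteU θ i l *ᵥ x) := fun l => by
      simpa using (D.whiteU_posSemidef (θ := θ) i l).dotProduct_mulVec_nonneg x
    have h1 : x ⬝ᵥ x = ∑ l, varPart θ l * (x ⬝ᵥ (D.whiteU θ i l *ᵥ x)) := by
      have : x ⬝ᵥ x = x ⬝ᵥ ((1 : Matrix (Fin (D.m i)) (Fin (D.m i)) ℝ) *ᵥ x) := by
        rw [Matrix.one_mulVec]
      rw [this, ← D.sum_smul_whiteU hθ i, Matrix.sum_mulVec, dotProduct_sum]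
      simp [Matrix.smul_mulVec]
    have h2 : x ⬝ᵥ (A *ᵥ x) = x ⬝ᵥ x + ∑ l, varPart h l * (x ⬝ᵥ (D.whiteU θ i l *ᵥ x)) := by
      rw [hA, D.whitener_mul_V_add_mul_whitener hθ, Matrix.add_mulVec, Matrix.one_mulVec,
        dotProduct_add, Matrix.sum_mulVec, dotProduct_sum]
      simp [Matrix.smul_mulVec]
    have h3 : -(1 / 4 * (x ⬝ᵥ x)) ≤ ∑ l, varPart h l * (x ⬝ᵥ (D.whiteU θ i l *ᵥ x)) := by
      rw [h1, Finset.mul_sum, ← Finset.sum_neg_distrib]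
      refine Finset.sum_le_sum fun l _ => ?_
      have h4 := neg_abs_le (varPart h l)
      have h5 := hh l
      nlinarith [hnn l]
    linarith
  have hdetA : (3 / 4 : ℝ) ^ D.m i ≤ A.det := by
    simpa using pow_le_det hherm (by norm_num) hq
  have hdet2 : (D.V (θ + h) i).det = A.det * (D.V θ i).det := by
    have h1 : (D.whitener θ i).det * (D.V θ i).det * (D.whitener θ i).det = 1 := by
      rw [← Matrix.det_mul, ← Matrix.det_mul, D.whitener_mul_V_mul_whitener hθ, Matrix.det_one]
    rw [hA, Matrix.det_mul, Matrix.det_mul]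
    linear_combination -(D.V (θ + h) i).det * h1
  have hlow : c ≤ (2 * Real.pi) ^ D.m i * (D.V (θ + h) i).det := by
    have h2 : (1 : ℝ) ≤ (2 * Real.pi) ^ D.m i * A.det := by
      calc (1 : ℝ) ≤ (2 * Real.pi * (3 / 4)) ^ D.m i :=
            one_le_pow₀ (by nlinarith [Real.pi_gt_three])
        _ = (2 * Real.pi) ^ D.m i * (3 / 4) ^ D.m i := mul_pow _ _ _
        _ ≤ _ := by gcongr
    rw [hdet2]
    nlinarith
  have e : D.eta α (θ + h) i = ((2 * Real.pi) ^ D.m i * (D.V (θ + h) i).det) ^ (-(α / 2)) := by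
    rw [Real.mul_rpow (by positivity) hpos.le, ← Real.rpow_natCast, ← Real.rpow_mul (by positivity),
      eta]
    congr 2
    ring
  rw [e]
  exact Real.rpow_le_rpow_of_nonpos hc hlow (by linarith)

theorem norm_whiteCol_sq (hθ : θ ∈ paramSpace k r) (i : ℕ) (a : Fin k) :
    ‖(WithLp.toLp 2 (D.whiteCol θ i a) : EuclideanSpace ℝ (Fin (D.m i)))‖ ^ 2 =
      D.colProd θ i a a := by
  rw [EuclideanSpace.norm_sq_eq, colProd, ← D.whitener_mul_self hθ, ← Matrix.mulVec_mulVec,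
    mulVec_dotProduct_whitener]
  simp [whiteCol, whitener, dotProduct, sq]

/-- Around a parameter with positive variance components, all groups are white groups with the
same constants. -/
theorem exists_whiteGroup (hα : 0 ≤ α) (hθ : θ ∈ paramSpace k r)
    (hcol : ∀ a, ∃ C : ℝ, ∀ i, |D.colProd θ i a a| ≤ C)
    (hdet : ∃ c : ℝ, 0 < c ∧ ∀ i, c ≤ (D.V θ i).det) :
    ∃ K δ Mη : ℝ, (∀ i, WhiteGroup (D.whiteB θ i) (D.whiteZ θ i) α
      (fun h => D.eta α (θ + h) i) K δ Mη) ∧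
        ∀ h ∈ Metric.closedBall (0 : Param k r) δ, θ + h ∈ paramSpace k r := by
  choose C hC using hcol
  obtain ⟨c, hc, hcdet⟩ := hdet
  -- `Ks` bounds `whiteB` and `Kc` bounds `whiteZ`; in the ball of radius `1 / (4 K)` every variance
  -- component changes by at most a quarter.
  set Ks : ℝ := ∑ j, (varPart θ j)⁻¹ with hKs
  set Kc : ℝ := ∑ a, √(C a) with hKc
  have hKs0 : 0 ≤ Ks := Finset.sum_nonneg fun j _ => (inv_pos.2 (hθ j)).le
  have hKc0 : 0 ≤ Kc := Finset.sum_nonneg fun a _ => Real.sqrt_nonneg _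
  set K : ℝ := 1 + Ks + Kc with hK
  have hK1 : 1 ≤ K := by linarith
  have hKpos : 0 < K := by linarith
  have hball : ∀ h ∈ Metric.closedBall (0 : Param k r) (1 / (4 * K)), ∀ j,
      |varPart h j| ≤ varPart θ j / 4 := fun h hh j => by
    have h1 : |varPart h j| ≤ ‖h‖ := PiLp.norm_apply_le h (Sum.inr j)
    have h2 : ‖h‖ ≤ 1 / (4 * K) := mem_closedBall_zero_iff.1 hh
    have h3 : (varPart θ j)⁻¹ ≤ K := by
      have := Finset.single_le_sum (f := fun j => (varPart θ j)⁻¹)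
        (fun j _ => (inv_pos.2 (hθ j)).le) (Finset.mem_univ j)
      have h4 : (varPart θ j)⁻¹ ≤ Ks := this
      linarith
    have h4 : K⁻¹ ≤ varPart θ j := inv_le_of_inv_le₀ (hθ j) h3
    calc _ ≤ 1 / (4 * K) := h1.trans h2
      _ = K⁻¹ / 4 := by field_simp
      _ ≤ _ := by linarith
  have hparam : ∀ h ∈ Metric.closedBall (0 : Param k r) (1 / (4 * K)), θ + h ∈ paramSpace k r :=
    fun h hh j => by
      have h1 := hθ j
      have h2 := neg_abs_le (varPart h j)
      have h3 := hball h hh j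
      have : varPart (θ + h) j = varPart θ j + varPart h j := rfl
      rw [this]
      linarith
  refine ⟨K, 1 / (4 * K), c ^ (-(α / 2)), fun i => ?_, hparam⟩
  refine ⟨hK1, by positivity, le_of_eq (by field_simp), fun e => ?_, fun e => ?_, fun e => ?_, hα,
    fun h hh => D.eta_nonneg (hparam h hh) i, fun h hh => ?_, fun h hh => ?_⟩
  · have hU : ∀ j, ‖Matrix.toEuclideanCLM (𝕜 := ℝ) (D.whiteU θ i j)‖ ≤ (varPart θ j)⁻¹ := fun j =>
      norm_toEuclideanCLM_le (D.whiteU_posSemidef i j) (inv_pos.2 (hθ j)).le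
        (D.quadForm_whiteU_le hθ i j)
    rw [whiteB_apply, map_sum]
    calc _ ≤ ∑ j, ‖e‖ * (varPart θ j)⁻¹ := by
          refine (norm_sum_le _ _).trans (Finset.sum_le_sum fun j _ => ?_)
          rw [map_smul, norm_smul]
          gcongr
          · exact PiLp.norm_apply_le e (Sum.inr j)
          · exact hU j
      _ = Ks * ‖e‖ := by rw [← Finset.mul_sum, mul_comm]
      _ ≤ K * ‖e‖ := by gcongr; linarith
  · have hZ : ∀ a, ‖(WithLp.toLp 2 (D.whiteCol θ i a) : EuclideanSpace ℝ (Fin (D.m i)))‖ ≤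
        √(C a) := fun a => by
      refine Real.le_sqrt_of_sq_le ?_
      rw [D.norm_whiteCol_sq hθ]
      exact (le_abs_self _).trans (hC a i)
    rw [whiteZ, sum_apply]
    calc _ ≤ ∑ a, ‖e‖ * √(C a) := by
          refine (norm_sum_le _ _).trans (Finset.sum_le_sum fun a _ => ?_)
          rw [ContinuousLinearMap.smulRight_apply, norm_smul]
          gcongr
          · exact PiLp.norm_apply_le e (Sum.inl a)
          · exact hZ a
      _ = Kc * ‖e‖ := by rw [← Finset.mul_sum, mul_comm]
      _ ≤ K * ‖e‖ := by gcongr; linarith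
  · rw [whiteB_apply]
    refine isSymmetric_toEuclideanCLM ?_
    change IsSelfAdjoint (∑ j, varPart e j • D.whiteU θ i j)
    refine isSelfAdjoint_sum _ fun j _ => ?_
    exact IsSelfAdjoint.smul (IsSelfAdjoint.all (varPart e j)) (D.whiteU_posSemidef i j).1
  · exact D.eta_add_le hα hθ i (hball h hh) hc (hcdet i)
  · exact D.hasFDerivAt_eta_add hθ i (hparam h hh)

end Design


/-! ### Square roots of inverse matrices -/

section SqrtInv

variable {ι : Type*} [Fintype ι] [DecidableEq ι]

theorem dotProduct_self_eq_norm_sq (x : ι → ℝ) : x ⬝ᵥ x = ‖WithLp.toLp 2 x‖ ^ 2 := by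
  rw [EuclideanSpace.norm_sq_eq]
  simp [dotProduct, sq]

theorem posDef_of_forall_le {A : Matrix ι ι ℝ} (hA : A.IsHermitian) {c : ℝ} (hc : 0 < c)
    (h : ∀ x : ι → ℝ, c * (x ⬝ᵥ x) ≤ x ⬝ᵥ (A *ᵥ x)) : A.PosDef := by
  refine Matrix.PosDef.of_dotProduct_mulVec_pos hA fun x hx => ?_
  have h1 : 0 < x ⬝ᵥ x := by
    rw [dotProduct_self_eq_norm_sq]
    have : WithLp.toLp 2 x ≠ 0 := fun h0 => hx (by simpa using h0)
    positivity
  simpa using (mul_pos hc h1).trans_le (h x)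

theorem norm_toEuclideanCLM_inv_le {A : Matrix ι ι ℝ} (hA : A.IsHermitian) {c : ℝ} (hc : 0 < c)
    (h : ∀ x : ι → ℝ, c * (x ⬝ᵥ x) ≤ x ⬝ᵥ (A *ᵥ x)) (y : EuclideanSpace ℝ ι) :
    ‖Matrix.toEuclideanCLM (𝕜 := ℝ) A⁻¹ y‖ ≤ c⁻¹ * ‖y‖ := by
  have hu : IsUnit A.det := (posDef_of_forall_le hA hc h).det_pos.ne'.isUnit
  set x := Matrix.toEuclideanCLM (𝕜 := ℝ) A⁻¹ y with hx
  have hAx : Matrix.toEuclideanCLM (𝕜 := ℝ) A x = y := by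
    rw [hx, ← ContinuousLinearMap.comp_apply, ← ContinuousLinearMap.mul_def, ← map_mul,
      Matrix.mul_nonsing_inv _ hu, map_one, one_apply_eq_self]
  have h1 : c * ‖x‖ ^ 2 ≤ ‖x‖ * ‖y‖ := by
    have h2 := h x.ofLp
    rw [← Matrix.inner_toEuclideanCLM, hAx, dotProduct_self_eq_norm_sq] at h2
    exact h2.trans (real_inner_le_norm x y)
  rw [inv_mul_eq_div, le_div_iff₀ hc]
  rcases (norm_nonneg x).eq_or_lt with h0 | h0
  · rw [← h0, zero_mul]; positivity
  · nlinarith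

variable {O : Matrix ι ι ℝ}

theorem transpose_sqrt (A : Matrix ι ι ℝ) : (CFC.sqrt A)ᵀ = CFC.sqrt A := by
  simpa using (Matrix.nonneg_iff_posSemidef.1 (CFC.sqrt_nonneg A)).1.eq

theorem sqrt_inv_mul_self (hO : O.PosDef) : CFC.sqrt O⁻¹ * CFC.sqrt O⁻¹ = O⁻¹ :=
  CFC.sqrt_mul_sqrt_self _ (Matrix.nonneg_iff_posSemidef.2 hO.inv.posSemidef)

theorem sqrt_inv_mul_mul_sqrt_inv (hO : O.PosDef) :
    CFC.sqrt O⁻¹ * O * CFC.sqrt O⁻¹ = 1 := by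
  rw [mul_assoc]
  refine mul_eq_one_comm.1 ?_
  rw [mul_assoc, sqrt_inv_mul_self hO, Matrix.mul_nonsing_inv _ hO.det_pos.ne'.isUnit]

theorem isUnit_det_sqrt_inv (hO : O.PosDef) : IsUnit (CFC.sqrt O⁻¹).det :=
  Matrix.isUnit_det_of_left_inverse (sqrt_inv_mul_mul_sqrt_inv hO)

theorem adjoint_toEuclideanCLM_of_transpose {A : Matrix ι ι ℝ} (hA : Aᵀ = A) :
    ContinuousLinearMap.adjoint (Matrix.toEuclideanCLM (𝕜 := ℝ) A) =
      Matrix.toEuclideanCLM (𝕜 := ℝ) A := by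
  rw [← ContinuousLinearMap.star_eq_adjoint, ← map_star, Matrix.star_eq_conjTranspose]
  simp [hA]

theorem norm_sq_toEuclideanCLM {A : Matrix ι ι ℝ} (hA : Aᵀ = A) (x : EuclideanSpace ℝ ι) :
    ‖Matrix.toEuclideanCLM (𝕜 := ℝ) A x‖ ^ 2 =
      inner ℝ x (Matrix.toEuclideanCLM (𝕜 := ℝ) (A * A) x) := by
  rw [← real_inner_self_eq_norm_sq, ← ContinuousLinearMap.adjoint_inner_right,
    adjoint_toEuclideanCLM_of_transpose hA, map_mul]
  rfl

theorem norm_toEuclideanCLM_sqrt_inv_le (hO : O.IsHermitian) {c : ℝ} (hc : 0 < c)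
    (h : ∀ x : ι → ℝ, c * (x ⬝ᵥ x) ≤ x ⬝ᵥ (O *ᵥ x)) :
    ‖Matrix.toEuclideanCLM (𝕜 := ℝ) (CFC.sqrt O⁻¹)‖ ≤ √c⁻¹ := by
  refine ContinuousLinearMap.opNorm_le_bound _ (Real.sqrt_nonneg _) fun x => ?_
  refine (pow_le_pow_iff_left₀ (norm_nonneg _) (by positivity) two_ne_zero).1 ?_
  rw [norm_sq_toEuclideanCLM (transpose_sqrt _), sqrt_inv_mul_self (posDef_of_forall_le hO hc h),
    mul_pow, Real.sq_sqrt (by positivity)]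
  calc _ ≤ ‖x‖ * ‖Matrix.toEuclideanCLM (𝕜 := ℝ) O⁻¹ x‖ := real_inner_le_norm _ _
    _ ≤ ‖x‖ * (c⁻¹ * ‖x‖) := by gcongr; exact norm_toEuclideanCLM_inv_le hO hc h x
    _ = _ := by ring

theorem norm_toEuclideanCLM_sqrt_inv_mul_inv_le (hO : O.PosDef) {C : ℝ} (hC : 0 ≤ C)
    (hOC : ∀ x : ι → ℝ, x ⬝ᵥ (O *ᵥ x) ≤ C * (x ⬝ᵥ x)) {P : Matrix ι ι ℝ} (hP : P.IsHermitian)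
    {c : ℝ} (hc : 0 < c) (h : ∀ x : ι → ℝ, c * (x ⬝ᵥ x) ≤ x ⬝ᵥ (P *ᵥ x)) :
    ‖Matrix.toEuclideanCLM (𝕜 := ℝ) (CFC.sqrt O⁻¹ * P)⁻¹‖ ≤ c⁻¹ * √C := by
  refine ContinuousLinearMap.opNorm_le_bound _ (by positivity) fun x => ?_
  rw [Matrix.mul_inv_rev, map_mul, mul_assoc]
  refine (norm_toEuclideanCLM_inv_le hP hc h _).trans ?_
  gcongr
  have hT : ((CFC.sqrt O⁻¹)⁻¹)ᵀ = (CFC.sqrt O⁻¹)⁻¹ := by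
    rw [Matrix.transpose_nonsing_inv, transpose_sqrt]
  refine (pow_le_pow_iff_left₀ (norm_nonneg _) (by positivity) two_ne_zero).1 ?_
  change ‖Matrix.toEuclideanCLM (𝕜 := ℝ) (CFC.sqrt O⁻¹)⁻¹ x‖ ^ 2 ≤ _
  rw [norm_sq_toEuclideanCLM hT, ← Matrix.mul_inv_rev, sqrt_inv_mul_self hO,
    Matrix.nonsing_inv_nonsing_inv _ hO.det_pos.ne'.isUnit, Matrix.inner_toEuclideanCLM, mul_pow,
    Real.sq_sqrt hC]
  exact (hOC _).trans (le_of_eq (by rw [dotProduct_self_eq_norm_sq]))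

/-- The inverse square root scales like `c ^ (-1/2)`. -/
theorem sqrt_inv_smul (hO : O.PosDef) {c : ℝ} (hc : 0 < c) :
    CFC.sqrt (c • O)⁻¹ = (√c)⁻¹ • CFC.sqrt O⁻¹ := by
  have hinv : (c • O)⁻¹ = c⁻¹ • O⁻¹ := by
    refine Matrix.inv_eq_left_inv ?_
    rw [Matrix.smul_mul, Matrix.mul_smul, smul_smul, inv_mul_cancel₀ hc.ne', one_smul,
      Matrix.nonsing_inv_mul _ hO.det_pos.ne'.isUnit]
  refine CFC.sqrt_unique ?_ (smul_nonneg (by positivity) (CFC.sqrt_nonneg _))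
  rw [Matrix.smul_mul, Matrix.mul_smul, smul_smul, sqrt_inv_mul_self hO, hinv, ← mul_inv,
    Real.mul_self_sqrt hc.le]

variable {κ : Type*} [Fintype κ] [DecidableEq κ]

theorem dotProduct_fromBlocks_mulVec (A : Matrix ι ι ℝ) (B : Matrix κ κ ℝ) (v : ι ⊕ κ → ℝ) :
    v ⬝ᵥ (Matrix.fromBlocks A 0 0 B *ᵥ v) = (v ∘ Sum.inl) ⬝ᵥ (A *ᵥ (v ∘ Sum.inl)) +
      (v ∘ Sum.inr) ⬝ᵥ (B *ᵥ (v ∘ Sum.inr)) := by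
  rw [Matrix.fromBlocks_mulVec]
  simp [dotProduct, Fintype.sum_sum_type]

theorem posSemidef_fromBlocks {A : Matrix ι ι ℝ} {B : Matrix κ κ ℝ} (hA : A.PosSemidef)
    (hB : B.PosSemidef) : (Matrix.fromBlocks A 0 0 B).PosSemidef := by
  refine Matrix.PosSemidef.of_dotProduct_mulVec_nonneg ?_ fun v => ?_
  · rw [Matrix.IsHermitian, Matrix.fromBlocks_conjTranspose, hA.1.eq, hB.1.eq]
    simp
  · rw [star_trivial, dotProduct_fromBlocks_mulVec]
    exact add_nonneg (by simpa using hA.dotProduct_mulVec_nonneg (v ∘ Sum.inl))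
      (by simpa using hB.dotProduct_mulVec_nonneg (v ∘ Sum.inr))

theorem sqrt_inv_fromBlocks {A : Matrix ι ι ℝ} {B : Matrix κ κ ℝ} (hA : A.PosDef)
    (hB : B.PosDef) : CFC.sqrt (Matrix.fromBlocks A 0 0 B)⁻¹ =
      Matrix.fromBlocks (CFC.sqrt A⁻¹) 0 0 (CFC.sqrt B⁻¹) := by
  refine CFC.sqrt_unique ?_ ?_
  · rw [Matrix.fromBlocks_multiply]
    simp only [sqrt_inv_mul_self hA, sqrt_inv_mul_self hB]
    refine (Matrix.inv_eq_left_inv ?_).symm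
    rw [Matrix.fromBlocks_multiply]
    simp [Matrix.nonsing_inv_mul _ hA.det_pos.ne'.isUnit,
      Matrix.nonsing_inv_mul _ hB.det_pos.ne'.isUnit]
  · exact Matrix.nonneg_iff_posSemidef.2 (posSemidef_fromBlocks
      (Matrix.nonneg_iff_posSemidef.1 (CFC.sqrt_nonneg _))
      (Matrix.nonneg_iff_posSemidef.1 (CFC.sqrt_nonneg _)))

end SqrtInv

/-! ### The two parts of the parameter -/

section Parts

variable {k r : ℕ}

/-- The projection of the parameter to the fixed effects. -/
noncomputable def fixedPartCLM (k r : ℕ) : Param k r →L[ℝ] EuclideanSpace ℝ (Fin k) :=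
  LinearMap.toContinuousLinearMap
    { toFun := fixedPart
      map_add' := fun _ _ => rfl
      map_smul' := fun _ _ => rfl }

/-- The projection of the parameter to the variance components. -/
noncomputable def varPartCLM (k r : ℕ) : Param k r →L[ℝ] EuclideanSpace ℝ (Fin (r + 1)) :=
  LinearMap.toContinuousLinearMap
    { toFun := varPart
      map_add' := fun _ _ => rfl
      map_smul' := fun _ _ => rfl }

theorem fixedPartCLM_apply (h : Param k r) : fixedPartCLM k r h = fixedPart h := rfl

theorem varPartCLM_apply (h : Param k r) : varPartCLM k r h = varPart h := rfl

theorem adjoint_fixedPartCLM_add (t₁ : EuclideanSpace ℝ (Fin k))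
    (t₂ : EuclideanSpace ℝ (Fin (r + 1))) :
    ContinuousLinearMap.adjoint (fixedPartCLM k r) t₁ +
      ContinuousLinearMap.adjoint (varPartCLM k r) t₂ =
        (WithLp.toLp 2 (Sum.elim t₁ t₂) : Param k r) := by
  refine ext_inner_right ℝ fun v => ?_
  rw [inner_add_left, ContinuousLinearMap.adjoint_inner_left,
    ContinuousLinearMap.adjoint_inner_left, fixedPartCLM_apply, varPartCLM_apply]
  simp [PiLp.inner_apply, Fintype.sum_sum_type, fixedPart, varPart]

theorem norm_sq_adjoint_parts (t₁ : EuclideanSpace ℝ (Fin k))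
    (t₂ : EuclideanSpace ℝ (Fin (r + 1))) :
    ‖ContinuousLinearMap.adjoint (fixedPartCLM k r) t₁ +
      ContinuousLinearMap.adjoint (varPartCLM k r) t₂‖ ^ 2 = ‖t₁‖ ^ 2 + ‖t₂‖ ^ 2 := by
  rw [adjoint_fixedPartCLM_add, EuclideanSpace.norm_sq_eq, EuclideanSpace.norm_sq_eq,
    EuclideanSpace.norm_sq_eq]
  simp [Fintype.sum_sum_type]

theorem fixedPart_toEuclideanCLM_fromBlocks (A : Matrix (Fin k) (Fin k) ℝ)
    (B : Matrix (Fin (r + 1)) (Fin (r + 1)) ℝ) (h : Param k r) :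
    fixedPart (Matrix.toEuclideanCLM (𝕜 := ℝ) (Matrix.fromBlocks A 0 0 B) h) =
      Matrix.toEuclideanCLM (𝕜 := ℝ) A (fixedPart h) := by
  ext a
  simp [fixedPart, Matrix.ofLp_toEuclideanCLM, Matrix.fromBlocks_mulVec, Function.comp_def]

theorem varPart_toEuclideanCLM_fromBlocks (A : Matrix (Fin k) (Fin k) ℝ)
    (B : Matrix (Fin (r + 1)) (Fin (r + 1)) ℝ) (h : Param k r) :
    varPart (Matrix.toEuclideanCLM (𝕜 := ℝ) (Matrix.fromBlocks A 0 0 B) h) =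
      Matrix.toEuclideanCLM (𝕜 := ℝ) B (varPart h) := by
  ext a
  simp [varPart, Matrix.ofLp_toEuclideanCLM, Matrix.fromBlocks_mulVec, Function.comp_def]

end Parts


/-! ### The matrices `Ψ_n` and `Ω_n` -/

section Powers

theorem rpow_add_two_eq {x : ℝ} (hx : 0 < x) (y : ℝ) : x ^ (y + 2) = x ^ y * x ^ 2 := by
  rw [Real.rpow_add hx]; norm_num

theorem rpow_half_sq {x : ℝ} (hx : 0 < x) (y : ℝ) : (x ^ (y / 2)) ^ 2 = x ^ y := by
  rw [← Real.rpow_natCast, ← Real.rpow_mul hx.le]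
  congr 1
  push_cast
  ring

/-- A lower bound for the summands of `Ω_n`, where `z`, `s` and `w` stand for `‖Z v‖²`, `Tr (B v)`
and `Tr ((B v)²)`: the negative term is at most a fixed proportion, smaller than one, of the term
with `4 α² s²`. -/
theorem covariance_bracket_ge {α N z s w : ℝ} (hα : 0 ≤ α) (hN : 0 ≤ N) (hz : 0 ≤ z)
    (hw : 0 ≤ w) :
    (1 - (1 + 2 * α) ^ 2 / (4 * (1 + α) ^ 2)) / (1 + 2 * α) ^ (N / 2 + 2) *
      (4 * z + 4 * α ^ 2 * s ^ 2 + 2 * w) ≤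
    4 * z / (1 + 2 * α) ^ (N / 2 + 1) + (4 * α ^ 2 * s ^ 2 + 2 * w) / (1 + 2 * α) ^ (N / 2 + 2) -
      α ^ 2 * s ^ 2 / (1 + α) ^ (N + 2) := by
  have hb : 0 < 1 + 2 * α := by linarith
  have ha : 0 < 1 + α := by linarith
  rw [rpow_add_two_eq hb, rpow_add_two_eq ha, Real.rpow_add_one hb.ne', ← rpow_half_sq ha N]
  -- The powers with exponent `N` are comparable because `1 + 2 α ≤ (1 + α) ^ 2`.
  have hpq : (1 + 2 * α) ^ (N / 2) ≤ ((1 + α) ^ (N / 2)) ^ 2 := by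
    rw [← Real.rpow_natCast, ← Real.rpow_mul ha.le, mul_comm (N / 2), Real.rpow_mul ha.le]
    refine Real.rpow_le_rpow hb.le ?_ (by positivity)
    push_cast
    norm_num
    nlinarith
  have hp : 0 < (1 + 2 * α) ^ (N / 2) := Real.rpow_pos_of_pos hb _
  generalize (1 + 2 * α) ^ (N / 2) = p at *
  generalize ((1 + α) ^ (N / 2)) ^ 2 = q at *
  set b := 1 + 2 * α with hbdef
  have h1b : 1 ≤ b := by linarith
  set κ := b ^ 2 / (4 * (1 + α) ^ 2) with hκ
  have hκ0 : 0 ≤ κ := by positivity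
  have t1 : 4 * z / (p * b ^ 2) ≤ 4 * z / (p * b) := by
    gcongr
    nlinarith
  have t2 : α ^ 2 * s ^ 2 / (q * (1 + α) ^ 2) ≤ κ * (4 * α ^ 2 * s ^ 2 / (p * b ^ 2)) := by
    have e : κ * (4 * α ^ 2 * s ^ 2 / (p * b ^ 2)) = α ^ 2 * s ^ 2 / (p * (1 + α) ^ 2) := by
      rw [hκ]; field_simp
    rw [e]
    gcongr
  have t3 : 0 ≤ κ * (4 * z / (p * b ^ 2)) := by positivity
  have t4 : 0 ≤ κ * (2 * w / (p * b ^ 2)) := by positivity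
  have e1 : (1 - κ) / (p * b ^ 2) * (4 * z + 4 * α ^ 2 * s ^ 2 + 2 * w) =
      4 * z / (p * b ^ 2) + 4 * α ^ 2 * s ^ 2 / (p * b ^ 2) + 2 * w / (p * b ^ 2) -
        κ * (4 * z / (p * b ^ 2)) - κ * (4 * α ^ 2 * s ^ 2 / (p * b ^ 2)) -
        κ * (2 * w / (p * b ^ 2)) := by ring
  have e2 : (4 * α ^ 2 * s ^ 2 + 2 * w) / (p * b ^ 2) =
      4 * α ^ 2 * s ^ 2 / (p * b ^ 2) + 2 * w / (p * b ^ 2) := by ring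
  rw [e1, e2]
  linarith

theorem proportion_lt_one {α : ℝ} (hα : 0 ≤ α) : (1 + 2 * α) ^ 2 / (4 * (1 + α) ^ 2) < 1 := by
  rw [div_lt_one (by positivity)]
  nlinarith

end Powers

namespace WhiteGroup

variable {E V : Type*} [NormedAddCommGroup E] [NormedSpace ℝ E] [NormedAddCommGroup V]
  [InnerProductSpace ℝ V] [FiniteDimensional ℝ V] {B : E →L[ℝ] V →L[ℝ] V} {Z : E →L[ℝ] V}
  {α : ℝ} {η : E → ℝ} {K δ Mη : ℝ}

theorem trace_sq_nonneg (W : WhiteGroup B Z α η K δ Mη) (e : E) : 0 ≤ trace (B e * B e) := by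
  rw [trace_eq_sum]
  refine Finset.sum_nonneg fun i _ => ?_
  have h : ∀ a b, inner ℝ (B e a) b = inner ℝ a (B e b) := W.symm e
  have e1 : (B e * B e) (stdOrthonormalBasis ℝ V i) = B e (B e (stdOrthonormalBasis ℝ V i)) := rfl
  rw [e1, ← h, real_inner_self_eq_norm_sq]
  positivity

theorem trace_sq_le (W : WhiteGroup B Z α η K δ Mη) (e : E) :
    trace (B e * B e) ≤ Module.finrank ℝ V * (K * ‖e‖) ^ 2 := by
  refine (le_abs_self _).trans ((abs_trace_le _).trans ?_)
  gcongr
  have := W.K_one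
  calc _ ≤ ‖B e‖ * ‖B e‖ := norm_mul_le _ _
    _ ≤ (K * ‖e‖) * (K * ‖e‖) := by gcongr <;> exact W.normB e
    _ = _ := (sq _).symm

theorem sq_trace_le (W : WhiteGroup B Z α η K δ Mη) (e : E) :
    trace (B e) ^ 2 ≤ (Module.finrank ℝ V * (K * ‖e‖)) ^ 2 := by
  rw [← sq_abs]
  gcongr
  exact (abs_trace_le _).trans (by gcongr; exact W.normB e)

end WhiteGroup

namespace Design

variable {k r : ℕ} (D : Design k r) {α : ℝ} {θ : Param k r}

theorem trace_VU (hθ : θ ∈ paramSpace k r) (i : ℕ) (j : Fin (r + 1)) :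
    (D.VU θ i j).trace = (D.whiteU θ i j).trace := by
  rw [VU, ← D.whitener_mul_self hθ, whiteU, mul_assoc, Matrix.trace_mul_comm]

theorem trace_VU_mul_VU (hθ : θ ∈ paramSpace k r) (i : ℕ) (j l : Fin (r + 1)) :
    (D.VU θ i j * D.VU θ i l).trace = (D.whiteU θ i j * D.whiteU θ i l).trace := by
  rw [VU, VU, ← D.whitener_mul_self hθ, whiteU, whiteU]
  simp only [mul_assoc]
  rw [Matrix.trace_mul_comm]
  simp only [mul_assoc]

theorem trace_whiteB (hθ : θ ∈ paramSpace k r) (i : ℕ) (v : Param k r) :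
    trace (D.whiteB θ i v) = ∑ j, varPart v j * (D.VU θ i j).trace := by
  rw [whiteB_apply, trace_toEuclideanCLM, Matrix.trace_sum]
  simp [D.trace_VU hθ]

theorem trace_whiteB_mul (hθ : θ ∈ paramSpace k r) (i : ℕ) (v : Param k r) :
    trace (D.whiteB θ i v * D.whiteB θ i v) =
      ∑ j, ∑ l, varPart v j * varPart v l * (D.VU θ i j * D.VU θ i l).trace := by
  rw [whiteB_apply, ← map_mul, trace_toEuclideanCLM, Matrix.sum_mul, Matrix.trace_sum]
  refine Finset.sum_congr rfl fun j _ => ?_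
  rw [Matrix.mul_sum, Matrix.trace_sum]
  refine Finset.sum_congr rfl fun l _ => ?_
  rw [D.trace_VU_mul_VU hθ, Matrix.smul_mul, Matrix.mul_smul, Matrix.trace_smul,
    Matrix.trace_smul, smul_eq_mul, smul_eq_mul, mul_assoc]

theorem dotProduct_gram (hθ : θ ∈ paramSpace k r) (i : ℕ) (v : Param k r) :
    (fixedPart v).ofLp ⬝ᵥ (((D.X i)ᵀ * (D.V θ i)⁻¹ * D.X i) *ᵥ (fixedPart v).ofLp) =
      ‖D.whiteZ θ i v‖ ^ 2 := by
  rw [whiteZ_apply, ← dotProduct_self_eq_norm_sq, ← mulVec_dotProduct_whitener,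
    ← D.whitener_mul_self hθ, ← Matrix.mulVec_mulVec, ← Matrix.mulVec_mulVec,
    ← Matrix.mulVec_mulVec, Matrix.dotProduct_mulVec, Matrix.vecMul_transpose]

theorem dotProduct_T (hθ : θ ∈ paramSpace k r) (i : ℕ) (c : ℝ) (v : Param k r) :
    ∑ j, ∑ l, varPart v j * varPart v l * T α c (D.VU θ i j) (D.VU θ i l) =
      c * α ^ 2 * trace (D.whiteB θ i v) ^ 2 + 2 * trace (D.whiteB θ i v * D.whiteB θ i v) := by
  rw [D.trace_whiteB hθ, D.trace_whiteB_mul hθ, sq (∑ j, _), Finset.sum_mul_sum, Finset.mul_sum,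
    Finset.mul_sum, ← Finset.sum_add_distrib]
  refine Finset.sum_congr rfl fun j _ => ?_
  rw [Finset.mul_sum, Finset.mul_sum, ← Finset.sum_add_distrib]
  refine Finset.sum_congr rfl fun l _ => ?_
  rw [T]
  ring

/-- The quadratic form of the `i`-th summand of `Ψ_n`. -/
noncomputable def psiForm (α : ℝ) (θ : Param k r) (i : ℕ) (v : Param k r) : ℝ :=
  D.eta α θ i / 4 * (4 * ‖D.whiteZ θ i v‖ ^ 2 / (1 + α) ^ ((D.m i : ℝ) / 2 + 1) +
    (α ^ 2 * trace (D.whiteB θ i v) ^ 2 + 2 * trace (D.whiteB θ i v * D.whiteB θ i v)) /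
      (1 + α) ^ ((D.m i : ℝ) / 2 + 2))

/-- The quadratic form of the `i`-th summand of `Ω_n`. -/
noncomputable def omForm (α : ℝ) (θ : Param k r) (i : ℕ) (v : Param k r) : ℝ :=
  D.eta α θ i ^ 2 / 4 * (4 * ‖D.whiteZ θ i v‖ ^ 2 / (1 + 2 * α) ^ ((D.m i : ℝ) / 2 + 1) +
    (4 * α ^ 2 * trace (D.whiteB θ i v) ^ 2 + 2 * trace (D.whiteB θ i v * D.whiteB θ i v)) /
      (1 + 2 * α) ^ ((D.m i : ℝ) / 2 + 2) -
    α ^ 2 * trace (D.whiteB θ i v) ^ 2 / (1 + α) ^ ((D.m i : ℝ) + 2))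

theorem dotProduct_average {ι : Type*} [Fintype ι] (n : ℕ) (M : ℕ → Matrix ι ι ℝ) (v : ι → ℝ) :
    v ⬝ᵥ (((1 / n : ℝ) • ∑ i ∈ Finset.range n, M i) *ᵥ v) =
      (1 / n : ℝ) * ∑ i ∈ Finset.range n, v ⬝ᵥ (M i *ᵥ v) := by
  rw [Matrix.smul_mulVec, dotProduct_smul, Matrix.sum_mulVec, dotProduct_sum, smul_eq_mul]

theorem dotProduct_Psi (hθ : θ ∈ paramSpace k r) (n : ℕ) (v : Param k r) :
    v.ofLp ⬝ᵥ (D.Psi α θ n *ᵥ v.ofLp) = (1 / n : ℝ) * ∑ i ∈ Finset.range n, D.psiForm α θ i v := by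
  rw [Psi, dotProduct_average]
  congr 1
  refine Finset.sum_congr rfl fun i _ => ?_
  rw [Matrix.smul_mulVec, dotProduct_smul, dotProduct_fromBlocks_mulVec, psiForm, smul_eq_mul]
  congr 2
  · rw [J11, Matrix.smul_mulVec, dotProduct_smul]
    have := D.dotProduct_gram hθ i v
    have e : v.ofLp ∘ Sum.inl = (fixedPart v).ofLp := rfl
    rw [e, this, smul_eq_mul]
    ring
  · have := D.dotProduct_T (α := α) hθ i 1 v
    rw [one_mul] at this
    rw [← this, Finset.sum_div]
    simp only [dotProduct, Matrix.mulVec, Finset.mul_sum, Finset.sum_div]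
    refine Finset.sum_congr rfl fun j _ => Finset.sum_congr rfl fun l _ => ?_
    simp only [J22, Matrix.of_apply, Function.comp_apply, varPart]
    ring

theorem dotProduct_Omega (hθ : θ ∈ paramSpace k r) (n : ℕ) (v : Param k r) :
    v.ofLp ⬝ᵥ (D.Omega α θ n *ᵥ v.ofLp) =
      (1 / n : ℝ) * ∑ i ∈ Finset.range n, D.omForm α θ i v := by
  rw [Omega, dotProduct_average]
  congr 1
  refine Finset.sum_congr rfl fun i _ => ?_
  rw [Matrix.smul_mulVec, dotProduct_smul, dotProduct_fromBlocks_mulVec, omForm, smul_eq_mul,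
    add_sub_assoc]
  congr 2
  · rw [Om11, Matrix.smul_mulVec, dotProduct_smul]
    have := D.dotProduct_gram hθ i v
    have e : v.ofLp ∘ Sum.inl = (fixedPart v).ofLp := rfl
    rw [e, this, smul_eq_mul]
    ring
  · rw [← D.dotProduct_T hθ i 4 v, D.trace_whiteB hθ, sq (∑ j, _), Finset.sum_mul_sum,
      Finset.mul_sum, Finset.sum_div, Finset.sum_div, ← Finset.sum_sub_distrib]
    simp only [dotProduct, Matrix.mulVec, Finset.mul_sum, Finset.sum_div]
    refine Finset.sum_congr rfl fun j _ => ?_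
    rw [← Finset.sum_sub_distrib]
    refine Finset.sum_congr rfl fun l _ => ?_
    simp only [Om22, Matrix.of_apply, Function.comp_apply, varPart]
    ring

/-- The expected derivatives of the estimating functions are the entries of `(1 + α) Ψ_n`. -/
theorem toEuclideanCLM_Psi_apply (hα : 0 ≤ α) (hθ : θ ∈ paramSpace k r) {K δ Mη : ℝ}
    (hW : ∀ i, WhiteGroup (D.whiteB θ i) (D.whiteZ θ i) α (fun h => D.eta α (θ + h) i) K δ Mη)
    (n : ℕ) (a b : Fin k ⊕ Fin (r + 1)) :
    Matrix.toEuclideanCLM (𝕜 := ℝ) ((1 + α) • D.Psi α θ n) (EuclideanSpace.single b 1) a =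
      (1 / n : ℝ) * ∑ i ∈ Finset.range n,
        ∫ x, estDeriv (D.whiteB θ i) (D.whiteZ θ i) x α (D.eta α (θ + 0) i)
          (EuclideanSpace.single a 1) (EuclideanSpace.single b 1) ∂(stdGaussian _) := by
  have e1 : Matrix.toEuclideanCLM (𝕜 := ℝ) ((1 + α) • D.Psi α θ n) (EuclideanSpace.single b 1) a =
      ((1 + α) • D.Psi α θ n) a b := by
    simp [Matrix.ofLp_toEuclideanCLM]
  have ha : 0 < 1 + α := by linarith
  rw [e1, Psi, Matrix.smul_apply, Matrix.smul_apply, Matrix.sum_apply, smul_eq_mul, smul_eq_mul,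
    mul_left_comm, Finset.mul_sum]
  congr 1
  refine Finset.sum_congr rfl fun i _ => ?_
  rw [(hW i).integral_estDeriv, finrank_euclideanSpace_fin, add_zero, Real.rpow_neg ha.le,
    Matrix.smul_apply, smul_eq_mul]
  have hp : 0 < (1 + α) ^ ((D.m i : ℝ) / 2) := Real.rpow_pos_of_pos ha _
  rcases a with a | a <;> rcases b with b | b
  · rw [whiteB_single_inl, whiteB_single_inl, whiteZ_single_inl, whiteZ_single_inl,
      Matrix.fromBlocks_apply₁₁, J11, Matrix.smul_apply, Real.rpow_add_one ha.ne']
    have e2 : inner ℝ (WithLp.toLp 2 (D.whiteCol θ i a) : EuclideanSpace ℝ (Fin (D.m i)))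
        (WithLp.toLp 2 (D.whiteCol θ i b)) = ((D.X i)ᵀ * (D.V θ i)⁻¹ * D.X i) a b := by
      have h1 : ((D.X i)ᵀ * (D.V θ i)⁻¹ * D.X i) a b =
          (fun s => D.X i s a) ⬝ᵥ ((D.V θ i)⁻¹ *ᵥ fun s => D.X i s b) := by
        rw [show (D.X i)ᵀ * (D.V θ i)⁻¹ * D.X i = (D.X i)ᵀ * ((D.V θ i)⁻¹ * D.X i) from
          Matrix.mul_assoc _ _ _]
        simp [Matrix.mul_apply, dotProduct, Matrix.mulVec]
      rw [h1, ← D.whitener_mul_self hθ, ← Matrix.mulVec_mulVec, mulVec_dotProduct_whitener,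
        EuclideanSpace.inner_toLp_toLp, star_trivial, dotProduct_comm]
      rfl
    rw [e2]
    simp only [trace, smul_eq_mul]
    simp
    field_simp
  · rw [whiteB_single_inl, whiteB_single_inr, whiteZ_single_inl, whiteZ_single_inr,
      Matrix.fromBlocks_apply₁₂]
    simp [trace]
  · rw [whiteB_single_inl, whiteB_single_inr, whiteZ_single_inl, whiteZ_single_inr,
      Matrix.fromBlocks_apply₂₁]
    simp [trace]
  · rw [whiteB_single_inr, whiteB_single_inr, whiteZ_single_inr, whiteZ_single_inr,
      Matrix.fromBlocks_apply₂₂, ← map_mul, trace_toEuclideanCLM, trace_toEuclideanCLM,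
      trace_toEuclideanCLM, inner_zero_left, J22, Matrix.of_apply, rpow_add_two_eq ha, T,
      D.trace_VU hθ, D.trace_VU hθ, D.trace_VU_mul_VU hθ]
    field_simp
    ring

/-- The variances of the estimating functions are `(1 + α)²` times the quadratic form of `Ω_n`. -/
theorem integral_estFun_sq (hα : 0 ≤ α) {K δ Mη : ℝ} (i : ℕ)
    (hW : WhiteGroup (D.whiteB θ i) (D.whiteZ θ i) α (fun h => D.eta α (θ + h) i) K δ Mη)
    (t : Param k r) :
    ∫ x, estFun (D.whiteB θ i) (D.whiteZ θ i) x α (fun h => D.eta α (θ + h) i) t 0 ^ 2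
      ∂(stdGaussian _) = (1 + α) ^ 2 * D.omForm α θ i t := by
  have ha : 0 < 1 + α := by linarith
  have hb : 0 < 1 + 2 * α := by linarith
  have h := hW.integral_estFun_mul t t
  simp_rw [← sq] at h
  rw [h, finrank_euclideanSpace_fin, add_zero, omForm, real_inner_self_eq_norm_sq,
    Real.rpow_neg ha.le, Real.rpow_neg hb.le, rpow_add_two_eq ha, rpow_add_two_eq hb,
    Real.rpow_add_one hb.ne', inv_pow ((1 + α) ^ ((D.m i : ℝ) / 2)), rpow_half_sq ha]
  have hp : 0 < (1 + α) ^ (D.m i : ℝ) := Real.rpow_pos_of_pos ha _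
  have hq : 0 < (1 + 2 * α) ^ ((D.m i : ℝ) / 2) := Real.rpow_pos_of_pos hb _
  generalize (1 + α) ^ (D.m i : ℝ) = p at *
  generalize (1 + 2 * α) ^ ((D.m i : ℝ) / 2) = q at *
  have e : 1 - (1 + 2 * α)⁻¹ = 2 * α / (1 + 2 * α) := by field_simp; ring
  rw [e]
  simp only [sq (D.whiteB θ i t)]
  field_simp
  ring

end Design


/-! ### Bounds for the eigenvalues of `Ψ_n` and `Ω_n` -/

theorem AvgBounded.exists_sum_le {f : ℕ → ℝ} (h : Design.AvgBounded f) :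
    ∃ C : ℝ, ∀ n : ℕ, ∑ i ∈ Finset.range n, f i ≤ C * n := by
  obtain ⟨C, hC⟩ := (isBigO_nat_atTop_iff fun x hx => absurd hx one_ne_zero).1 h
  refine ⟨C, fun n => ?_⟩
  rcases n.eq_zero_or_pos with rfl | hn
  · simp
  have hn' : (0 : ℝ) < n := by exact_mod_cast hn
  have h1 := (le_abs_self _).trans (hC n)
  rw [norm_one, mul_one, one_div, inv_mul_le_iff₀ hn'] at h1
  linarith

namespace Design

variable {k r : ℕ} (D : Design k r) {α : ℝ} {θ : Param k r}

theorem sum_varPart_mul_trace_VU (hθ : θ ∈ paramSpace k r) (i : ℕ) :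
    ∑ j, varPart θ j * (D.VU θ i j).trace = D.m i := by
  have := congrArg Matrix.trace (D.sum_smul_whiteU hθ i)
  simpa [Matrix.trace_sum, D.trace_VU hθ] using this

/-- Since `n_i` is a combination of the traces of the `V_i⁻¹ U_{ij}`, the third moments of the group
sizes are bounded. -/
theorem exists_sum_size_le (hθ : θ ∈ paramSpace k r)
    (h : ∀ j l p, AvgBounded fun i =>
      (D.VU θ i j).trace * (D.VU θ i l).trace * (D.VU θ i p).trace) :
    ∃ C : ℝ, ∀ n : ℕ, ∑ i ∈ Finset.range n, (1 + D.m i : ℝ) ^ 3 ≤ C * n := by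
  choose C hC using fun j l p => AvgBounded.exists_sum_le (h j l p)
  refine ⟨4 * (1 + ∑ j, ∑ l, ∑ p, varPart θ j * varPart θ l * varPart θ p * C j l p),
    fun n => ?_⟩
  have e : ∀ i, (D.m i : ℝ) ^ 3 = ∑ j, ∑ l, ∑ p, varPart θ j * varPart θ l * varPart θ p *
      ((D.VU θ i j).trace * (D.VU θ i l).trace * (D.VU θ i p).trace) := fun i => by
    rw [← D.sum_varPart_mul_trace_VU hθ i, pow_succ, sq, Finset.sum_mul_sum, Finset.sum_mul]
    refine Finset.sum_congr rfl fun j _ => ?_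
    rw [Finset.sum_mul_sum]
    refine Finset.sum_congr rfl fun l _ => Finset.sum_congr rfl fun p _ => ?_
    ring
  have h3 : ∑ i ∈ Finset.range n, (D.m i : ℝ) ^ 3 ≤
      (∑ j, ∑ l, ∑ p, varPart θ j * varPart θ l * varPart θ p * C j l p) * n := by
    simp_rw [e]
    rw [Finset.sum_comm, Finset.sum_mul]
    refine Finset.sum_le_sum fun j _ => ?_
    rw [Finset.sum_comm, Finset.sum_mul]
    refine Finset.sum_le_sum fun l _ => ?_
    rw [Finset.sum_comm, Finset.sum_mul]
    refine Finset.sum_le_sum fun p _ => ?_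
    rw [← Finset.mul_sum, mul_assoc (_ * _ * _) (C j l p)]
    have := hθ j
    have := hθ l
    have := hθ p
    gcongr
    exact hC j l p n
  calc ∑ i ∈ Finset.range n, (1 + D.m i : ℝ) ^ 3
      ≤ ∑ i ∈ Finset.range n, 4 * (1 + (D.m i : ℝ) ^ 3) := by
        refine Finset.sum_le_sum fun i _ => ?_
        have hm : (0 : ℝ) ≤ D.m i := Nat.cast_nonneg _
        nlinarith [mul_nonneg (by linarith : (0 : ℝ) ≤ 1 + D.m i) (sq_nonneg ((D.m i : ℝ) - 1))]
    _ = 4 * (n + ∑ i ∈ Finset.range n, (D.m i : ℝ) ^ 3) := by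
        rw [← Finset.mul_sum, Finset.sum_add_distrib]
        simp
    _ ≤ _ := by linarith

section Forms

variable {K δ Mη : ℝ} (hθ : θ ∈ paramSpace k r)
  (hW : ∀ i, WhiteGroup (D.whiteB θ i) (D.whiteZ θ i) α (fun h => D.eta α (θ + h) i) K δ Mη)

include hW

theorem eta_le (i : ℕ) : D.eta α θ i ≤ Mη := by
  simpa using (hW i).η_le 0 (Metric.mem_closedBall_self (hW i).δ_pos.le)

include hθ

/-- The bound for the quadratic forms of the `i`-th group; `c` is `1` for `Ψ_n` and `4` for `Ω_n`.
-/
theorem whiteForm_le (i : ℕ) (v : Param k r) {c : ℝ} (hc : c ≤ 4) :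
    4 * ‖D.whiteZ θ i v‖ ^ 2 + (c * α ^ 2 * trace (D.whiteB θ i v) ^ 2 +
      2 * trace (D.whiteB θ i v * D.whiteB θ i v)) ≤
    4 * (K ^ 2 * (1 + α ^ 2) * (1 + D.m i) ^ 2 * ‖v‖ ^ 2) := by
  have h1 : ‖D.whiteZ θ i v‖ ^ 2 ≤ (K * ‖v‖) ^ 2 := by gcongr; exact (hW i).normZ v
  have h2 := (hW i).trace_sq_le v
  have h3 := (hW i).sq_trace_le v
  rw [finrank_euclideanSpace_fin] at h2 h3
  have hm : (0 : ℝ) ≤ D.m i := Nat.cast_nonneg _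
  set x := (K * ‖v‖) ^ 2 with hx
  have hx0 : 0 ≤ x := sq_nonneg _
  have h4 : c * α ^ 2 * trace (D.whiteB θ i v) ^ 2 ≤ 4 * α ^ 2 * ((D.m i) ^ 2 * x) := by
    rw [mul_pow] at h3
    gcongr
  have e : K ^ 2 * (1 + α ^ 2) * (1 + (D.m i : ℝ)) ^ 2 * ‖v‖ ^ 2 =
      (1 + α ^ 2) * (1 + (D.m i : ℝ)) ^ 2 * x := by rw [hx]; ring
  rw [e]
  have h5 : 0 ≤ α ^ 2 * x := by positivity
  have h6 : 0 ≤ α ^ 2 * x * D.m i := by positivity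
  have h7 : 0 ≤ x * (D.m i) ^ 2 := by positivity
  have h8 : 0 ≤ D.m i * x := by positivity
  nlinarith

theorem psiForm_le (hα : 0 ≤ α) (i : ℕ) (v : Param k r) :
    D.psiForm α θ i v ≤ D.eta α θ i / 4 * (4 * ‖D.whiteZ θ i v‖ ^ 2 +
      (α ^ 2 * trace (D.whiteB θ i v) ^ 2 + 2 * trace (D.whiteB θ i v * D.whiteB θ i v))) := by
  have h0 := (hW i).trace_sq_nonneg v
  have hη := D.eta_nonneg (α := α) hθ i
  have hm : (0 : ℝ) ≤ D.m i := Nat.cast_nonneg _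
  rw [psiForm]
  gcongr
  · exact div_le_self (by positivity) (Real.one_le_rpow (by linarith) (by positivity))
  · exact div_le_self (by positivity) (Real.one_le_rpow (by linarith) (by positivity))

theorem psiForm_le_size (hα : 0 ≤ α) (i : ℕ) (v : Param k r) :
    D.psiForm α θ i v ≤ Mη * (K ^ 2 * (1 + α ^ 2) * (1 + D.m i) ^ 2 * ‖v‖ ^ 2) := by
  have h := D.whiteForm_le hθ hW i v (c := 1) (by norm_num)
  have h0 := (hW i).trace_sq_nonneg v
  have hη := D.eta_nonneg (α := α) hθ i
  rw [one_mul] at h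
  calc _ ≤ _ := D.psiForm_le hθ hW hα i v
    _ ≤ Mη / 4 * (4 * (K ^ 2 * (1 + α ^ 2) * (1 + D.m i) ^ 2 * ‖v‖ ^ 2)) := by
        have hM := hη.trans (D.eta_le hW i)
        gcongr
        exact D.eta_le hW i
    _ = _ := by ring

theorem omForm_le_size (hα : 0 ≤ α) (i : ℕ) (v : Param k r) :
    D.omForm α θ i v ≤ Mη ^ 2 * (K ^ 2 * (1 + α ^ 2) * (1 + D.m i) ^ 2 * ‖v‖ ^ 2) := by
  have h := D.whiteForm_le hθ hW i v (c := 4) le_rfl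
  have h0 := (hW i).trace_sq_nonneg v
  have hη := D.eta_nonneg (α := α) hθ i
  have hm : (0 : ℝ) ≤ D.m i := Nat.cast_nonneg _
  have h1 : 0 ≤ α ^ 2 * trace (D.whiteB θ i v) ^ 2 / (1 + α) ^ ((D.m i : ℝ) + 2) := by positivity
  calc D.omForm α θ i v ≤ D.eta α θ i ^ 2 / 4 * (4 * ‖D.whiteZ θ i v‖ ^ 2 +
      (4 * α ^ 2 * trace (D.whiteB θ i v) ^ 2 +
        2 * trace (D.whiteB θ i v * D.whiteB θ i v))) := by
        rw [omForm]
        gcongr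
        refine (sub_le_self _ h1).trans (add_le_add ?_ ?_)
        · exact div_le_self (by positivity) (Real.one_le_rpow (by linarith) (by positivity))
        · exact div_le_self (by positivity) (Real.one_le_rpow (by linarith) (by positivity))
    _ ≤ Mη ^ 2 / 4 * (4 * (K ^ 2 * (1 + α ^ 2) * (1 + D.m i) ^ 2 * ‖v‖ ^ 2)) := by
        gcongr
        exact D.eta_le hW i
    _ = _ := by ring

/-- The form of `Ω_n` dominates that of `Ψ_n` with a factor that deteriorates with the group size.
-/
theorem omForm_ge (hα : 0 ≤ α) (i : ℕ) (v : Param k r) :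
    D.eta α θ i * ((1 - (1 + 2 * α) ^ 2 / (4 * (1 + α) ^ 2)) /
      (1 + 2 * α) ^ ((D.m i : ℝ) / 2 + 2)) * D.psiForm α θ i v ≤ D.omForm α θ i v := by
  have h0 := (hW i).trace_sq_nonneg v
  have hη := D.eta_nonneg (α := α) hθ i
  have hκ := sub_nonneg.2 (proportion_lt_one hα).le
  have h := covariance_bracket_ge hα (Nat.cast_nonneg (D.m i)) (sq_nonneg ‖D.whiteZ θ i v‖) h0
    (s := trace (D.whiteB θ i v))
  set ρ := (1 - (1 + 2 * α) ^ 2 / (4 * (1 + α) ^ 2)) / (1 + 2 * α) ^ ((D.m i : ℝ) / 2 + 2) with hρ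
  have hρ0 : 0 ≤ ρ := by positivity
  calc _ ≤ D.eta α θ i * ρ * (D.eta α θ i / 4 * (4 * ‖D.whiteZ θ i v‖ ^ 2 +
      (α ^ 2 * trace (D.whiteB θ i v) ^ 2 + 2 * trace (D.whiteB θ i v * D.whiteB θ i v)))) := by
        gcongr
        exact D.psiForm_le hθ hW hα i v
    _ ≤ D.eta α θ i ^ 2 / 4 * (ρ * (4 * ‖D.whiteZ θ i v‖ ^ 2 +
        4 * α ^ 2 * trace (D.whiteB θ i v) ^ 2 +
          2 * trace (D.whiteB θ i v * D.whiteB θ i v))) := by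
        have h1 : 0 ≤ α ^ 2 * trace (D.whiteB θ i v) ^ 2 := by positivity
        have h2 : D.eta α θ i * ρ * (D.eta α θ i / 4 * (4 * ‖D.whiteZ θ i v‖ ^ 2 +
          (α ^ 2 * trace (D.whiteB θ i v) ^ 2 + 2 * trace (D.whiteB θ i v * D.whiteB θ i v)))) =
          D.eta α θ i ^ 2 / 4 * (ρ * (4 * ‖D.whiteZ θ i v‖ ^ 2 +
            (α ^ 2 * trace (D.whiteB θ i v) ^ 2 +
              2 * trace (D.whiteB θ i v * D.whiteB θ i v)))) := by ring
        rw [h2]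
        refine mul_le_mul_of_nonneg_left (mul_le_mul_of_nonneg_left ?_ hρ0) (by positivity)
        linarith
    _ ≤ D.omForm α θ i v := by
        rw [omForm]
        exact mul_le_mul_of_nonneg_left h (by positivity)

theorem psiForm_nonneg (hα : 0 ≤ α) (i : ℕ) (v : Param k r) : 0 ≤ D.psiForm α θ i v := by
  have h0 := (hW i).trace_sq_nonneg v
  have hη := D.eta_nonneg (α := α) hθ i
  rw [psiForm]
  positivity

/-- On groups of size at most `M`, the form of `Ω_n` dominates a multiple of that of `Ψ_n`. -/
theorem exists_mul_psiForm_le_omForm (hα : 0 ≤ α) {C : ℝ} (hdet : ∀ i, (D.V θ i).det ≤ C)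
    (M : ℕ) : ∃ c : ℝ, 0 < c ∧ ∀ i, D.m i ≤ M → ∀ v,
      c * D.psiForm α θ i v ≤ D.omForm α θ i v := by
  have hκ := sub_pos.2 (proportion_lt_one hα)
  have hC : 0 < C := (D.V_posDef hθ 0).det_pos.trans_le (hdet 0)
  have hpi : (1 : ℝ) ≤ 2 * Real.pi := by linarith [Real.pi_gt_three]
  -- The first factor is the smallest possible `η_i` for groups of size at most `M`.
  refine ⟨((2 * Real.pi) ^ (-(M * α / 2)) * C ^ (-(α / 2))) *
    ((1 - (1 + 2 * α) ^ 2 / (4 * (1 + α) ^ 2)) / (1 + 2 * α) ^ ((M : ℝ) / 2 + 2)), by positivity,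
    fun i hi v => (mul_le_mul_of_nonneg_right ?_ (D.psiForm_nonneg hθ hW hα i v)).trans
      (D.omForm_ge hθ hW hα i v)⟩
  have hi' : (D.m i : ℝ) ≤ M := by exact_mod_cast hi
  have hη := D.eta_nonneg (α := α) hθ i
  refine mul_le_mul ?_ ?_ (by positivity) hη
  · rw [eta]
    refine mul_le_mul ?_ ?_ (by positivity) (by positivity)
    · refine Real.rpow_le_rpow_of_exponent_le hpi ?_
      have := mul_le_mul_of_nonneg_right hi' hα
      linarith
    · exact Real.rpow_le_rpow_of_nonpos (D.V_posDef hθ i).det_pos (hdet i) (by linarith)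
  · refine div_le_div_of_nonneg_left hκ.le (by positivity) ?_
    exact Real.rpow_le_rpow_of_exponent_le (by linarith) (by linarith)

theorem exists_Omega_le (hα : 0 ≤ α) {C : ℝ}
    (hC : ∀ n : ℕ, ∑ i ∈ Finset.range n, (1 + D.m i : ℝ) ^ 3 ≤ C * n) :
    ∃ c : ℝ, 0 ≤ c ∧ ∀ (n : ℕ) (v : Fin k ⊕ Fin (r + 1) → ℝ),
      v ⬝ᵥ (D.Omega α θ n *ᵥ v) ≤ c * (v ⬝ᵥ v) := by
  have hC0 : 0 ≤ C := by
    have := hC 1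
    simp only [Finset.sum_range_one, Nat.cast_one, mul_one] at this
    exact le_trans (by positivity) this
  refine ⟨Mη ^ 2 * (K ^ 2 * (1 + α ^ 2)) * C, by positivity, fun n v => ?_⟩
  have h := D.dotProduct_Omega (α := α) hθ n (WithLp.toLp 2 v)
  rw [WithLp.ofLp_toLp] at h
  rw [h, dotProduct_self_eq_norm_sq]
  rcases n.eq_zero_or_pos with rfl | hn
  · simp only [Finset.range_zero, Finset.sum_empty, mul_zero]
    positivity
  have hn' : (0 : ℝ) < n := by exact_mod_cast hn
  rw [one_div, inv_mul_le_iff₀ hn']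
  calc _ ≤ ∑ i ∈ Finset.range n, Mη ^ 2 * (K ^ 2 * (1 + α ^ 2)) * ‖WithLp.toLp 2 v‖ ^ 2 *
        (1 + D.m i : ℝ) ^ 3 := by
        refine Finset.sum_le_sum fun i _ => (D.omForm_le_size hθ hW hα i _).trans ?_
        have hm : (0 : ℝ) ≤ D.m i := Nat.cast_nonneg _
        have : (1 + D.m i : ℝ) ^ 2 ≤ (1 + D.m i : ℝ) ^ 3 :=
          pow_le_pow_right₀ (by linarith) (by norm_num)
        calc _ = Mη ^ 2 * (K ^ 2 * (1 + α ^ 2)) * ‖WithLp.toLp 2 v‖ ^ 2 *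
              (1 + D.m i : ℝ) ^ 2 := by ring
          _ ≤ _ := by gcongr
    _ ≤ Mη ^ 2 * (K ^ 2 * (1 + α ^ 2)) * ‖WithLp.toLp 2 v‖ ^ 2 * (C * n) := by
        rw [← Finset.mul_sum]
        gcongr
        exact hC n
    _ = _ := by ring

/-- A positive lower bound for `Ψ_n` passes to `Ω_n`: groups larger than a fixed `M` contribute
little to `Ψ_n`, and the others are compared term by term. -/
theorem exists_le_Omega (hα : 0 ≤ α) {C C' : ℝ} (hdet : ∀ i, (D.V θ i).det ≤ C')
    (hC : ∀ n : ℕ, ∑ i ∈ Finset.range n, (1 + D.m i : ℝ) ^ 3 ≤ C * n) {c : ℝ} (hc : 0 < c)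
    (hPsi : ∀ᶠ n in atTop, ∀ v : Fin k ⊕ Fin (r + 1) → ℝ,
      c * (v ⬝ᵥ v) ≤ v ⬝ᵥ (D.Psi α θ n *ᵥ v)) :
    ∃ c' : ℝ, 0 < c' ∧ ∀ᶠ n in atTop, ∀ v : Fin k ⊕ Fin (r + 1) → ℝ,
      c' * (v ⬝ᵥ v) ≤ v ⬝ᵥ (D.Omega α θ n *ᵥ v) := by
  have hM0 : 0 ≤ Mη := (D.eta_nonneg (α := α) hθ 0).trans (D.eta_le hW 0)
  set a := Mη * (K ^ 2 * (1 + α ^ 2)) with ha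
  have ha0 : 0 ≤ a := by positivity
  -- With this `M` the groups larger than `M` contribute at most `c / 2` to `Ψ_n`.
  obtain ⟨M, hM⟩ := exists_nat_ge (2 * a * C / c)
  obtain ⟨b, hb, hbM⟩ := D.exists_mul_psiForm_le_omForm hθ hW hα hdet M
  refine ⟨b * (c / 2), by positivity, ?_⟩
  filter_upwards [hPsi, eventually_gt_atTop 0] with n hn hn0 v
  have hn' : (0 : ℝ) < n := by exact_mod_cast hn0
  have h1 := hn v
  have e1 := D.dotProduct_Psi (α := α) hθ n (WithLp.toLp 2 v)
  have e2 := D.dotProduct_Omega (α := α) hθ n (WithLp.toLp 2 v)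
  rw [WithLp.ofLp_toLp] at e1 e2
  rw [e1, dotProduct_self_eq_norm_sq] at h1
  rw [e2, dotProduct_self_eq_norm_sq]
  set x : Param k r := WithLp.toLp 2 v
  have hterm : ∀ i, D.psiForm α θ i x ≤
      b⁻¹ * D.omForm α θ i x + a * ‖x‖ ^ 2 / (1 + M) * (1 + D.m i : ℝ) ^ 3 := fun i => by
    have hm : (0 : ℝ) ≤ D.m i := Nat.cast_nonneg _
    have hMn : (0 : ℝ) ≤ M := Nat.cast_nonneg _
    rcases le_or_gt (D.m i) M with hi | hi
    · have h2 := hbM i hi x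
      have h3 : D.psiForm α θ i x ≤ b⁻¹ * D.omForm α θ i x := by
        rw [le_inv_mul_iff₀ hb]; exact h2
      have : 0 ≤ a * ‖x‖ ^ 2 / (1 + M) * (1 + D.m i : ℝ) ^ 3 := by positivity
      linarith
    · have h2 := D.psiForm_le_size hθ hW hα i x
      have h3 : 0 ≤ D.omForm α θ i x := by
        refine le_trans ?_ (D.omForm_ge hθ hW hα i x)
        have := D.psiForm_nonneg hθ hW hα i x
        have := D.eta_nonneg (α := α) hθ i
        have := sub_nonneg.2 (proportion_lt_one hα).le
        positivity
      have hi' : (M : ℝ) ≤ D.m i := by exact_mod_cast hi.le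
      have h4 : Mη * (K ^ 2 * (1 + α ^ 2) * (1 + D.m i) ^ 2 * ‖x‖ ^ 2) ≤
          a * ‖x‖ ^ 2 / (1 + M) * (1 + D.m i : ℝ) ^ 3 := by
        rw [div_mul_eq_mul_div, le_div_iff₀ (by positivity)]
        calc _ = a * ‖x‖ ^ 2 * (1 + D.m i : ℝ) ^ 2 * (1 + M) := by rw [ha]; ring
          _ ≤ a * ‖x‖ ^ 2 * (1 + D.m i : ℝ) ^ 2 * (1 + D.m i) := by gcongr
          _ = _ := by ring
      have : 0 ≤ b⁻¹ * D.omForm α θ i x := by positivity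
      linarith
  have hsum : ∑ i ∈ Finset.range n, D.psiForm α θ i x ≤
      b⁻¹ * ∑ i ∈ Finset.range n, D.omForm α θ i x + a * ‖x‖ ^ 2 / (1 + M) * (C * n) := by
    refine (Finset.sum_le_sum fun i _ => hterm i).trans ?_
    rw [Finset.sum_add_distrib, ← Finset.mul_sum, ← Finset.mul_sum]
    gcongr
    exact hC n
  have hMc : a * C / (1 + M) ≤ c / 2 := by
    rw [div_le_iff₀ (by positivity)]
    rw [div_le_iff₀ hc] at hM
    nlinarith
  have h5 : a * ‖x‖ ^ 2 / (1 + M) * (C * n) ≤ c / 2 * ‖x‖ ^ 2 * n := by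
    calc _ = a * C / (1 + M) * (‖x‖ ^ 2 * n) := by ring
      _ ≤ c / 2 * (‖x‖ ^ 2 * n) := by gcongr
      _ = _ := by ring
  rw [one_div, le_inv_mul_iff₀ hn'] at h1 ⊢
  have h6 : c / 2 * ‖x‖ ^ 2 * n ≤ b⁻¹ * ∑ i ∈ Finset.range n, D.omForm α θ i x := by linarith
  rw [le_inv_mul_iff₀ hb] at h6
  linarith

end Forms

end Design


/-! ### The diagonal blocks of `Ψ_n` and `Ω_n` -/

section Blocks

variable {ι κ : Type*} [Fintype ι] [Fintype κ] [DecidableEq ι] [DecidableEq κ]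

theorem le_quadForm_blocks {A : Matrix ι ι ℝ} {B : Matrix κ κ ℝ} {c : ℝ}
    (h : ∀ v : ι ⊕ κ → ℝ, c * (v ⬝ᵥ v) ≤ v ⬝ᵥ (Matrix.fromBlocks A 0 0 B *ᵥ v)) :
    (∀ v : ι → ℝ, c * (v ⬝ᵥ v) ≤ v ⬝ᵥ (A *ᵥ v)) ∧
      ∀ v : κ → ℝ, c * (v ⬝ᵥ v) ≤ v ⬝ᵥ (B *ᵥ v) := by
  constructor
  · intro v
    have := h (Sum.elim v 0)
    rw [dotProduct_fromBlocks_mulVec] at this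
    simpa [dotProduct, Fintype.sum_sum_type] using this
  · intro v
    have := h (Sum.elim 0 v)
    rw [dotProduct_fromBlocks_mulVec] at this
    simpa [dotProduct, Fintype.sum_sum_type] using this

theorem quadForm_blocks_le {A : Matrix ι ι ℝ} {B : Matrix κ κ ℝ} {c : ℝ}
    (h : ∀ v : ι ⊕ κ → ℝ, v ⬝ᵥ (Matrix.fromBlocks A 0 0 B *ᵥ v) ≤ c * (v ⬝ᵥ v)) :
    (∀ v : ι → ℝ, v ⬝ᵥ (A *ᵥ v) ≤ c * (v ⬝ᵥ v)) ∧
      ∀ v : κ → ℝ, v ⬝ᵥ (B *ᵥ v) ≤ c * (v ⬝ᵥ v) := by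
  constructor
  · intro v
    have := h (Sum.elim v 0)
    rw [dotProduct_fromBlocks_mulVec] at this
    simpa [dotProduct, Fintype.sum_sum_type] using this
  · intro v
    have := h (Sum.elim 0 v)
    rw [dotProduct_fromBlocks_mulVec] at this
    simpa [dotProduct, Fintype.sum_sum_type] using this

theorem isHermitian_average {M : ℕ → Matrix ι ι ℝ} (hM : ∀ i, (M i).IsHermitian) (a : ℕ → ℝ)
    (c : ℝ) (n : ℕ) : (c • ∑ i ∈ Finset.range n, a i • M i).IsHermitian := by
  rw [Matrix.IsHermitian, Matrix.conjTranspose_smul, Matrix.conjTranspose_sum]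
  simp only [Matrix.conjTranspose_smul, (hM _).eq, star_trivial]

theorem average_fromBlocks (A : ℕ → Matrix ι ι ℝ) (B : ℕ → Matrix κ κ ℝ) (a : ℕ → ℝ) (c : ℝ)
    (n : ℕ) :
    c • ∑ i ∈ Finset.range n, a i • Matrix.fromBlocks (A i) 0 0 (B i) =
      Matrix.fromBlocks (c • ∑ i ∈ Finset.range n, a i • A i) 0 0
        (c • ∑ i ∈ Finset.range n, a i • B i) := by
  ext x y
  rcases x with x | x <;> rcases y with y | y <;> simp [Matrix.sum_apply]

end Blocks

namespace Design

variable {k r : ℕ} (D : Design k r) {α : ℝ} {θ : Param k r}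

/-- The block of `Ψ_n` for the fixed effects. -/
noncomputable def psiFixed (α : ℝ) (θ : Param k r) (n : ℕ) : Matrix (Fin k) (Fin k) ℝ :=
  (1 / n : ℝ) • ∑ i ∈ Finset.range n, (D.eta α θ i / 4) • D.J11 α θ i

/-- The block of `Ψ_n` for the variance components. -/
noncomputable def psiVar (α : ℝ) (θ : Param k r) (n : ℕ) :
    Matrix (Fin (r + 1)) (Fin (r + 1)) ℝ :=
  (1 / n : ℝ) • ∑ i ∈ Finset.range n, (D.eta α θ i / 4) • D.J22 α θ i

/-- The block of `Ω_n` for the fixed effects. -/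
noncomputable def omFixed (α : ℝ) (θ : Param k r) (n : ℕ) : Matrix (Fin k) (Fin k) ℝ :=
  (1 / n : ℝ) • ∑ i ∈ Finset.range n, (D.eta α θ i ^ 2 / 4) • D.Om11 α θ i

/-- The block of `Ω_n` for the variance components. -/
noncomputable def omVar (α : ℝ) (θ : Param k r) (n : ℕ) :
    Matrix (Fin (r + 1)) (Fin (r + 1)) ℝ :=
  (1 / n : ℝ) • ∑ i ∈ Finset.range n, (D.eta α θ i ^ 2 / 4) • D.Om22 α θ i

theorem Psi_eq_fromBlocks (n : ℕ) :
    D.Psi α θ n = Matrix.fromBlocks (D.psiFixed α θ n) 0 0 (D.psiVar α θ n) :=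
  average_fromBlocks _ _ _ _ _

theorem Omega_eq_fromBlocks (n : ℕ) :
    D.Omega α θ n = Matrix.fromBlocks (D.omFixed α θ n) 0 0 (D.omVar α θ n) :=
  average_fromBlocks _ _ _ _ _

theorem isHermitian_gram (hθ : θ ∈ paramSpace k r) (i : ℕ) (c : ℝ) :
    (c • ((D.X i)ᵀ * (D.V θ i)⁻¹ * D.X i)).IsHermitian := by
  have hV : ((D.V θ i)⁻¹)ᵀ = (D.V θ i)⁻¹ := by
    simpa using (D.V_posDef hθ i).1.inv.eq
  rw [Matrix.IsHermitian, Matrix.conjTranspose_eq_transpose_of_trivial, Matrix.transpose_smul,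
    Matrix.transpose_mul, Matrix.transpose_mul, hV, Matrix.transpose_transpose, Matrix.mul_assoc]

theorem T_comm {p : ℕ} (c : ℝ) (A B : Matrix (Fin p) (Fin p) ℝ) : T α c A B = T α c B A := by
  rw [T, T, Matrix.trace_mul_comm A B]
  ring

theorem isHermitian_psiFixed (hθ : θ ∈ paramSpace k r) (n : ℕ) :
    (D.psiFixed α θ n).IsHermitian :=
  isHermitian_average (fun i => D.isHermitian_gram hθ i _) _ _ _

theorem isHermitian_omFixed (hθ : θ ∈ paramSpace k r) (n : ℕ) :
    (D.omFixed α θ n).IsHermitian :=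
  isHermitian_average (fun i => D.isHermitian_gram hθ i _) _ _ _

theorem isHermitian_psiVar (n : ℕ) : (D.psiVar α θ n).IsHermitian := by
  refine isHermitian_average (fun i => ?_) _ _ _
  ext j l
  simp [J22, T_comm]

theorem isHermitian_omVar (n : ℕ) : (D.omVar α θ n).IsHermitian := by
  refine isHermitian_average (fun i => ?_) _ _ _
  ext j l
  simp only [Matrix.conjTranspose_apply, star_trivial, Om22, Matrix.of_apply,
    T_comm 4 (D.VU θ i j) (D.VU θ i l)]
  ring

theorem stack_gram (B : (i : ℕ) → Matrix (Fin (D.m i)) (Fin k) ℝ) (n : ℕ) :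
    (D.stack B n)ᵀ * D.stack B n = ∑ i ∈ Finset.range n, (B i)ᵀ * B i := by
  ext a b
  rw [Matrix.mul_apply, Fintype.sum_sigma, Matrix.sum_apply,
    ← Fin.sum_univ_eq_sum_range (fun i => ((B i)ᵀ * B i) a b)]
  simp [stack, Matrix.mul_apply]

theorem sqrt_mul_gram (hθ : θ ∈ paramSpace k r) (i : ℕ) {c : ℝ} (hc : 0 ≤ c) :
    (CFC.sqrt (c • (D.V θ i)⁻¹) * D.X i)ᵀ * (CFC.sqrt (c • (D.V θ i)⁻¹) * D.X i) =
      c • ((D.X i)ᵀ * (D.V θ i)⁻¹ * D.X i) := by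
  have h : CFC.sqrt (c • (D.V θ i)⁻¹) * CFC.sqrt (c • (D.V θ i)⁻¹) = c • (D.V θ i)⁻¹ :=
    CFC.sqrt_mul_sqrt_self _
      (Matrix.nonneg_iff_posSemidef.2 ((D.V_posDef hθ i).inv.posSemidef.smul hc))
  rw [Matrix.transpose_mul, transpose_sqrt, Matrix.mul_assoc, ← Matrix.mul_assoc (CFC.sqrt _), h]
  simp [Matrix.mul_assoc]

theorem gramPrime_eq (hα : 0 ≤ α) (hθ : θ ∈ paramSpace k r) (n : ℕ) :
    D.gramPrime α θ n = (n : ℝ) • D.psiFixed α θ n := by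
  rw [gramPrime, stack_gram, psiFixed, smul_smul]
  rcases n.eq_zero_or_pos with rfl | hn
  · simp
  have hn' : (n : ℝ) ≠ 0 := by exact_mod_cast hn.ne'
  rw [mul_one_div_cancel hn', one_smul]
  refine Finset.sum_congr rfl fun i _ => ?_
  have hη := D.eta_nonneg (α := α) hθ i
  rw [Xprime, D.sqrt_mul_gram hθ i (by positivity), J11, smul_smul]
  congr 1
  ring

theorem gramStar_eq (hα : 0 ≤ α) (hθ : θ ∈ paramSpace k r) (n : ℕ) :
    D.gramStar α θ n = (n : ℝ) • D.omFixed α θ n := by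
  rw [gramStar, stack_gram, omFixed, smul_smul]
  rcases n.eq_zero_or_pos with rfl | hn
  · simp
  have hn' : (n : ℝ) ≠ 0 := by exact_mod_cast hn.ne'
  rw [mul_one_div_cancel hn', one_smul]
  refine Finset.sum_congr rfl fun i _ => ?_
  rw [Xstar, D.sqrt_mul_gram hθ i (by positivity), Om11, smul_smul]
  congr 1
  ring

theorem exists_le_Psi (hα : 0 ≤ α) (hθ : θ ∈ paramSpace k r) (h1 : D.MM1 α θ)
    (h2 : D.VarianceInfo α θ) :
    ∃ c : ℝ, 0 < c ∧ ∀ᶠ n in atTop, ∀ v : Fin k ⊕ Fin (r + 1) → ℝ,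
      c * (v ⬝ᵥ v) ≤ v ⬝ᵥ (D.Psi α θ n *ᵥ v) := by
  obtain ⟨c₁, hc₁, h1⟩ := h1
  obtain ⟨c₂, hc₂, h2⟩ := h2
  refine ⟨min c₁ c₂, lt_min hc₁ hc₂, ?_⟩
  filter_upwards [h1, h2, eventually_gt_atTop 0] with n h1 h2 hn v
  have hn' : (n : ℝ) ≠ 0 := by exact_mod_cast hn.ne'
  have h1' := h1 (v ∘ Sum.inl)
  have h2' := h2 (v ∘ Sum.inr)
  rw [D.gramPrime_eq hα hθ, smul_smul, one_div_mul_cancel hn', one_smul] at h1'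
  rw [D.Psi_eq_fromBlocks, dotProduct_fromBlocks_mulVec]
  have e : v ⬝ᵥ v = (v ∘ Sum.inl) ⬝ᵥ (v ∘ Sum.inl) + (v ∘ Sum.inr) ⬝ᵥ (v ∘ Sum.inr) := by
    simp [dotProduct, Fintype.sum_sum_type]
  rw [e, mul_add]
  have p1 : 0 ≤ (v ∘ Sum.inl) ⬝ᵥ (v ∘ Sum.inl) := by
    rw [dotProduct_self_eq_norm_sq]; positivity
  have p2 : 0 ≤ (v ∘ Sum.inr) ⬝ᵥ (v ∘ Sum.inr) := by
    rw [dotProduct_self_eq_norm_sq]; positivity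
  refine add_le_add (le_trans ?_ h1') (le_trans ?_ h2')
  · gcongr; exact min_le_left _ _
  · gcongr; exact min_le_right _ _

end Design


/-! ### Consistent roots and their limit law -/

section Probability

variable {S : Type*} [MeasurableSpace S] {μ : Measure S} {E F : Type*} [NormedAddCommGroup E]
  [NormedSpace ℝ E] [NormedAddCommGroup F] [NormedSpace ℝ F]

/-- A sequence of order `n ^ (-1/2)` in probability tends to zero in probability. -/
theorem BoundedInProbability.tendstoInMeasure_zero {T : ℕ → S → E}
    (h : BoundedInProbability (fun (n : ℕ) ω => √(n : ℝ) • T n ω) μ) :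
    TendstoInMeasure μ T atTop fun _ => 0 := by
  refine tendstoInMeasure_iff_norm.2 fun ε hε => ENNReal.tendsto_nhds_zero.2 fun η hη => ?_
  obtain ⟨M, -, hM⟩ := h η hη
  have h1 : Tendsto (fun n : ℕ => √(n : ℝ) * ε) atTop atTop :=
    (Real.tendsto_sqrt_atTop.comp tendsto_natCast_atTop_atTop).atTop_mul_const hε
  filter_upwards [hM, h1.eventually_gt_atTop M] with n hn hn1
  refine le_trans (measure_mono ?_) hn
  intro ω hω
  rw [Set.mem_ofPred_eq, sub_zero] at hω
  rw [Set.mem_ofPred_eq, norm_smul, Real.norm_of_nonneg (Real.sqrt_nonneg _)]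
  exact hn1.trans_le (by gcongr)

/-- Convergence to zero in probability is preserved by bounded sequences of linear maps. -/
theorem tendstoInMeasure_clm_apply {R : ℕ → S → E} (hR : TendstoInMeasure μ R atTop fun _ => 0)
    {Q : ℕ → E →L[ℝ] F} {c : ℝ} (hQ : ∀ᶠ n in atTop, ‖Q n‖ ≤ c) :
    TendstoInMeasure μ (fun n ω => Q n (R n ω)) atTop fun _ => 0 := by
  refine tendstoInMeasure_iff_norm.2 fun ε hε => ?_
  have hc : 0 < |c| + 1 := by positivity
  have h1 := tendstoInMeasure_iff_norm.1 hR (ε / (|c| + 1)) (by positivity)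
  refine tendsto_of_tendsto_of_tendsto_of_le_of_le' tendsto_const_nhds h1
    (Eventually.of_forall fun _ => zero_le) ?_
  filter_upwards [hQ] with n hn
  refine measure_mono ?_
  intro ω hω
  rw [Set.mem_ofPred_eq, sub_zero] at hω ⊢
  rw [div_le_iff₀ hc]
  have h2 : ‖Q n (R n ω)‖ ≤ (|c| + 1) * ‖R n ω‖ :=
    (Q n).le_of_opNorm_le (hn.trans ((le_abs_self c).trans (by linarith))) _
  linarith

theorem TendstoInDistribution.congr_eventually [IsProbabilityMeasure μ] {E Ω' : Type*}
    [NormedAddCommGroup E] [MeasurableSpace E] [BorelSpace E] [SecondCountableTopology E]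
    [MeasurableSpace Ω'] {ν : Measure Ω'} [IsProbabilityMeasure ν] {X X' : ℕ → S → E} {Z : Ω' → E}
    (h : TendstoInDistribution X atTop Z (fun _ => μ) ν) (hX' : ∀ n, AEMeasurable (X' n) μ)
    (he : ∀ᶠ n in atTop, ∀ ω, X' n ω = X n ω) :
    TendstoInDistribution X' atTop Z (fun _ => μ) ν := by
  refine tendstoInDistribution_of_tendstoInMeasure_sub X' Z h ?_ hX'
  refine tendstoInMeasure_iff_norm.2 fun ε hε => ?_
  refine tendsto_const_nhds.congr' (he.mono fun n hn => ?_)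
  simp [hn, not_le.2 hε]

end Probability

namespace Design

variable {k r : ℕ} (D : Design k r) {α : ℝ} {θ : Param k r}

section Limit

theorem isHermitian_Psi (hθ : θ ∈ paramSpace k r) (n : ℕ) : (D.Psi α θ n).IsHermitian := by
  rw [Psi_eq_fromBlocks]
  exact (D.isHermitian_psiFixed hθ n).fromBlocks (by simp) (D.isHermitian_psiVar n)

theorem isHermitian_Omega (hθ : θ ∈ paramSpace k r) (n : ℕ) : (D.Omega α θ n).IsHermitian := by
  rw [Omega_eq_fromBlocks]
  exact (D.isHermitian_omFixed hθ n).fromBlocks (by simp) (D.isHermitian_omVar n)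

theorem eventually_inverse_info (hα : 0 ≤ α) (hθ : θ ∈ paramSpace k r) {c : ℝ} (hc : 0 < c)
    (hPsi : ∀ᶠ n in atTop, ∀ v : Fin k ⊕ Fin (r + 1) → ℝ,
      c * (v ⬝ᵥ v) ≤ v ⬝ᵥ (D.Psi α θ n *ᵥ v)) :
    ∀ᶠ n in atTop,
      (∀ v, Matrix.toEuclideanCLM (𝕜 := ℝ) ((1 + α) • D.Psi α θ n)⁻¹
        (Matrix.toEuclideanCLM (𝕜 := ℝ) ((1 + α) • D.Psi α θ n) v) = v) ∧
      (∀ v, Matrix.toEuclideanCLM (𝕜 := ℝ) ((1 + α) • D.Psi α θ n)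
        (Matrix.toEuclideanCLM (𝕜 := ℝ) ((1 + α) • D.Psi α θ n)⁻¹ v) = v) ∧
      ∀ v, ‖Matrix.toEuclideanCLM (𝕜 := ℝ) ((1 + α) • D.Psi α θ n)⁻¹ v‖ ≤ c⁻¹ * ‖v‖ := by
  filter_upwards [hPsi] with n hn
  set P := (1 + α) • D.Psi α θ n with hP
  have hH : P.IsHermitian := by
    rw [hP, Matrix.IsHermitian, Matrix.conjTranspose_smul, (D.isHermitian_Psi hθ n).eq,
      star_trivial]
  have hb : ∀ v : Fin k ⊕ Fin (r + 1) → ℝ, c * (v ⬝ᵥ v) ≤ v ⬝ᵥ (P *ᵥ v) := fun v => by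
    have h0 : 0 ≤ c * (v ⬝ᵥ v) := by rw [dotProduct_self_eq_norm_sq]; positivity
    rw [hP, Matrix.smul_mulVec, dotProduct_smul, smul_eq_mul]
    have := hn v
    nlinarith
  have hu : IsUnit P.det := (posDef_of_forall_le hH hc hb).det_pos.ne'.isUnit
  refine ⟨fun v => ?_, fun v => ?_, norm_toEuclideanCLM_inv_le hH hc hb⟩
  · rw [← ContinuousLinearMap.comp_apply, ← ContinuousLinearMap.mul_def, ← map_mul,
      Matrix.nonsing_inv_mul _ hu, map_one, one_apply_eq_self]
  · rw [← ContinuousLinearMap.comp_apply, ← ContinuousLinearMap.mul_def, ← map_mul,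
      Matrix.mul_nonsing_inv _ hu, map_one, one_apply_eq_self]

variable {K δ Mη C : ℝ} {S : Type*} [MeasurableSpace S] {μ : Measure S} [IsProbabilityMeasure μ]
  {Y : (i : ℕ) → S → EuclideanSpace ℝ (Fin (D.m i))}

/-- The standardized residuals `V_i^{-1/2} (Y_i - X_i β)` turn the mixed model into a system of
white groups. -/
theorem whiteSystem (hθ : θ ∈ paramSpace k r) (hY : D.IsModel θ Y μ)
    (hW : ∀ i, WhiteGroup (D.whiteB θ i) (D.whiteZ θ i) α (fun h => D.eta α (θ + h) i) K δ Mη)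
    (hC : ∀ n : ℕ, ∑ i ∈ Finset.range n, (1 + D.m i : ℝ) ^ 3 ≤ C * n) :
    WhiteSystem (D.whiteB θ) (D.whiteZ θ) α (fun i h => D.eta α (θ + h) i)
      (fun i ω => D.whiteNoise θ i (Y i ω)) μ K δ Mη C where
  group := hW
  indep := hY.indep.comp _ fun i => (D.continuous_whiteNoise i).measurable
  law := D.hasLaw_whiteNoise hθ hY
  size := by simpa using hC

theorem locallyLinear_estEq (hα : 0 ≤ α) (hθ : θ ∈ paramSpace k r)
    (hsys : WhiteSystem (D.whiteB θ) (D.whiteZ θ) α (fun i h => D.eta α (θ + h) i)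
      (fun i ω => D.whiteNoise θ i (Y i ω)) μ K δ Mη C) :
    LocallyLinear (fun n ω h => D.estEq α (θ + h) (fun i : Fin n => Y i ω))
      (fun n => Matrix.toEuclideanCLM (𝕜 := ℝ) ((1 + α) • D.Psi α θ n)) 0 μ := by
  have h := hsys.locallyLinear (D.toEuclideanCLM_Psi_apply hα hθ hsys.group)
  have e : avgEst (D.whiteB θ) (D.whiteZ θ) α (fun i h => D.eta α (θ + h) i)
      (fun i ω => D.whiteNoise θ i (Y i ω)) =
        fun n ω h => D.estEq α (θ + h) (fun i : Fin n => Y i ω) := by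
    funext n ω h
    exact D.avgEst_white hα hθ Y n ω h
  rwa [e] at h

theorem boundedInProbability_estEq (hα : 0 ≤ α) (hθ : θ ∈ paramSpace k r)
    (hsys : WhiteSystem (D.whiteB θ) (D.whiteZ θ) α (fun i h => D.eta α (θ + h) i)
      (fun i ω => D.whiteNoise θ i (Y i ω)) μ K δ Mη C) :
    BoundedInProbability
      (fun (n : ℕ) ω => √(n : ℝ) • D.estEq α (θ + 0) (fun i : Fin n => Y i ω)) μ := by
  simpa only [D.avgEst_white hα hθ Y] using hsys.boundedInProbability_avgEst

/-- There are measurable consistent roots of the estimating equations. -/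
theorem exists_isConsistentRoots (hα : 0 ≤ α) (hθ : θ ∈ paramSpace k r) (hY : D.IsModel θ Y μ)
    (hsys : WhiteSystem (D.whiteB θ) (D.whiteZ θ) α (fun i h => D.eta α (θ + h) i)
      (fun i ω => D.whiteNoise θ i (Y i ω)) μ K δ Mη C)
    (hδ : ∀ h ∈ Metric.closedBall (0 : Param k r) δ, θ + h ∈ paramSpace k r)
    {c : ℝ} (hc : 0 < c) (hPsi : ∀ᶠ n in atTop, ∀ v : Fin k ⊕ Fin (r + 1) → ℝ,
      c * (v ⬝ᵥ v) ≤ v ⬝ᵥ (D.Psi α θ n *ᵥ v)) :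
    ∃ est : (n : ℕ) → D.Sample n → Param k r, (∀ n, Measurable (est n)) ∧
      D.IsConsistentRoots α θ Y μ (fun n ω => est n (fun i => Y i ω)) := by
  obtain ⟨est, hm, hroot, hcons⟩ := LocallyLinear.exists_measurable_roots
    (G := fun n (y : D.Sample n) h => D.estEq α (θ + h) y) (fun n => D.measurable_estEq n)
    (Y := fun n ω (i : Fin n) => Y i ω) hc (D.eventually_inverse_info hα hθ hc hPsi)
    (D.locallyLinear_estEq hα hθ hsys)
    (D.boundedInProbability_estEq hα hθ hsys).tendstoInMeasure_zero
    (Metric.closedBall_mem_nhds 0 (hsys.group 0).δ_pos)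
  refine ⟨fun n y => θ + est n y, fun n => (hm n).const_add θ, ?_, ?_, ?_⟩
  · intro n
    have hYm : AEMeasurable (fun ω (i : Fin n) => Y i ω) μ :=
      aemeasurable_pi_lambda _ fun i => (hY.law i).aemeasurable
    exact ((hm n).const_add θ).comp_aemeasurable hYm
  · refine tendsto_of_tendsto_of_tendsto_of_le_of_le tendsto_const_nhds hroot
      (fun _ => zero_le) fun n => measure_mono ?_
    intro ω hω
    rw [Set.mem_ofPred_eq] at hω ⊢
    contrapose! hω
    exact (D.isRoot_iff _).2 ⟨hδ _ hω.1, hω.2⟩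
  · refine tendstoInMeasure_iff_norm.2 fun ε hε => ?_
    simpa using tendstoInMeasure_iff_norm.1 hcons ε hε

/-- The linearization of the estimating equations and the central limit theorem for their value at
`θ` give the limit law of the roots. -/
theorem asymptoticallyStdNormal_roots (hα : 0 ≤ α) (hθ : θ ∈ paramSpace k r)
    (hsys : WhiteSystem (D.whiteB θ) (D.whiteZ θ) α (fun i h => D.eta α (θ + h) i)
      (fun i ω => D.whiteNoise θ i (Y i ω)) μ K δ Mη C)
    {c : ℝ} (hc : 0 < c) (hPsi : ∀ᶠ n in atTop, ∀ v : Fin k ⊕ Fin (r + 1) → ℝ,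
      c * (v ⬝ᵥ v) ≤ v ⬝ᵥ (D.Psi α θ n *ᵥ v)) {c' : ℝ} (hc' : 0 < c')
    (hOm : ∀ᶠ n in atTop, ∀ v : Fin k ⊕ Fin (r + 1) → ℝ,
      c' * (v ⬝ᵥ v) ≤ v ⬝ᵥ (D.Omega α θ n *ᵥ v)) {θhat : ℕ → S → Param k r}
    (hroots : D.IsConsistentRoots α θ Y μ θhat) :
    AsymptoticallyStdNormal
      (fun (n : ℕ) ω => Matrix.toEuclideanCLM (𝕜 := ℝ)
        (CFC.sqrt (D.Omega α θ n)⁻¹ * D.Psi α θ n) (√(n : ℝ) • (θhat n ω - θ))) μ := by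
  have ha : 0 < 1 + α := by linarith
  set R : ℕ → Param k r →L[ℝ] Param k r := fun n =>
    (1 + α)⁻¹ • Matrix.toEuclideanCLM (𝕜 := ℝ) (CFC.sqrt (D.Omega α θ n)⁻¹) with hR
  have hRn : ∀ᶠ n in atTop, ‖R n‖ ≤ (1 + α)⁻¹ * √c'⁻¹ := by
    filter_upwards [hOm] with n hn
    rw [hR, norm_smul, Real.norm_of_nonneg (by positivity)]
    gcongr
    exact norm_toEuclideanCLM_sqrt_inv_le (D.isHermitian_Omega hθ n) hc' hn
  have hRadj : ∀ n, ContinuousLinearMap.adjoint (R n) = R n := fun n => by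
    rw [hR, map_smulₛₗ, adjoint_toEuclideanCLM_of_transpose (transpose_sqrt _)]
    simp
  have hclt := hsys.tendstoInDistribution_avgEst (Q := fun n => -R n)
    (c := (1 + α)⁻¹ * √c'⁻¹) (by simpa using hRn) (fun t => by
      refine tendsto_const_nhds.congr' ?_
      filter_upwards [hOm] with n hn
      have hO := posDef_of_forall_le (D.isHermitian_Omega hθ n) hc' hn
      rw [map_neg, hRadj]
      simp_rw [D.integral_estFun_sq hα _ (hsys.group _)]
      rw [← Finset.mul_sum, mul_left_comm, ← D.dotProduct_Omega hθ]
      set t' := Matrix.toEuclideanCLM (𝕜 := ℝ) (CFC.sqrt (D.Omega α θ n)⁻¹) t with ht'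
      have e : (-R n) t = (-(1 + α)⁻¹) • t' := by rw [hR, ht']; simp
      rw [e, WithLp.ofLp_smul, Matrix.mulVec_smul, smul_dotProduct, dotProduct_smul]
      have e2 : t'.ofLp ⬝ᵥ (D.Omega α θ n *ᵥ t'.ofLp) =
          inner ℝ t' (Matrix.toEuclideanCLM (𝕜 := ℝ) (D.Omega α θ n) t') := by
        rw [Matrix.inner_toEuclideanCLM]
      have e3 : inner ℝ t' (Matrix.toEuclideanCLM (𝕜 := ℝ) (D.Omega α θ n) t') = ‖t‖ ^ 2 := by
        rw [ht', ← ContinuousLinearMap.adjoint_inner_right,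
          adjoint_toEuclideanCLM_of_transpose (transpose_sqrt _),
          ← ContinuousLinearMap.comp_apply, ← ContinuousLinearMap.comp_apply,
          ← ContinuousLinearMap.mul_def, ← ContinuousLinearMap.mul_def, ← map_mul, ← map_mul,
          sqrt_inv_mul_mul_sqrt_inv hO, map_one, one_apply_eq_self,
          real_inner_self_eq_norm_sq]
      rw [e2, e3, smul_eq_mul, smul_eq_mul]
      field_simp)
  simp only [D.avgEst_white hα hθ Y] at hclt
  have hlin := (D.locallyLinear_estEq hα hθ hsys).tendstoInMeasure_linearization hc
    ((D.eventually_inverse_info hα hθ hc hPsi).mono fun n hn => ⟨hn.1, hn.2.2⟩)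
    (D.boundedInProbability_estEq hα hθ hsys) (θhat := fun n ω => θhat n ω - θ)
    (by
      refine tendsto_of_tendsto_of_tendsto_of_le_of_le tendsto_const_nhds hroots.root
        (fun _ => zero_le) fun n => measure_mono ?_
      intro ω hω
      rw [Set.mem_ofPred_eq] at hω ⊢
      contrapose! hω
      rw [add_sub_cancel]
      exact ((D.isRoot_iff _).1 hω).2)
    (by
      refine tendstoInMeasure_iff_norm.2 fun ε hε => ?_
      simpa using tendstoInMeasure_iff_norm.1 hroots.consistent ε hε)
  refine tendstoInDistribution_of_tendstoInMeasure_sub _ _ hclt ?_ fun n => ?_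
  · refine (tendstoInMeasure_clm_apply hlin hRn).congr_left fun n => ?_
    refine Eventually.of_forall fun ω => ?_
    simp only [hR, Pi.sub_apply, smul_apply, map_add, neg_apply, sub_zero, sub_neg_eq_add,
      map_mul]
    rw [map_smul (Matrix.toEuclideanCLM (𝕜 := ℝ)) (1 + α), smul_apply, map_smul _ (1 + α),
      inv_smul_smul₀ ha.ne']
    rfl
  · exact (ContinuousLinearMap.continuous _).measurable.comp_aemeasurable
      (((hroots.aemeasurable n).sub_const θ).const_smul (√(n : ℝ)))

end Limit

end Design


/-! ### The limit laws of the two parts of the estimator -/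

theorem fixedPart_smul_sub (c : ℝ) (x y : Param k r) :
    fixedPart (c • (x - y)) = c • (fixedPart x - fixedPart y) := rfl

theorem varPart_smul_sub (c : ℝ) (x y : Param k r) :
    varPart (c • (x - y)) = c • (varPart x - varPart y) := rfl

namespace Design

variable {k r : ℕ} (D : Design k r) {α : ℝ} {θ : Param k r}

theorem sqrt_inv_Omega_mul_Psi {n : ℕ} (h1 : (D.omFixed α θ n).PosDef)
    (h2 : (D.omVar α θ n).PosDef) :
    CFC.sqrt (D.Omega α θ n)⁻¹ * D.Psi α θ n =
      Matrix.fromBlocks (CFC.sqrt (D.omFixed α θ n)⁻¹ * D.psiFixed α θ n) 0 0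
        (CFC.sqrt (D.omVar α θ n)⁻¹ * D.psiVar α θ n) := by
  rw [Omega_eq_fromBlocks, Psi_eq_fromBlocks, sqrt_inv_fromBlocks h1 h2,
    Matrix.fromBlocks_multiply]
  simp

variable {S : Type*} [MeasurableSpace S] {μ : Measure S} [IsProbabilityMeasure μ]

/-- The two parts of the estimator are, up to the block diagonal matrix `Ω_n^{-1/2} Ψ_n` with
bounded inverse, the two blocks of an asymptotically standard normal vector. -/
theorem asymptoticallyIndep_parts (hθ : θ ∈ paramSpace k r) {c c' C : ℝ} (hc : 0 < c)
    (hPsi : ∀ᶠ n in atTop, ∀ v : Fin k ⊕ Fin (r + 1) → ℝ,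
      c * (v ⬝ᵥ v) ≤ v ⬝ᵥ (D.Psi α θ n *ᵥ v)) (hc' : 0 < c')
    (hOm : ∀ᶠ n in atTop, ∀ v : Fin k ⊕ Fin (r + 1) → ℝ,
      c' * (v ⬝ᵥ v) ≤ v ⬝ᵥ (D.Omega α θ n *ᵥ v)) (hC : 0 ≤ C)
    (hOmC : ∀ (n : ℕ) (v : Fin k ⊕ Fin (r + 1) → ℝ),
      v ⬝ᵥ (D.Omega α θ n *ᵥ v) ≤ C * (v ⬝ᵥ v)) {θhat : ℕ → S → Param k r}
    (h : AsymptoticallyStdNormal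
      (fun (n : ℕ) ω => Matrix.toEuclideanCLM (𝕜 := ℝ)
        (CFC.sqrt (D.Omega α θ n)⁻¹ * D.Psi α θ n) (√(n : ℝ) • (θhat n ω - θ))) μ) :
    AsymptoticallyIndep
      (fun (n : ℕ) ω => √(n : ℝ) • (fixedPart (θhat n ω) - fixedPart θ))
      (fun (n : ℕ) ω => √(n : ℝ) • (varPart (θhat n ω) - varPart θ)) μ := by
  have hev : ∀ᶠ n in atTop, ((∀ v : Fin k → ℝ, c * (v ⬝ᵥ v) ≤ v ⬝ᵥ (D.psiFixed α θ n *ᵥ v)) ∧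
      ∀ v : Fin (r + 1) → ℝ, c * (v ⬝ᵥ v) ≤ v ⬝ᵥ (D.psiVar α θ n *ᵥ v)) ∧
      (∀ v : Fin k → ℝ, c' * (v ⬝ᵥ v) ≤ v ⬝ᵥ (D.omFixed α θ n *ᵥ v)) ∧
      ∀ v : Fin (r + 1) → ℝ, c' * (v ⬝ᵥ v) ≤ v ⬝ᵥ (D.omVar α θ n *ᵥ v) := by
    filter_upwards [hPsi, hOm] with n h1 h2
    rw [Psi_eq_fromBlocks] at h1
    rw [Omega_eq_fromBlocks] at h2
    exact ⟨le_quadForm_blocks h1, le_quadForm_blocks h2⟩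
  have hle : ∀ n, (∀ v : Fin k → ℝ, v ⬝ᵥ (D.omFixed α θ n *ᵥ v) ≤ C * (v ⬝ᵥ v)) ∧
      ∀ v : Fin (r + 1) → ℝ, v ⬝ᵥ (D.omVar α θ n *ᵥ v) ≤ C * (v ⬝ᵥ v) := fun n => by
    have := hOmC n
    rw [Omega_eq_fromBlocks] at this
    exact quadForm_blocks_le this
  refine asymptoticallyIndep_of_blocks h (p₁ := fixedPartCLM k r) (p₂ := varPartCLM k r)
    norm_sq_adjoint_parts (c := c⁻¹ * √C)
    (N₁ := fun n => Matrix.toEuclideanCLM (𝕜 := ℝ)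
      (CFC.sqrt (D.omFixed α θ n)⁻¹ * D.psiFixed α θ n)⁻¹)
    (N₂ := fun n => Matrix.toEuclideanCLM (𝕜 := ℝ)
      (CFC.sqrt (D.omVar α θ n)⁻¹ * D.psiVar α θ n)⁻¹) ?_ ?_ ?_ ?_
  · filter_upwards [hev] with n hn
    exact norm_toEuclideanCLM_sqrt_inv_mul_inv_le
      (posDef_of_forall_le (D.isHermitian_omFixed hθ n) hc' hn.2.1) hC (hle n).1
      (D.isHermitian_psiFixed hθ n) hc hn.1.1
  · filter_upwards [hev] with n hn
    exact norm_toEuclideanCLM_sqrt_inv_mul_inv_le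
      (posDef_of_forall_le (D.isHermitian_omVar n) hc' hn.2.2) hC (hle n).2
      (D.isHermitian_psiVar n) hc hn.1.2
  · filter_upwards [hev] with n hn ω
    have h1 := posDef_of_forall_le (D.isHermitian_omFixed hθ n) hc' hn.2.1
    have h2 := posDef_of_forall_le (D.isHermitian_omVar n) hc' hn.2.2
    have hP := posDef_of_forall_le (D.isHermitian_psiFixed hθ n) hc hn.1.1
    have hu : IsUnit (CFC.sqrt (D.omFixed α θ n)⁻¹ * D.psiFixed α θ n).det := by
      rw [Matrix.det_mul]
      exact (isUnit_det_sqrt_inv h1).mul hP.det_pos.ne'.isUnit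
    rw [fixedPartCLM_apply, D.sqrt_inv_Omega_mul_Psi h1 h2, fixedPart_toEuclideanCLM_fromBlocks,
      ← ContinuousLinearMap.comp_apply, ← ContinuousLinearMap.mul_def, ← map_mul,
      Matrix.nonsing_inv_mul _ hu, map_one, one_apply_eq_self, fixedPart_smul_sub]
  · filter_upwards [hev] with n hn ω
    have h1 := posDef_of_forall_le (D.isHermitian_omFixed hθ n) hc' hn.2.1
    have h2 := posDef_of_forall_le (D.isHermitian_omVar n) hc' hn.2.2
    have hP := posDef_of_forall_le (D.isHermitian_psiVar n) hc hn.1.2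
    have hu : IsUnit (CFC.sqrt (D.omVar α θ n)⁻¹ * D.psiVar α θ n).det := by
      rw [Matrix.det_mul]
      exact (isUnit_det_sqrt_inv h2).mul hP.det_pos.ne'.isUnit
    rw [varPartCLM_apply, D.sqrt_inv_Omega_mul_Psi h1 h2, varPart_toEuclideanCLM_fromBlocks,
      ← ContinuousLinearMap.comp_apply, ← ContinuousLinearMap.mul_def, ← map_mul,
      Matrix.nonsing_inv_mul _ hu, map_one, one_apply_eq_self, varPart_smul_sub]

/-- As `X*ᵀ X*` and `X'ᵀ X'` are `n` times the blocks of `Ω_n` and `Ψ_n` for the fixed effects,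
this is the limit law of the first block of the standardized estimator. -/
theorem asymptoticallyStdNormal_fixedPart (hα : 0 ≤ α) (hθ : θ ∈ paramSpace k r) {c' : ℝ}
    (hc' : 0 < c') (hOm : ∀ᶠ n in atTop, ∀ v : Fin k ⊕ Fin (r + 1) → ℝ,
      c' * (v ⬝ᵥ v) ≤ v ⬝ᵥ (D.Omega α θ n *ᵥ v)) {θhat : ℕ → S → Param k r}
    (hm : ∀ n, AEMeasurable (θhat n) μ)
    (h : AsymptoticallyStdNormal
      (fun (n : ℕ) ω => Matrix.toEuclideanCLM (𝕜 := ℝ)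
        (CFC.sqrt (D.Omega α θ n)⁻¹ * D.Psi α θ n) (√(n : ℝ) • (θhat n ω - θ))) μ) :
    AsymptoticallyStdNormal
      (fun (n : ℕ) ω => Matrix.toEuclideanCLM (𝕜 := ℝ)
        (CFC.sqrt (D.gramStar α θ n)⁻¹ * D.gramPrime α θ n)
        (fixedPart (θhat n ω) - fixedPart θ)) μ := by
  have hp : ∀ t, ‖ContinuousLinearMap.adjoint (fixedPartCLM k r) t‖ = ‖t‖ := fun t => by
    have := norm_sq_adjoint_parts (r := r) t 0
    rw [map_zero, add_zero, norm_zero, zero_pow two_ne_zero, add_zero] at this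
    exact (pow_left_inj₀ (norm_nonneg _) (norm_nonneg _) two_ne_zero).1 this
  have h1 := TendstoInDistribution.continuous_comp (fixedPartCLM k r).continuous h
  have h2 : AsymptoticallyStdNormal (fun (n : ℕ) ω => fixedPartCLM k r
      (Matrix.toEuclideanCLM (𝕜 := ℝ) (CFC.sqrt (D.Omega α θ n)⁻¹ * D.Psi α θ n)
        (√(n : ℝ) • (θhat n ω - θ)))) μ := by
    refine ⟨h1.forall_aemeasurable, aemeasurable_id, ?_⟩
    convert! h1.tendsto using 2
    refine congrArg 𝓝 (Subtype.ext ?_)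
    change (stdGaussian _).map id = (stdGaussian _).map (fixedPartCLM k r)
    rw [Measure.map_id, map_stdGaussian_of_adjoint_isometry hp]
  refine TendstoInDistribution.congr_eventually h2 (fun n => ?_) ?_
  · have hf : Measurable (fixedPart : Param k r → EuclideanSpace ℝ (Fin k)) :=
      (fixedPartCLM k r).continuous.measurable
    exact (ContinuousLinearMap.continuous _).measurable.comp_aemeasurable
      ((hf.comp_aemeasurable (hm n)).sub_const _)
  · filter_upwards [hOm, eventually_gt_atTop 0] with n hn hn0 ω
    have hn' : (0 : ℝ) < n := by exact_mod_cast hn0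
    rw [Omega_eq_fromBlocks] at hn
    have h1 := posDef_of_forall_le (D.isHermitian_omFixed hθ n) hc' (le_quadForm_blocks hn).1
    have h2 := posDef_of_forall_le (D.isHermitian_omVar n) hc' (le_quadForm_blocks hn).2
    have hs : (√(n : ℝ))⁻¹ * n = √(n : ℝ) := by
      rw [inv_mul_eq_div, Real.div_sqrt]
    rw [fixedPartCLM_apply, D.sqrt_inv_Omega_mul_Psi h1 h2, fixedPart_toEuclideanCLM_fromBlocks,
      D.gramStar_eq hα hθ, D.gramPrime_eq hα hθ, sqrt_inv_smul h1 hn', Matrix.smul_mul,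
      Matrix.mul_smul, smul_smul, hs, fixedPart_smul_sub,
      map_smul (Matrix.toEuclideanCLM (𝕜 := ℝ)), smul_apply, map_smul]

end Design

end MixedModel


open MixedModel in
theorem theorem1 {k r : ℕ} (D : Design k r) (α : ℝ) (hα : 0 ≤ α)
    (θ : Param k r) (hθ : θ ∈ paramSpace k r)
    {S : Type*} [MeasurableSpace S] (μ : Measure S) [IsProbabilityMeasure μ]
    (Y : (i : ℕ) → S → EuclideanSpace ℝ (Fin (D.m i))) (hY : D.IsModel θ Y μ)
    (h1 : D.MM1 α θ) (h1v : D.VarianceInfo α θ) (h2 : D.MM2 θ) (h3 : D.MM3 θ) (h4 : D.MM4 α θ) :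
    (∃ est : (n : ℕ) → D.Sample n → Param k r, (∀ n, Measurable (est n)) ∧
      D.IsConsistentRoots α θ Y μ (fun n ω => est n (fun i => Y i ω))) ∧
    ∀ θhat : ℕ → S → Param k r, D.IsConsistentRoots α θ Y μ θhat →
      AsymptoticallyIndep
        (fun (n : ℕ) ω => √(n : ℝ) • (fixedPart (θhat n ω) - fixedPart θ))
        (fun (n : ℕ) ω => √(n : ℝ) • (varPart (θhat n ω) - varPart θ)) μ ∧
      AsymptoticallyStdNormal
        (fun (n : ℕ) ω => Matrix.toEuclideanCLM (𝕜 := ℝ)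
          (CFC.sqrt (D.Omega α θ n)⁻¹ * D.Psi α θ n) (√(n : ℝ) • (θhat n ω - θ))) μ ∧
      AsymptoticallyStdNormal
        (fun (n : ℕ) ω => Matrix.toEuclideanCLM (𝕜 := ℝ)
          (CFC.sqrt (D.gramStar α θ n)⁻¹ * D.gramPrime α θ n)
          (fixedPart (θhat n ω) - fixedPart θ)) μ := by
  obtain ⟨d, C', hd, hdet⟩ := h3.det_bdd
  obtain ⟨K, δ, Mη, hW, hδ⟩ := D.exists_whiteGroup hα hθ (fun a => h2.prod_bdd a a)
    ⟨d, hd, fun i => (hdet i).1⟩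
  obtain ⟨C, hC⟩ := D.exists_sum_size_le hθ h3.tr_tr_tr
  obtain ⟨c, hc, hPsi⟩ := D.exists_le_Psi hα hθ h1 h1v
  obtain ⟨c', hc', hOm⟩ := D.exists_le_Omega hθ hW hα (fun i => (hdet i).2) hC hc hPsi
  obtain ⟨CΩ, hCΩ, hOmC⟩ := D.exists_Omega_le hθ hW hα hC
  have hsys := D.whiteSystem hθ hY hW hC
  refine ⟨D.exists_isConsistentRoots hα hθ hY hsys hδ hc hPsi, fun θhat hroots => ?_⟩
  have hN := D.asymptoticallyStdNormal_roots hα hθ hsys hc hPsi hc' hOm hroots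
  exact ⟨D.asymptoticallyIndep_parts hθ hc hPsi hc' hOm hCΩ hOmC hN, hN,
    D.asymptoticallyStdNormal_fixedPart hα hθ hc' hOm hroots.aemeasurable hN⟩
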